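/- Let $p$ be an odd prime and let $F$ be the largest Lie algebra over $\mathbb F_p$ generated by $z,c_1,c_2,\dots$ in which the $c_i$ commute with each other, every ideal $\mathrm{Id}(c_i)$ is abelian and $\mathrm{Id}(z)$ is metabelian. Lie commutators are left-normed. For a finite set $I=\{i_1<\dots<i_k\}$ of positive integers put $[z,c_I]=[z,c_{i_1},\dots,c_{i_k}]$ (so $[z,c_\varnothing]=z$), and for finite sets $I_1,\dots,I_m$ put $$\langle I_1,\dots,I_m\rangle=[[z,c_{I_1}],[z,c_{I_2}],\dots,[z,c_{I_m}]].$$ Order the elements $[z,c_I]$ by comparing the words $zc_{i_1}\cdots c_{i_k}$ lexicographically ($c_1<c_2<\cdots$), except that $z$ is the largest element. Let $X$ be the set of all $\langle I_1,\dots,I_m\rangle$ with $m\ge1$, $I_1,\dots,I_m$ pairwise disjoint and $[z,c_{I_1}]>[z,c_{I_2}]\le\dots\le[z,c_{I_m}]$ (this is the usual basis of $\mathrm{Id}(z)$). The type of $\langle I_1,\dots,I_m\rangle$ is $|I_1|+\dots+|I_m|-2m$. Let $J$ be the smallest ideal of $F$ containing * every $c\in X$, $c\ne z$, of type less than $-1$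 or greater than $1$; and * every $\langle I_1,\dots,I_m\rangle\in X$ with $m\ge2$ in which one of $I_1,I_3,\dots,I_m$ has more than two elements. Let $Z\subseteq X$ consist of the elements $[z,c_I]$ with $|I|\le3$ and of the elements $\langle I_1,\dots,I_m\rangle\in X$ with $m\ge2$, $|I_1|\le2$, $|I_2|\le3$ such that one of the following holds (in each case all sets $I_3,\dots,I_m$ that are not explicitly mentioned have size $2$, and $I_3,\dots,I_m$ are taken up to order): * $(\zeta_1)$ or $(\xi_2)$ or $(\tau_1)$: $|I_1|+|I_2|=3$, or $4$, or $5$, respectively; * $(\zeta_2)$ or $(\xi_1)$: $|I_1|+|I_2|=4$, or $5$, respectively, and one of $I_3,\dots,I_m$ has size $1$; * $(\zeta_3)$: $|I_1|+|I_2|=5$ and one of $I_3,\dots,I_m$ is empty; * $(\zeta_4)$: $|I_1|+|I_2|=5$ and two of $I_3,\dots,I_m$ have size $1$. In the following elements, $a<$ all other indices; $A,B,C$ are two-element sets; $i,j,k,s,q$ are single indices; $R$ stands for an arbitrary, possibly empty, sequence of two-element sets; all the sets and indices that occur are pairwise disjoint, respectively distinct. We write $aB$ for $\{a\}\cup B$,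 $aij$ for $\{a,i,j\}$, and so on. The relators are * E1: $\langle A,aB,i,j,R\rangle+\langle A,aB,\varnothing,ij,R\rangle$ * E2: $\langle A,ak,i,R\rangle+\langle A,aki,\varnothing,R\rangle$ * E3: $\langle i,aB,j,R\rangle+\langle ij,aB,\varnothing,R\rangle$ * E4: $\langle\varnothing,aB,C,R\rangle-\langle C,aB,\varnothing,R\rangle$ * E5: $\langle A,a,ij,R\rangle-\langle A,aij,\varnothing,R\rangle$ * E6: $\langle i,as,jk,R\rangle-\langle ij,ask,\varnothing,R\rangle-\langle ik,asj,\varnothing,R\rangle$ * E7: $\langle A,aB,\varnothing,C,R\rangle-\langle C,aB,\varnothing,A,R\rangle$ * E8: $\langle A,aB,\varnothing,R\rangle-\langle B,aA,\varnothing,R\rangle$ * E9: $\langle ik,ajs,\varnothing,R\rangle+\langle ij,aks,\varnothing,R\rangle+\langle is,ajk,\varnothing,R\rangle$ * G1: $\langle i,aB,jk,R\rangle-\langle jk,aB,i,R\rangle$ * G2: $\langle A,ak,ij,R\rangle-\langle A,aij,k,R\rangle$ * G3: $\langle A,aB,k,R\rangle-\langle B,aA,k,R\rangle$ * G4: $\langle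 A,aB,k,C,R\rangle-\langle C,aB,k,A,R\rangle$ * G5: $\langle ik,ajs,q,R\rangle+\langle ij,aks,q,R\rangle+\langle is,ajk,q,R\rangle$ * G6: $\langle A,aik,j,R\rangle+\langle A,akj,i,R\rangle+\langle A,aij,k,R\rangle$ * H1: $\langle A,aB,R\rangle-\langle B,aA,R\rangle$ * H2: $\langle A,aB,C,R\rangle-\langle C,aB,A,R\rangle$ * H3: $\langle ik,ajs,R\rangle+\langle ij,aks,R\rangle+\langle is,akj,R\rangle$ and, in degree two in $z$ and of type $-1$ or $0$ (where E1–E9 and G1–G6 have no members), * D1: $\langle i,aj\rangle+\langle\varnothing,aij\rangle$ * D2: $\langle ij,a\rangle-\langle\varnothing,aij\rangle$ * D3: $\langle ij,ak\rangle-\langle k,aij\rangle$ * D4: $\langle i,ajk\rangle+\langle j,aik\rangle+\langle k,aij\rangle$. Then $J=V+V_2$, where $V$ is the subspace of $F$ spanned by $X\setminus Z$ and all the relators E1–E9, G1–G6, H1–H3, and $V_2$ is the subspace spanned by all the relators D1–D4. In particular $V+V_2$ is an ideal of $F$. -/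

import Mathlib

open scoped Finset

namespace MetabelianLie

noncomputable section

/-- The letters `z, c 0, c 1, c 2, …`. -/
inductive Letter : Type
  | z : Letter
  | c : ℕ → Letter

/-- The Lie ideal generated by a single element. -/
def principalIdeal (K : Type*) {A : Type*} [CommRing K] [LieRing A] [LieAlgebra K A] (x : A) :
    LieIdeal K A :=
  LieSubmodule.lieSpan K A {x}

/-- The free Lie algebra on `z, c 0, c 1, …` over the field with `p` elements. -/
abbrev Free (p : ℕ) : Type := FreeLieAlgebra (ZMod p) Letter

/-- The relators of `F`: the `c i` commute with each other, the ideal generated by each `c i`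
is abelian, and the ideal generated by `z` is metabelian. -/
inductive FRel (p : ℕ) : Free p → Prop
  | comm (i j : ℕ) :
      FRel p ⁅FreeLieAlgebra.of (ZMod p) (Letter.c i), FreeLieAlgebra.of (ZMod p) (Letter.c j)⁆
  | abelian (i : ℕ) (u v : Free p)
      (hu : u ∈ principalIdeal (ZMod p) (FreeLieAlgebra.of (ZMod p) (Letter.c i)))
      (hv : v ∈ principalIdeal (ZMod p) (FreeLieAlgebra.of (ZMod p) (Letter.c i))) :
      FRel p ⁅u, v⁆
  | metabelian (u v u' v' : Free p)
      (hu : u ∈ principalIdeal (ZMod p) (FreeLieAlgebra.of (ZMod p) Letter.z))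
      (hv : v ∈ principalIdeal (ZMod p) (FreeLieAlgebra.of (ZMod p) Letter.z))
      (hu' : u' ∈ principalIdeal (ZMod p) (FreeLieAlgebra.of (ZMod p) Letter.z))
      (hv' : v' ∈ principalIdeal (ZMod p) (FreeLieAlgebra.of (ZMod p) Letter.z)) :
      FRel p ⁅⁅u, v⁆, ⁅u', v'⁆⁆

/-- The ideal of relations of `F`. -/
def FIdeal (p : ℕ) : LieIdeal (ZMod p) (Free p) :=
  LieSubmodule.lieSpan (ZMod p) (Free p) {w | FRel p w}

/-- `F`: the largest Lie algebra over the field with `p` elements generated by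
`z, c 0, c 1, …` in which the `c i` commute, every `Id(c i)` is abelian and `Id(z)` is
metabelian. -/
abbrev F (p : ℕ) : Type := Free p ⧸ FIdeal p

/-- The generator `z` of `F`. -/
def z (p : ℕ) : F p :=
  LieSubmodule.Quotient.mk (N := FIdeal p) (FreeLieAlgebra.of (ZMod p) Letter.z)

/-- The generators `c i` of `F`. -/
def c (p : ℕ) (i : ℕ) : F p :=
  LieSubmodule.Quotient.mk (N := FIdeal p) (FreeLieAlgebra.of (ZMod p) (Letter.c i))

/-- `[z, c_I]`, the left-normed commutator `[z, c i₁, …, c iₖ]`, where `I = {i₁ < ⋯ < iₖ}`. -/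
def zc (p : ℕ) (I : Finset ℕ) : F p :=
  (I.sort (· ≤ ·)).foldl (fun u i => ⁅u, c p i⁆) (z p)

/-- The left-normed commutator `[[z, c_{I₁}], [z, c_{I₂}], …, [z, c_{Iₘ}]]`. -/
def comm (p : ℕ) : List (Finset ℕ) → F p
  | [] => 0
  | I :: l => l.foldl (fun u J => ⁅u, zc p J⁆) (zc p I)

/-- The index tuples `(I₁, …, Iₘ)` of the basis `X` of `Id(z)`: `m ≥ 1`, the sets are pairwise
disjoint, and `[z, c_{I₁}] > [z, c_{I₂}] ≤ [z, c_{I₃}] ≤ ⋯ ≤ [z, c_{Iₘ}]`. In the order on the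
generators `[z, c_I]` of `Id(z)`, `z` itself is the largest, and otherwise the words
`z c_{i₁} ⋯ c_{iₖ}` are compared lexicographically; for disjoint sets this amounts to comparing
the smallest elements, with `min ∅ = ⊤`. -/
def IsBasisIndex (l : List (Finset ℕ)) : Prop :=
  l.Pairwise Disjoint ∧
    match l with
    | [] => False
    | [_] => True
    | I₁ :: I₂ :: t => I₂.min < I₁.min ∧ (I₂ :: t).Pairwise (fun I J => I.min ≤ J.min)

/-- The type `|I₁| + ⋯ + |Iₘ| - 2m` of the commutator with index `(I₁, …, Iₘ)`. -/
def typ (l : List (Finset ℕ)) : ℤ :=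
  ((l.map Finset.card).sum : ℤ) - 2 * (l.length : ℤ)

/-- `m ≥ 2` and one of `I₁, I₃, …, Iₘ` has more than two elements. -/
def HasLargeSet : List (Finset ℕ) → Prop
  | I₁ :: _ :: t => 2 < #I₁ ∨ ∃ I ∈ t, 2 < #I
  | _ => False

/-- `J`: the smallest ideal of `F` that contains all basis elements other than `z` of type less
than `-1` or greater than `1`, and all basis elements with `m ≥ 2` in which one of
`I₁, I₃, …, Iₘ` has more than two elements. -/
def J (p : ℕ) : LieIdeal (ZMod p) (F p) :=
  LieSubmodule.lieSpan (ZMod p) (F p)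
    {w | ∃ l, IsBasisIndex l ∧
      ((l ≠ [∅] ∧ (typ l < -1 ∨ 1 < typ l)) ∨ HasLargeSet l) ∧ comm p l = w}

/-- The sizes of the sets in `t` are, in some order, those in `s` followed by `2, 2, …, 2`. -/
def Sizes (t : List (Finset ℕ)) (s : List ℕ) : Prop :=
  ∃ k : ℕ, (t.map Finset.card).Perm (s ++ List.replicate k 2)

/-- The size conditions that single out the basis elements in `Z` among all basis elements. -/
def IsZ : List (Finset ℕ) → Prop
  | [] => False
  | [I] => #I ≤ 3
  | I₁ :: I₂ :: t =>
      -- the shape ζ₁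
      (#I₁ + #I₂ = 3 ∧ #I₁ ≤ 2 ∧ Sizes t []) ∨
      -- the shape ζ₂
      (#I₁ + #I₂ = 4 ∧ #I₁ ≤ 2 ∧ #I₂ ≤ 3 ∧ Sizes t [1]) ∨
      -- the shape ζ₃
      (#I₁ = 2 ∧ #I₂ = 3 ∧ Sizes t [0]) ∨
      -- the shape ζ₄
      (#I₁ = 2 ∧ #I₂ = 3 ∧ Sizes t [1, 1]) ∨
      -- the shape ξ₁
      (#I₁ = 2 ∧ #I₂ = 3 ∧ Sizes t [1]) ∨
      -- the shape ξ₂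
      (#I₁ + #I₂ = 4 ∧ #I₁ ≤ 2 ∧ #I₂ ≤ 3 ∧ Sizes t []) ∨
      -- the shape τ₁
      (#I₁ = 2 ∧ #I₂ = 3 ∧ Sizes t [])

/-- The set `X ∖ Z` of basis elements. -/
def XdiffZ (p : ℕ) : Set (F p) :=
  {w | ∃ l, IsBasisIndex l ∧ ¬ IsZ l ∧ comm p l = w}

/-- The data of a relator: `l ++ r` is a list of pairwise disjoint sets, the index `a` is smaller
than all their elements, and the sets in `r` (the remaining slots up to `Iₘ`) have size two. In
every commutator of a relator the smallest index `a` lies in the second slot. -/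
def Cfg (a : ℕ) (l r : List (Finset ℕ)) : Prop :=
  (l ++ r).Pairwise Disjoint ∧ (∀ I ∈ l ++ r, ∀ b ∈ I, a < b) ∧ ∀ I ∈ r, #I = 2

/-- The relators E1–E9 (of type `-1`, the shapes ζ). -/
inductive RelE (p : ℕ) : F p → Prop
  | E1 (a i j : ℕ) (I₁ I₂ : Finset ℕ) (r : List (Finset ℕ))
      (h : Cfg a [I₁, I₂, {i}, {j}] r) (h₁ : #I₁ = 2) (h₂ : #I₂ = 2) :
      RelE p (comm p (I₁ :: insert a I₂ :: {i} :: {j} :: r)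
        + comm p (I₁ :: insert a I₂ :: ∅ :: {i, j} :: r))
  | E2 (a i k : ℕ) (I₁ : Finset ℕ) (r : List (Finset ℕ))
      (h : Cfg a [I₁, {k}, {i}] r) (h₁ : #I₁ = 2) :
      RelE p (comm p (I₁ :: {a, k} :: {i} :: r)
        + comm p (I₁ :: {a, k, i} :: ∅ :: r))
  | E3 (a i j : ℕ) (I₂ : Finset ℕ) (r : List (Finset ℕ))
      (h : Cfg a [{i}, I₂, {j}] r) (h₂ : #I₂ = 2) :
      RelE p (comm p ({i} :: insert a I₂ :: {j} :: r)
        + comm p ({i, j} :: insert a I₂ :: ∅ :: r))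
  | E4 (a : ℕ) (I₂ I₃ : Finset ℕ) (r : List (Finset ℕ))
      (h : Cfg a [I₂, I₃] r) (h₂ : #I₂ = 2) (h₃ : #I₃ = 2) :
      RelE p (comm p (∅ :: insert a I₂ :: I₃ :: r)
        - comm p (I₃ :: insert a I₂ :: ∅ :: r))
  | E5 (a i j : ℕ) (I₁ : Finset ℕ) (r : List (Finset ℕ))
      (h : Cfg a [I₁, {i}, {j}] r) (h₁ : #I₁ = 2) :
      RelE p (comm p (I₁ :: {a} :: {i, j} :: r)
        - comm p (I₁ :: {a, i, j} :: ∅ :: r))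
  | E6 (a i j k s : ℕ) (r : List (Finset ℕ))
      (h : Cfg a [{i}, {s}, {j}, {k}] r) :
      RelE p (comm p ({i} :: {a, s} :: {j, k} :: r)
        - comm p ({i, j} :: {a, s, k} :: ∅ :: r)
        - comm p ({i, k} :: {a, s, j} :: ∅ :: r))
  | E7 (a : ℕ) (I₁ I₂ I₄ : Finset ℕ) (r : List (Finset ℕ))
      (h : Cfg a [I₁, I₂, I₄] r) (h₁ : #I₁ = 2) (h₂ : #I₂ = 2) (h₄ : #I₄ = 2) :
      RelE p (comm p (I₁ :: insert a I₂ :: ∅ :: I₄ :: r)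
        - comm p (I₄ :: insert a I₂ :: ∅ :: I₁ :: r))
  | E8 (a : ℕ) (I₁ I₂ : Finset ℕ) (r : List (Finset ℕ))
      (h : Cfg a [I₁, I₂] r) (h₁ : #I₁ = 2) (h₂ : #I₂ = 2) :
      RelE p (comm p (I₁ :: insert a I₂ :: ∅ :: r)
        - comm p (I₂ :: insert a I₁ :: ∅ :: r))
  | E9 (a i j k s : ℕ) (r : List (Finset ℕ))
      (h : Cfg a [{i}, {j}, {k}, {s}] r) :
      RelE p (comm p ({i, k} :: {a, j, s} :: ∅ :: r)
        + comm p ({i, j} :: {a, k, s} :: ∅ :: r)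
        + comm p ({i, s} :: {a, j, k} :: ∅ :: r))

/-- The relators G1–G6 (of type `0`, the shapes ξ). -/
inductive RelG (p : ℕ) : F p → Prop
  | G1 (a i j k : ℕ) (I₂ : Finset ℕ) (r : List (Finset ℕ))
      (h : Cfg a [{i}, I₂, {j}, {k}] r) (h₂ : #I₂ = 2) :
      RelG p (comm p ({i} :: insert a I₂ :: {j, k} :: r)
        - comm p ({j, k} :: insert a I₂ :: {i} :: r))
  | G2 (a i j k : ℕ) (I₁ : Finset ℕ) (r : List (Finset ℕ))
      (h : Cfg a [I₁, {k}, {i}, {j}] r) (h₁ : #I₁ = 2) :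
      RelG p (comm p (I₁ :: {a, k} :: {i, j} :: r)
        - comm p (I₁ :: {a, i, j} :: {k} :: r))
  | G3 (a k : ℕ) (I₁ I₂ : Finset ℕ) (r : List (Finset ℕ))
      (h : Cfg a [I₁, I₂, {k}] r) (h₁ : #I₁ = 2) (h₂ : #I₂ = 2) :
      RelG p (comm p (I₁ :: insert a I₂ :: {k} :: r)
        - comm p (I₂ :: insert a I₁ :: {k} :: r))
  | G4 (a k : ℕ) (I₁ I₂ I₄ : Finset ℕ) (r : List (Finset ℕ))
      (h : Cfg a [I₁, I₂, {k}, I₄] r) (h₁ : #I₁ = 2) (h₂ : #I₂ = 2) (h₄ : #I₄ = 2) :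
      RelG p (comm p (I₁ :: insert a I₂ :: {k} :: I₄ :: r)
        - comm p (I₄ :: insert a I₂ :: {k} :: I₁ :: r))
  | G5 (a i j k s q : ℕ) (r : List (Finset ℕ))
      (h : Cfg a [{i}, {j}, {k}, {s}, {q}] r) :
      RelG p (comm p ({i, k} :: {a, j, s} :: {q} :: r)
        + comm p ({i, j} :: {a, k, s} :: {q} :: r)
        + comm p ({i, s} :: {a, j, k} :: {q} :: r))
  | G6 (a i j k : ℕ) (I₁ : Finset ℕ) (r : List (Finset ℕ))
      (h : Cfg a [I₁, {i}, {j}, {k}] r) (h₁ : #I₁ = 2) :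
      RelG p (comm p (I₁ :: {a, i, k} :: {j} :: r)
        + comm p (I₁ :: {a, k, j} :: {i} :: r)
        + comm p (I₁ :: {a, i, j} :: {k} :: r))

/-- The relators H1–H3 (of type `1`, the shape τ₁). As the slots from the third on may be permuted
freely, the slot exchanged with the first one in H2 is written in third position. -/
inductive RelH (p : ℕ) : F p → Prop
  | H1 (a : ℕ) (I₁ I₂ : Finset ℕ) (r : List (Finset ℕ))
      (h : Cfg a [I₁, I₂] r) (h₁ : #I₁ = 2) (h₂ : #I₂ = 2) :
      RelH p (comm p (I₁ :: insert a I₂ :: r) - comm p (I₂ :: insert a I₁ :: r))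
  | H2 (a : ℕ) (I₁ I₂ I₄ : Finset ℕ) (r : List (Finset ℕ))
      (h : Cfg a [I₁, I₂, I₄] r) (h₁ : #I₁ = 2) (h₂ : #I₂ = 2) (h₄ : #I₄ = 2) :
      RelH p (comm p (I₁ :: insert a I₂ :: I₄ :: r) - comm p (I₄ :: insert a I₂ :: I₁ :: r))
  | H3 (a i j k s : ℕ) (r : List (Finset ℕ))
      (h : Cfg a [{i}, {j}, {k}, {s}] r) :
      RelH p (comm p ({i, k} :: {a, j, s} :: r)
        + comm p ({i, j} :: {a, k, s} :: r)
        + comm p ({i, s} :: {a, k, j} :: r))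

/-- The relators of degree two in `z` and of type `-1` or `0`; the families E1–E9 and G1–G6 only
have members of degree at least three in `z`. -/
inductive RelTwo (p : ℕ) : F p → Prop
  | D1 (a i j : ℕ) (h : Cfg a [{i}, {j}] []) :
      RelTwo p (comm p [{i}, {a, j}] + comm p [∅, {a, i, j}])
  | D2 (a i j : ℕ) (h : Cfg a [{i}, {j}] []) :
      RelTwo p (comm p [{i, j}, {a}] - comm p [∅, {a, i, j}])
  | D3 (a i j k : ℕ) (h : Cfg a [{i}, {j}, {k}] []) :
      RelTwo p (comm p [{i, j}, {a, k}] - comm p [{k}, {a, i, j}])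
  | D4 (a i j k : ℕ) (h : Cfg a [{i}, {j}, {k}] []) :
      RelTwo p (comm p [{i}, {a, j, k}] + comm p [{j}, {a, i, k}] + comm p [{k}, {a, i, j}])

/-- The subspace of `F` spanned by `X ∖ Z` and the relators E1–E9, G1–G6 and H1–H3. -/
def V (p : ℕ) : Submodule (ZMod p) (F p) :=
  Submodule.span (ZMod p) (XdiffZ p ∪ {w | RelE p w} ∪ {w | RelG p w} ∪ {w | RelH p w})

/-- The subspace of `F` spanned by the relators of degree two in `z` and of type `-1` or `0`. -/
def VTwo (p : ℕ) : Submodule (ZMod p) (F p) :=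
  Submodule.span (ZMod p) {w | RelTwo p w}

end

end MetabelianLie

namespace MetabelianLie

noncomputable section

/-! Everything is expressed through `P b L`: the commutator whose slots are the sets in `L`, with an
index `b` smaller than all others added to the second slot. Its type is one minus the deficit `dfc
L`, so `J` is generated by the `[z, c_I]` with more than three indices, the `P b L` of deficit
outside 0, 1, 2, and those with more than two elements in a slot other than the second. Two
mechanisms do the work. Since `Id(z)` is metabelian, the slots from the third on commute. Bracketing
with `c i` is a derivation that inserts `i` into each slot in turn, and it kills a commutator that
already involves `i`.

`V ⊔ VTwo ≤ J`: a commutator of deficit three lies in `J`, so its bracket with some `c i` is a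
relation of deficit two modulo `J`. Such relations, together with brackets of elements of `J` with a
`c b` below all their indices, yield E1–E9, D1 and D2. One more bracket gives G1–G6, D3 and D4 in
deficit one, and another gives H1–H3 in deficit zero. The obstacle is a term with three elements
besides `b` in the second slot, which is not a generator of `J`. These terms do lie in `J`
(`q_large_second`), by descending induction on the deficit. The decisive case is
`q_large_empty_singleton`, where four relations combine to `2x = 0`; there `p` must be odd.

`J ≤ V ⊔ VTwo`: instead of testing the listed relators for closure under brackets, one passes to
`SymSpan`, spanned by a redundant system of relators without restrictions on the tail. Modulo it `P
b L` does not depend on the order of `L` (`sq_perm`). This makes closure a short computation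
(`symRel_lie_c`, `symRel_lie_z`): a bracket with a `c i` below all indices cancels by symmetry, and
a bracket with a new larger index carries the `merge` relators to `three`, then to `four`, then to
zero. So `SymSpan` is an ideal, and it contains the generators of `J`. It remains to see that the
listed relators imply the symmetric ones. The main point is the same order independence modulo `V ⊔
VTwo` (`w_perm`), proved by normal forms. This closes the circle `J ≤ SymSpan ≤ V ⊔ VTwo ≤ J`. -/

variable {p : ℕ}

/-! ### The defining relations of `F`, and a criterion for ideals -/

/-- The projection of the free Lie algebra onto `F`. -/
abbrev toF (p : ℕ) (u : Free p) : F p := LieSubmodule.Quotient.mk (N := FIdeal p) u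

lemma toF_surjective : Function.Surjective (toF p) := by
  intro x
  induction x using Quotient.inductionOn' with
  | h u => exact ⟨u, rfl⟩

lemma toF_eq_zero_of_rel {u : Free p} (h : FRel p u) : toF p u = 0 :=
  (LieSubmodule.Quotient.mk_eq_zero (N := FIdeal p)).2 (LieSubmodule.subset_lieSpan h)

/-- Membership in the image in `F` of the ideal of the free Lie algebra generated by a letter. -/
def InId (x : Letter) (u : F p) : Prop :=
  ∃ v ∈ principalIdeal (ZMod p) (FreeLieAlgebra.of (ZMod p) x), toF p v = u

lemma InId.letter (x : Letter) : InId x (toF p (FreeLieAlgebra.of (ZMod p) x)) :=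
  ⟨_, LieSubmodule.subset_lieSpan rfl, rfl⟩

lemma InId.lie_right {x : Letter} {u : F p} (h : InId x u) (v : F p) : InId x ⁅v, u⁆ := by
  obtain ⟨u', hu, rfl⟩ := h
  obtain ⟨v', rfl⟩ := toF_surjective v
  exact ⟨⁅v', u'⁆, LieSubmodule.lie_mem _ hu, rfl⟩

lemma InId.lie_left {x : Letter} {u : F p} (h : InId x u) (v : F p) : InId x ⁅u, v⁆ := by
  obtain ⟨u', hu, rfl⟩ := h
  obtain ⟨v', rfl⟩ := toF_surjective v
  refine ⟨⁅u', v'⁆, ?_, rfl⟩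
  rw [← lie_skew]
  exact neg_mem (LieSubmodule.lie_mem _ hu)

lemma lie_eq_zero_of_inId_c {i : ℕ} {u v : F p} (hu : InId (.c i) u) (hv : InId (.c i) v) :
    ⁅u, v⁆ = 0 := by
  obtain ⟨u, hu, rfl⟩ := hu
  obtain ⟨v, hv, rfl⟩ := hv
  exact toF_eq_zero_of_rel (.abelian i u v hu hv)

lemma lie_lie_eq_zero {u v u' v' : F p} (hu : InId .z u) (hv : InId .z v)
    (hu' : InId .z u') (hv' : InId .z v') : ⁅⁅u, v⁆, ⁅u', v'⁆⁆ = 0 := by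
  obtain ⟨u, hu, rfl⟩ := hu
  obtain ⟨v, hv, rfl⟩ := hv
  obtain ⟨u', hu', rfl⟩ := hu'
  obtain ⟨v', hv', rfl⟩ := hv'
  exact toF_eq_zero_of_rel (.metabelian u v u' v' hu hv hu' hv')

lemma lie_c_c (i j : ℕ) : ⁅c p i, c p j⁆ = 0 := toF_eq_zero_of_rel (.comm i j)

lemma lie_lie_right (u v w : F p) : ⁅⁅u, v⁆, w⁆ = ⁅⁅u, w⁆, v⁆ + ⁅u, ⁅v, w⁆⁆ := by
  rw [leibniz_lie u v w, ← lie_skew v]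
  abel

lemma lie_lie_swap {u v w : F p} (h : ⁅v, w⁆ = 0) : ⁅⁅u, v⁆, w⁆ = ⁅⁅u, w⁆, v⁆ := by
  rw [lie_lie_right, h, lie_zero, add_zero]

/-- A subspace of `F` that is closed under brackets with the generators is an ideal. -/
lemma lie_mem_of_closed (N : Submodule (ZMod p) (F p))
    (hz : ∀ w ∈ N, ⁅w, z p⁆ ∈ N) (hc : ∀ i, ∀ w ∈ N, ⁅w, c p i⁆ ∈ N) (x w : F p) (hw : w ∈ N) :
    ⁅x, w⁆ ∈ N := by
  let S : LieSubalgebra (ZMod p) (Free p) :=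
    { carrier := {u | ∀ w ∈ N, ⁅toF p u, w⁆ ∈ N}
      add_mem' := fun {u v} hu hv w hw => by
        change ⁅toF p u + toF p v, w⁆ ∈ N
        rw [add_lie]; exact add_mem (hu w hw) (hv w hw)
      zero_mem' := fun w hw => by
        change ⁅(0 : F p), w⁆ ∈ N
        rw [zero_lie]; exact zero_mem _
      smul_mem' := fun r u hu w hw => by
        change ⁅r • toF p u, w⁆ ∈ N
        rw [smul_lie]; exact N.smul_mem _ (hu w hw)
      lie_mem' := fun {u v} hu hv w hw => by
        change ⁅⁅toF p u, toF p v⁆, w⁆ ∈ N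
        rw [lie_lie]; exact sub_mem (hu _ (hv w hw)) (hv _ (hu w hw)) }
  have hgen : ∀ y, FreeLieAlgebra.of (ZMod p) y ∈ S := by
    rintro (_ | i) w hw
    · rw [← lie_skew]; exact neg_mem (hz w hw)
    · rw [← lie_skew]; exact neg_mem (hc i w hw)
  -- The elements that stabilise `N` form a subalgebra containing the letters. By the universal
  -- property the identity factors through it, so it is everything.
  let φ : Free p →ₗ⁅ZMod p⁆ S := FreeLieAlgebra.lift (ZMod p) fun y => ⟨_, hgen y⟩
  have hφ : S.incl.comp φ = LieHom.id := by
    ext y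
    simp [φ]
  obtain ⟨u, rfl⟩ := toF_surjective x
  have h1 : (φ u : Free p) = u := by
    have := LieHom.congr_fun hφ u
    simpa using this
  have h2 := (φ u).2
  rw [h1] at h2
  exact h2 w hw

/-! ### The elements `[z, c_I]` and their iterated commutators -/

lemma zc_eq_of_perm {I : Finset ℕ} {l : List ℕ} (h : (I.sort (· ≤ ·)).Perm l) :
    zc p I = l.foldl (fun u i => ⁅u, c p i⁆) (z p) := by
  have : RightCommutative (fun (u : F p) i => ⁅u, c p i⁆) :=
    ⟨fun u i j => lie_lie_swap (lie_c_c i j)⟩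
  exact h.foldl_eq _

@[simp] lemma zc_empty : zc p ∅ = z p := by simp [zc]

lemma zc_insert {I : Finset ℕ} {b : ℕ} (h : b ∉ I) : zc p (insert b I) = ⁅zc p I, c p b⁆ := by
  rw [zc_eq_of_perm (l := I.sort (· ≤ ·) ++ [b])]
  · simp [zc]
  · refine (List.perm_ext_iff_of_nodup (Finset.sort_nodup _ _) ?_).2 ?_
    · simp [List.nodup_append, h]
    · intro x; simp [or_comm]

lemma zc_inId_z (I : Finset ℕ) : InId .z (zc p I) := by
  induction I using Finset.induction_on with
  | empty => rw [zc_empty]; exact InId.letter _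
  | insert b I h ih => rw [zc_insert h]; exact ih.lie_left _

lemma zc_inId_c {I : Finset ℕ} {b : ℕ} (h : b ∈ I) : InId (.c b) (zc p I) := by
  rw [← Finset.insert_erase h, zc_insert (Finset.notMem_erase b I)]
  exact (InId.letter (.c b)).lie_right _

/-- Iterated right bracketing with the elements `[z, c_I]`. -/
def fold (p : ℕ) (u : F p) (t : List (Finset ℕ)) : F p := t.foldl (fun u J => ⁅u, zc p J⁆) u

@[simp] lemma fold_nil (u : F p) : fold p u [] = u := rfl

@[simp] lemma fold_cons (u : F p) (J : Finset ℕ) (t : List (Finset ℕ)) :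
    fold p u (J :: t) = fold p ⁅u, zc p J⁆ t := rfl

lemma comm_cons (I : Finset ℕ) (t : List (Finset ℕ)) : comm p (I :: t) = fold p (zc p I) t := rfl

lemma comm_cons_cons (I J : Finset ℕ) (t : List (Finset ℕ)) :
    comm p (I :: J :: t) = fold p ⁅zc p I, zc p J⁆ t := rfl

lemma fold_add (u v : F p) (t : List (Finset ℕ)) : fold p (u + v) t = fold p u t + fold p v t := by
  induction t generalizing u v with
  | nil => rfl
  | cons J t ih => simp [add_lie, ih]

@[simp] lemma fold_zero (t : List (Finset ℕ)) : fold p 0 t = 0 := by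
  induction t with
  | nil => rfl
  | cons J t ih => simp [ih]

lemma fold_neg (u : F p) (t : List (Finset ℕ)) : fold p (-u) t = - fold p u t := by
  rw [eq_neg_iff_add_eq_zero, ← fold_add]; simp

lemma fold_sub (u v : F p) (t : List (Finset ℕ)) : fold p (u - v) t = fold p u t - fold p v t := by
  rw [sub_eq_add_neg, fold_add, fold_neg, sub_eq_add_neg]

/-- Exchanging two neighbouring brackets costs `[[u, v], [zc J, zc K]]`, which is zero because
`Id(z)` is metabelian. -/
lemma fold_perm {u v : F p} (hu : InId .z u) (hv : InId .z v) {t t' : List (Finset ℕ)}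
    (h : t.Perm t') : fold p ⁅u, v⁆ t = fold p ⁅u, v⁆ t' := by
  induction h generalizing u v with
  | nil => rfl
  | cons J _ ih => exact ih (hu.lie_left _) (zc_inId_z J)
  | swap J K t =>
    simp only [fold_cons]
    congr 1
    rw [lie_lie_right, lie_lie_eq_zero hu hv (zc_inId_z _) (zc_inId_z _), add_zero]
  | trans _ _ ih1 ih2 => exact (ih1 hu hv).trans (ih2 hu hv)

lemma comm_perm (X Y : Finset ℕ) {t t' : List (Finset ℕ)} (h : t.Perm t') :
    comm p (X :: Y :: t) = comm p (X :: Y :: t') :=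
  fold_perm (zc_inId_z X) (zc_inId_z Y) h

lemma comm_antisymm (X Y : Finset ℕ) (t : List (Finset ℕ)) :
    comm p (X :: Y :: t) = - comm p (Y :: X :: t) := by
  rw [comm_cons_cons, comm_cons_cons, ← fold_neg, lie_skew]

/-- The Jacobi identity, in the form that brings the third slot into the second in both terms on the
right. With `comm_antisymm` and `comm_perm` it suffices for straightening. -/
lemma comm_jacobi (X Y Z : Finset ℕ) (t : List (Finset ℕ)) :
    comm p (X :: Y :: Z :: t) = comm p (X :: Z :: Y :: t) - comm p (Y :: Z :: X :: t) := by
  simp only [comm_cons_cons, fold_cons]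
  rw [← fold_sub]
  congr 1
  rw [lie_lie_right, ← lie_skew (zc p X) ⁅_, _⁆]
  abel

/-! ### Bracketing with a `c b` as a sum of insertions -/

/-- The sum of the values of `f` at the lists obtained from `t` by inserting `b` into one of the
sets. -/
def sumIns {M : Type*} [AddCommMonoid M] (b : ℕ) :
    List (Finset ℕ) → (List (Finset ℕ) → M) → M
  | [], _ => 0
  | X :: t, f => f (insert b X :: t) + sumIns b t fun s => f (X :: s)

@[simp] lemma sumIns_nil {M : Type*} [AddCommMonoid M] (b : ℕ) (f : List (Finset ℕ) → M) :
    sumIns b [] f = 0 := rfl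

@[simp] lemma sumIns_cons {M : Type*} [AddCommMonoid M] (b : ℕ) (X : Finset ℕ)
    (t : List (Finset ℕ)) (f : List (Finset ℕ) → M) :
    sumIns b (X :: t) f = f (insert b X :: t) + sumIns b t fun s => f (X :: s) := rfl

/-- Leibniz rule: on a factor `[z, c_I]` with `b` not in `I`, bracketing with `c b` is insertion of
`b` into `I`. -/
lemma fold_lie_c {b : ℕ} (u : F p) {t : List (Finset ℕ)} (hb : ∀ I ∈ t, b ∉ I) :
    ⁅fold p u t, c p b⁆ = fold p ⁅u, c p b⁆ t + sumIns b t (fold p u) := by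
  induction t generalizing u with
  | nil => simp
  | cons J t ih =>
    simp only [List.mem_cons, forall_eq_or_imp] at hb
    rw [fold_cons, ih _ hb.2]
    simp only [fold_cons, sumIns_cons, zc_insert hb.1]
    rw [← add_assoc, ← fold_add]
    congr 2
    exact lie_lie_right _ _ _

lemma comm_lie_c {b : ℕ} {l : List (Finset ℕ)} (hb : ∀ I ∈ l, b ∉ I) :
    ⁅comm p l, c p b⁆ = sumIns b l (comm p) := by
  cases l with
  | nil => simp [comm]
  | cons X t =>
    simp only [List.mem_cons, forall_eq_or_imp] at hb
    rw [comm_cons, fold_lie_c _ hb.2, ← zc_insert hb.1]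
    rfl

lemma comm_lie_z {l : List (Finset ℕ)} (hl : l ≠ []) : ⁅comm p l, z p⁆ = comm p (l ++ [∅]) := by
  cases l with
  | nil => exact absurd rfl hl
  | cons X t => simp [comm, List.foldl_append]

lemma fold_inId_left {x : Letter} {u : F p} (h : InId x u) (t : List (Finset ℕ)) :
    InId x (fold p u t) := by
  induction t generalizing u with
  | nil => exact h
  | cons J t ih => exact ih (h.lie_left _)

lemma fold_inId_right {b : ℕ} (u : F p) {t : List (Finset ℕ)} {I : Finset ℕ} (hI : I ∈ t)
    (hb : b ∈ I) : InId (.c b) (fold p u t) := by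
  induction t generalizing u with
  | nil => simp at hI
  | cons J t ih =>
    rcases List.mem_cons.1 hI with rfl | h
    · exact fold_inId_left ((zc_inId_c hb).lie_right _) t
    · exact ih _ h

lemma comm_lie_c_eq_zero {b : ℕ} {l : List (Finset ℕ)} {I : Finset ℕ} (hI : I ∈ l) (hb : b ∈ I) :
    ⁅comm p l, c p b⁆ = 0 := by
  cases l with
  | nil => simp at hI
  | cons X t =>
    refine lie_eq_zero_of_inId_c (i := b) ?_ (InId.letter _)
    rcases List.mem_cons.1 hI with rfl | h
    · exact fold_inId_left (zc_inId_c hb) t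
    · exact fold_inId_right _ h hb

/-- If two slots share an index `i`, the partial commutator up to the first of them stays in `Id(c
i)` until it meets the second, and `Id(c i)` is abelian. The alternative concerning `u` is what the
induction on `t` needs. -/
lemma fold_eq_zero {u : F p} {t : List (Finset ℕ)}
    (h : (∃ i, InId (.c i) u ∧ ∃ I ∈ t, i ∈ I) ∨ ¬ t.Pairwise Disjoint) : fold p u t = 0 := by
  induction t generalizing u with
  | nil => simp at h
  | cons J t ih =>
    rw [fold_cons]
    rcases h with ⟨i, hi, I, hI, hiI⟩ | h
    · rcases List.mem_cons.1 hI with rfl | hI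
      · rw [lie_eq_zero_of_inId_c hi (zc_inId_c hiI), fold_zero]
      · exact ih (.inl ⟨i, hi.lie_left _, I, hI, hiI⟩)
    · rw [List.pairwise_cons, not_and_or] at h
      rcases h with h | h
      · push Not at h
        obtain ⟨I, hI, hd⟩ := h
        obtain ⟨i, hiJ, hiI⟩ := Finset.not_disjoint_iff.1 hd
        exact ih (.inl ⟨i, (zc_inId_c hiJ).lie_right _, I, hI, hiI⟩)
      · exact ih (.inr h)

lemma comm_eq_zero_of_not_disjoint {l : List (Finset ℕ)} (h : ¬ l.Pairwise Disjoint) :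
    comm p l = 0 := by
  cases l with
  | nil => rfl
  | cons J t =>
    rw [comm_cons]
    apply fold_eq_zero
    rw [List.pairwise_cons, not_and_or] at h
    rcases h with h | h
    · push Not at h
      obtain ⟨I, hI, hd⟩ := h
      obtain ⟨i, hiJ, hiI⟩ := Finset.not_disjoint_iff.1 hd
      exact .inl ⟨i, zc_inId_c hiJ, I, hI, hiI⟩
    · exact .inr h

lemma sumIns_congr {M : Type*} [AddCommMonoid M] {b : ℕ} {t : List (Finset ℕ)}
    {f g : List (Finset ℕ) → M}
    (h : ∀ l₁ I l₂, t = l₁ ++ I :: l₂ → f (l₁ ++ insert b I :: l₂) = g (l₁ ++ insert b I :: l₂)) :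
    sumIns b t f = sumIns b t g := by
  induction t generalizing f g with
  | nil => rfl
  | cons X t ih =>
    rw [sumIns_cons, sumIns_cons]
    congr 1
    · exact h [] X t rfl
    refine ih fun l₁ I l₂ e => ?_
    exact h (X :: l₁) I l₂ (by simp [e])

lemma sumIns_eq_zero {M : Type*} [AddCommMonoid M] {b : ℕ} {t : List (Finset ℕ)}
    {f : List (Finset ℕ) → M}
    (h : ∀ l₁ I l₂, t = l₁ ++ I :: l₂ → f (l₁ ++ insert b I :: l₂) = 0) :
    sumIns b t f = 0 := by
  have : sumIns b t (fun _ => (0 : M)) = 0 := by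
    clear h
    induction t with
    | nil => rfl
    | cons X t ih => rw [sumIns_cons, zero_add, ih]
  rw [sumIns_congr (g := fun _ => 0) h, this]

lemma sumIns_map {M N : Type*} [AddCommMonoid M] [AddCommMonoid N] (φ : M →+ N) (b : ℕ)
    (t : List (Finset ℕ)) (f : List (Finset ℕ) → M) :
    φ (sumIns b t f) = sumIns b t fun s => φ (f s) := by
  induction t generalizing f with
  | nil => simp
  | cons X t ih => simp [ih]

/-- The sum of the values of `f` at the pairs consisting of a member of `t` and the list of the
other members. -/
def sumPick {M : Type*} [AddCommMonoid M] :
    List (Finset ℕ) → (Finset ℕ → List (Finset ℕ) → M) → M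
  | [], _ => 0
  | X :: t, f => f X t + sumPick t fun I s => f I (X :: s)

@[simp] lemma sumPick_nil {M : Type*} [AddCommMonoid M] (f : Finset ℕ → List (Finset ℕ) → M) :
    sumPick [] f = 0 := rfl

@[simp] lemma sumPick_cons {M : Type*} [AddCommMonoid M] (X : Finset ℕ) (t : List (Finset ℕ))
    (f : Finset ℕ → List (Finset ℕ) → M) :
    sumPick (X :: t) f = f X t + sumPick t fun I s => f I (X :: s) := rfl

lemma sumPick_congr {M : Type*} [AddCommMonoid M] {t : List (Finset ℕ)}
    {f g : Finset ℕ → List (Finset ℕ) → M} (h : ∀ I s, t.Perm (I :: s) → f I s = g I s) :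
    sumPick t f = sumPick t g := by
  induction t generalizing f g with
  | nil => rfl
  | cons X t ih =>
    rw [sumPick_cons, sumPick_cons, h X t (List.Perm.refl _)]
    congr 1
    exact ih fun I s e => h I _ ((e.cons X).trans (List.Perm.swap _ _ _))

lemma sumPick_zero {M : Type*} [AddCommMonoid M] (t : List (Finset ℕ)) :
    sumPick t (fun _ _ => (0 : M)) = 0 := by
  induction t with
  | nil => rfl
  | cons X t ih => rw [sumPick_cons, ih, zero_add]

lemma sumPick_eq_zero {M : Type*} [AddCommMonoid M] {t : List (Finset ℕ)}
    {f : Finset ℕ → List (Finset ℕ) → M} (h : ∀ I s, t.Perm (I :: s) → f I s = 0) :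
    sumPick t f = 0 := by
  rw [sumPick_congr h, sumPick_zero]

lemma sumPick_map {M N : Type*} [AddCommMonoid M] [AddCommMonoid N] (φ : M →+ N)
    (t : List (Finset ℕ)) (f : Finset ℕ → List (Finset ℕ) → M) :
    φ (sumPick t f) = sumPick t fun I s => φ (f I s) := by
  induction t generalizing f with
  | nil => simp
  | cons X t ih => simp [ih]

lemma sumIns_eq_sumPick {M : Type*} [AddCommMonoid M] {b : ℕ} {t : List (Finset ℕ)}
    {f : List (Finset ℕ) → M} (h : ∀ s s', s.Perm s' → f s = f s') :
    sumIns b t f = sumPick t fun I s => f (insert b I :: s) := by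
  induction t generalizing f with
  | nil => rfl
  | cons X t ih =>
    rw [sumIns_cons, sumPick_cons, ih fun s s' e => h _ _ (e.cons X)]
    congr 1
    exact sumPick_congr fun I s _ => h _ _ (List.Perm.swap _ _ _)

/-! ### Commutators with the smallest index in the second slot -/

/-- The sets in `L` are pairwise disjoint and `b` is smaller than all their elements. -/
def Ok (b : ℕ) (L : List (Finset ℕ)) : Prop :=
  L.Pairwise Disjoint ∧ ∀ I ∈ L, ∀ x ∈ I, b < x

lemma Ok.perm {b : ℕ} {L L' : List (Finset ℕ)} (h : L.Perm L') : Ok b L ↔ Ok b L' := by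
  unfold Ok
  rw [h.pairwise_iff (fun {x y} h => Disjoint.symm h)]
  simp [h.mem_iff]

lemma ok_cons {b : ℕ} {X : Finset ℕ} {L : List (Finset ℕ)} :
    Ok b (X :: L) ↔ (∀ I ∈ L, Disjoint X I) ∧ (∀ x ∈ X, b < x) ∧ Ok b L := by
  simp only [Ok, List.pairwise_cons, List.mem_cons, forall_eq_or_imp]
  tauto

@[simp] lemma ok_nil (b : ℕ) : Ok b [] := by simp [Ok]

lemma Ok.cons_singleton {a b : ℕ} {L : List (Finset ℕ)} (h : Ok a L) (hb : b < a) :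
    Ok b ({a} :: L) := by
  refine ok_cons.2 ⟨fun I hI => ?_, by simpa using hb, h.1, fun I hI x hx =>
    hb.trans (h.2 I hI x hx)⟩
  exact Finset.disjoint_singleton_left.2 fun ha => (h.2 I hI a ha).ne rfl

lemma ok_insert {b i : ℕ} {l₁ l₂ : List (Finset ℕ)} {I : Finset ℕ} (hb : b < i)
    (hi : ∀ J ∈ l₁ ++ I :: l₂, i ∉ J) :
    Ok b (l₁ ++ insert i I :: l₂) ↔ Ok b (l₁ ++ I :: l₂) := by
  rw [Ok.perm List.perm_middle, Ok.perm (L := l₁ ++ I :: l₂) List.perm_middle, ok_cons, ok_cons]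
  have h : ∀ J ∈ l₁ ++ l₂, i ∉ J := fun J hJ => hi J (by simp at hJ ⊢; tauto)
  constructor
  · rintro ⟨h1, h2, h3⟩
    exact ⟨fun J hJ => (Finset.disjoint_insert_left.1 (h1 J hJ)).2,
      fun x hx => h2 x (Finset.mem_insert_of_mem hx), h3⟩
  · rintro ⟨h1, h2, h3⟩
    refine ⟨fun J hJ => Finset.disjoint_insert_left.2 ⟨h J hJ, h1 J hJ⟩, fun x hx => ?_, h3⟩
    rcases Finset.mem_insert.1 hx with rfl | hx
    · exact hb
    · exact h2 x hx

open Classical in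
/-- The commutator `⟨X, bY, t⟩` with smallest index `b`; zero if the sets `X, Y, t` are not
pairwise disjoint or `b` is not smaller than all their elements. -/
def P (p : ℕ) (b : ℕ) : List (Finset ℕ) → F p
  | X :: Y :: t => if Ok b (X :: Y :: t) then comm p (X :: insert b Y :: t) else 0
  | _ => 0

lemma P_of_ok {b : ℕ} {X Y : Finset ℕ} {t : List (Finset ℕ)} (h : Ok b (X :: Y :: t)) :
    P p b (X :: Y :: t) = comm p (X :: insert b Y :: t) := if_pos h

lemma P_of_not_ok {b : ℕ} {L : List (Finset ℕ)} (h : ¬ Ok b L) : P p b L = 0 := by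
  match L with
  | X :: Y :: t => exact if_neg h
  | [X] => rfl
  | [] => rfl

lemma P_perm (b : ℕ) (X Y : Finset ℕ) {t t' : List (Finset ℕ)} (h : t.Perm t') :
    P p b (X :: Y :: t) = P p b (X :: Y :: t') := by
  by_cases hO : Ok b (X :: Y :: t)
  · rw [P_of_ok hO, P_of_ok ((Ok.perm ((h.cons Y).cons X)).1 hO)]
    exact comm_perm _ _ h
  · rw [P_of_not_ok hO, P_of_not_ok (mt (Ok.perm ((h.cons Y).cons X)).2 hO)]

lemma P_lie_z {b : ℕ} {L : List (Finset ℕ)} (hL : 2 ≤ L.length) :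
    ⁅P p b L, z p⁆ = P p b (L ++ [∅]) := by
  match L with
  | X :: Y :: t =>
    have e : Ok b (X :: Y :: t) ↔ Ok b (X :: Y :: t ++ [∅]) := by
      rw [Ok.perm (List.perm_append_singleton _ _), ok_cons (X := ∅)]; simp
    by_cases h : Ok b (X :: Y :: t)
    · rw [P_of_ok h, comm_lie_z (by simp)]
      exact (P_of_ok (e.1 h)).symm
    · rw [P_of_not_ok h, P_of_not_ok (mt e.2 h), zero_lie]

/-- As `i` exceeds `b`, every insertion leaves `b` the smallest index, still in the second slot.
Lists violating `Ok` also match, since inserting a new `i` does not change `Ok`. -/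
lemma P_lie_c {b i : ℕ} {L : List (Finset ℕ)} (hb : b < i) (hi : ∀ I ∈ L, i ∉ I) :
    ⁅P p b L, c p i⁆ = sumIns i L (P p b) := by
  match L with
  | [] => simp [P]
  | [X] => simp [P]
  | X :: Y :: t =>
    by_cases h : Ok b (X :: Y :: t)
    · have key : ∀ l₁ I l₂, X :: Y :: t = l₁ ++ I :: l₂ → Ok b (l₁ ++ insert i I :: l₂) := by
        intro l₁ I l₂ e
        rw [ok_insert hb (by rwa [← e]), ← e]; exact h
      have hi' : ∀ I ∈ X :: insert b Y :: t, i ∉ I := by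
        simp only [List.mem_cons, forall_eq_or_imp] at hi ⊢
        refine ⟨hi.1, ?_, hi.2.2⟩
        simp [hi.2.1, hb.ne']
      rw [P_of_ok h, comm_lie_c hi']
      simp only [sumIns_cons]
      rw [P_of_ok (key [] X _ rfl), P_of_ok (key [X] Y _ rfl), Finset.insert_comm]
      congr 2
      refine sumIns_congr fun l₁ I l₂ e => ?_
      exact (P_of_ok (key (X :: Y :: l₁) I l₂ (by simp [e]))).symm
    · rw [P_of_not_ok h, zero_lie]
      symm
      refine sumIns_eq_zero fun l₁ I l₂ e => P_of_not_ok ?_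
      rw [ok_insert hb (by rwa [← e]), ← e]
      exact h

lemma P_lie_c_eq_zero {b i : ℕ} {L : List (Finset ℕ)} {I : Finset ℕ} (hI : I ∈ L) (hi : i ∈ I) :
    ⁅P p b L, c p i⁆ = 0 := by
  by_cases h : Ok b L
  · match L with
    | [] => simp [P]
    | [X] => simp [P]
    | X :: Y :: t =>
      rw [P_of_ok h]
      simp only [List.mem_cons] at hI
      rcases hI with rfl | rfl | hI
      · exact comm_lie_c_eq_zero (List.mem_cons_self ..) hi
      · exact comm_lie_c_eq_zero (I := insert b I) (by simp) (by simp [hi])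
      · exact comm_lie_c_eq_zero (I := I) (by simp [hI]) hi
  · rw [P_of_not_ok h, zero_lie]

/-- Bracketing with a `c b` whose index is smaller than all others. -/
lemma comm_lie_c_of_ok {b : ℕ} {X Y : Finset ℕ} {t : List (Finset ℕ)} (h : Ok b (X :: Y :: t)) :
    ⁅comm p (X :: Y :: t), c p b⁆ = P p b (X :: Y :: t) - P p b (Y :: X :: t)
      + sumPick t fun I s => P p b (X :: I :: Y :: s) - P p b (Y :: I :: X :: s) := by
  have hf : ∀ I ∈ X :: Y :: t, b ∉ I := fun I hI hb => (h.2 I hI b hb).ne rfl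
  -- Insertion into the second slot is already in the desired form; insertion into the first is
  -- corrected by antisymmetry, and insertion into a later slot by Jacobi.
  rw [comm_lie_c hf, sumIns_cons, sumIns_cons, P_of_ok h,
    P_of_ok ((Ok.perm (List.Perm.swap _ _ _)).1 h), comm_antisymm (insert b X), ← add_assoc,
    sumIns_eq_sumPick fun s s' e => comm_perm X Y e]
  congr 1
  · abel
  · refine sumPick_congr fun I s e => ?_
    have h1 : (X :: Y :: t).Perm (X :: I :: Y :: s) :=
      ((e.cons Y).trans (List.Perm.swap _ _ _)).cons X
    have h2 : (X :: Y :: t).Perm (Y :: I :: X :: s) :=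
      (List.Perm.swap _ _ _).trans (((e.cons X).trans (List.Perm.swap _ _ _)).cons Y)
    rw [P_of_ok ((Ok.perm h1).1 h), P_of_ok ((Ok.perm h2).1 h), comm_jacobi]

/-! ### Straightening -/

lemma ok_map_erase {a : ℕ} {l : List (Finset ℕ)} (hd : l.Pairwise Disjoint)
    (hmin : ∀ I ∈ l, ∀ x ∈ I, a ≤ x) : Ok a (l.map fun I => I.erase a) := by
  constructor
  · rw [List.pairwise_map]
    exact hd.imp fun h => h.mono (Finset.erase_subset _ _) (Finset.erase_subset _ _)
  · intro I hI x hx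
    obtain ⟨J, hJ, rfl⟩ := List.mem_map.1 hI
    exact lt_of_le_of_ne (hmin J hJ x (Finset.mem_of_mem_erase hx))
      (Finset.ne_of_mem_erase hx).symm

lemma comm_eq_P {a : ℕ} {X Y : Finset ℕ} {t : List (Finset ℕ)}
    (hd : (X :: Y :: t).Pairwise Disjoint) (ha : a ∈ Y)
    (hmin : ∀ I ∈ X :: Y :: t, ∀ x ∈ I, a ≤ x) :
    comm p (X :: Y :: t) = P p a ((X :: Y :: t).map fun I => I.erase a) := by
  have h := ok_map_erase hd hmin
  simp only [List.map_cons] at h ⊢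
  rw [P_of_ok h, Finset.insert_erase ha]
  simp only [List.pairwise_cons, List.mem_cons, forall_eq_or_imp] at hd
  have hX : X.erase a = X := Finset.erase_eq_of_notMem (Finset.disjoint_right.1 hd.1.1 ha)
  have ht : (t.map fun I => I.erase a) = t := by
    conv_rhs => rw [← List.map_id t]
    exact List.map_congr_left fun I hI =>
      Finset.erase_eq_of_notMem (Finset.disjoint_left.1 (hd.2.1 I hI) ha)
  rw [hX, ht]

/-- Straightening: a commutator with smallest index `a` is a combination of commutators with `a`
in the second slot. -/
lemma comm_mem_of_min {N : Submodule (ZMod p) (F p)} {a : ℕ} {l : List (Finset ℕ)}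
    (hl : 2 ≤ l.length) (ha : ∃ I ∈ l, a ∈ I)
    (hN : ∀ X Y t, (X :: Y :: t).Perm l → a ∈ Y → comm p (X :: Y :: t) ∈ N) : comm p l ∈ N := by
  match l, hl with
  | X :: Y :: t, _ =>
    obtain ⟨I, hI, haI⟩ := ha
    simp only [List.mem_cons] at hI
    rcases hI with rfl | rfl | hI
    · rw [comm_antisymm]
      exact neg_mem (hN _ _ _ (List.Perm.swap _ _ _) haI)
    · exact hN _ _ _ (List.Perm.refl _) haI
    · have e := List.perm_cons_erase hI
      rw [comm_perm X Y e, comm_jacobi]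
      have h1 : (I :: X :: Y :: t.erase I).Perm (X :: Y :: t) :=
        ((List.Perm.swap _ _ _).trans ((List.Perm.swap _ _ _).cons X)).trans
          ((e.symm.cons Y).cons X)
      refine sub_mem (hN _ _ _ ((List.Perm.swap _ _ _).trans h1) haI)
        (hN _ _ _ ((List.Perm.swap _ _ _).trans (List.Perm.trans ?_ h1)) haI)
      exact (List.Perm.swap _ _ _).cons I

/-- Straightening, for a commutator without prescribed smallest index. -/
lemma comm_mem {N : Submodule (ZMod p) (F p)} {l : List (Finset ℕ)} (hl : 2 ≤ l.length)
    (hN : ∀ a, (∀ I ∈ l, ∀ x ∈ I, a ≤ x) → (∃ I ∈ l, a ∈ I) → l.Pairwise Disjoint →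
      ∀ X Y t, (X :: Y :: t).Perm l → a ∈ Y →
        P p a ((X :: Y :: t).map fun I => I.erase a) ∈ N) :
    comm p l ∈ N := by
  by_cases hd : l.Pairwise Disjoint
  swap
  · rw [comm_eq_zero_of_not_disjoint hd]; exact zero_mem _
  by_cases he : ∃ x, ∃ I ∈ l, x ∈ I
  · classical
    have hmin : ∀ I ∈ l, ∀ x ∈ I, Nat.find he ≤ x := fun I hI x hx =>
      Nat.find_min' he ⟨I, hI, hx⟩
    refine comm_mem_of_min hl (Nat.find_spec he) fun X Y t e hY => ?_
    rw [comm_eq_P ((e.pairwise_iff (fun {x y} h => Disjoint.symm h)).2 hd) hY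
        fun I hI => hmin I (e.mem_iff.1 hI)]
    exact hN _ hmin (Nat.find_spec he) hd X Y t e hY
  -- No index occurs at all, so all sets are empty and the commutator begins with `[z, z]`.
  · push Not at he
    match l, hl with
    | X :: Y :: t, _ =>
      have hX : X = ∅ := Finset.eq_empty_of_forall_notMem fun x => he x X (by simp)
      have hY : Y = ∅ := Finset.eq_empty_of_forall_notMem fun x => he x Y (by simp)
      rw [hX, hY, comm_cons_cons, lie_self, fold_zero]
      exact zero_mem _

/-! ### Deficits, comparison with the basis, and shapes of small deficit -/

/-- The total deficit of a list of sets with respect to sets of size two. -/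
def dfc (L : List (Finset ℕ)) : ℤ := 2 * (L.length : ℤ) - ((L.map Finset.card).sum : ℤ)

@[simp] lemma dfc_nil : dfc [] = 0 := rfl

@[simp] lemma dfc_cons (X : Finset ℕ) (L : List (Finset ℕ)) : dfc (X :: L) = 2 - #X + dfc L := by
  simp [dfc]; ring

lemma dfc_append (L L' : List (Finset ℕ)) : dfc (L ++ L') = dfc L + dfc L' := by
  induction L with
  | nil => simp
  | cons X L ih => simp [ih, add_assoc]

lemma dfc_perm {L L' : List (Finset ℕ)} (h : L.Perm L') : dfc L = dfc L' := by
  rw [dfc, dfc, h.length_eq, (h.map _).sum_eq]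

lemma dfc_insert {i : ℕ} {l₁ l₂ : List (Finset ℕ)} {I : Finset ℕ} (h : i ∉ I) :
    dfc (l₁ ++ insert i I :: l₂) = dfc (l₁ ++ I :: l₂) - 1 := by
  simp [dfc_append, Finset.card_insert_of_notMem h]; ring

lemma typ_eq (l : List (Finset ℕ)) : typ l = - dfc l := by simp [typ, dfc]

/-- Disjointness means that `a` is removed from exactly one set. This shift by one separates the
deficit of a commutator from that of the list in its `P` form. -/
lemma dfc_map_erase {a : ℕ} {l : List (Finset ℕ)} (hd : l.Pairwise Disjoint)
    (ha : ∃ I ∈ l, a ∈ I) : dfc (l.map fun I => I.erase a) = dfc l + 1 := by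
  induction l with
  | nil => simp at ha
  | cons X t ih =>
    rw [List.pairwise_cons] at hd
    simp only [List.map_cons, dfc_cons]
    by_cases h : a ∈ X
    · have ht : (t.map fun I => I.erase a) = t := by
        conv_rhs => rw [← List.map_id t]
        exact List.map_congr_left fun I hI =>
          Finset.erase_eq_of_notMem (Finset.disjoint_left.1 (hd.1 I hI) h)
      rw [ht, Finset.card_erase_of_mem h, Nat.cast_sub (Finset.card_pos.2 ⟨a, h⟩)]
      push_cast; ring
    · rw [ih hd.2 (by simpa [h] using ha), Finset.erase_eq_of_notMem h]
      ring

/-- A commutator with smallest index in the second slot is, up to the order of the later slots,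
a member of the basis. -/
lemma exists_isBasisIndex {b : ℕ} {X Y : Finset ℕ} {t : List (Finset ℕ)}
    (h : Ok b (X :: Y :: t)) :
    ∃ t', t.Perm t' ∧ IsBasisIndex (X :: insert b Y :: t') ∧
      P p b (X :: Y :: t) = comm p (X :: insert b Y :: t') := by
  let r : Finset ℕ → Finset ℕ → Prop := fun I J => I.min ≤ J.min
  have : Std.Total r := ⟨fun I J => le_total _ _⟩
  have : IsTrans (Finset ℕ) r := ⟨fun I J K => le_trans⟩
  classical
  have e : t.Perm (t.insertionSort r) := (List.perm_insertionSort r t).symm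
  refine ⟨t.insertionSort r, e, ?_, ?_⟩
  · have h' := (Ok.perm ((e.cons Y).cons X)).1 h
    have hmin : ∀ I ∈ X :: Y :: t.insertionSort r, (b : WithTop ℕ) < I.min := by
      intro I hI
      rcases I.eq_empty_or_nonempty with rfl | hne
      · simp
      · rw [← Finset.coe_min' hne]
        exact WithTop.coe_lt_coe.2 (h'.2 I hI _ (Finset.min'_mem _ _))
    have hb : (insert b Y).min = (b : WithTop ℕ) := by
      rw [Finset.min_insert]
      exact min_eq_left (hmin Y (by simp)).le
    have hbn : ∀ I ∈ X :: Y :: t.insertionSort r, b ∉ I := fun I hI hbI =>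
      (h'.2 I hI b hbI).ne rfl
    refine ⟨?_, ?_, ?_⟩
    · have hp := h'.1
      simp only [List.pairwise_cons, List.mem_cons, forall_eq_or_imp, Finset.disjoint_insert_left,
        Finset.disjoint_insert_right] at hp hbn ⊢
      exact ⟨⟨⟨hbn.1, hp.1.1⟩, hp.1.2⟩, fun I hI => ⟨hbn.2.2 I hI, hp.2.1 I hI⟩, hp.2.2⟩
    · rw [hb]; exact hmin X (by simp)
    · rw [List.pairwise_cons]
      refine ⟨fun I hI => ?_, List.pairwise_insertionSort r t⟩
      rw [hb]; exact (hmin I (by simp [hI])).le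
  · rw [P_of_ok h, comm_perm _ _ e]

/-- A member of the basis of degree at least two in `z`. -/
lemma exists_eq_P_of_isBasisIndex {X Y : Finset ℕ} {t : List (Finset ℕ)}
    (h : IsBasisIndex (X :: Y :: t)) :
    ∃ a Y', a ∉ Y' ∧ Y = insert a Y' ∧ Ok a (X :: Y' :: t) ∧
      comm p (X :: Y :: t) = P p a (X :: Y' :: t) := by
  obtain ⟨hd, hlt, hs⟩ := h
  have hne : Y.Nonempty := by
    by_contra hY
    rw [Finset.not_nonempty_iff_eq_empty] at hY
    simp [hY] at hlt
  set a := Y.min' hne with ha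
  have haY : a ∈ Y := Finset.min'_mem _ _
  have hle : ∀ I : Finset ℕ, Y.min ≤ I.min → ∀ x ∈ I, a ≤ x := fun I hI x hx => by
    have := hI.trans (Finset.min_le hx)
    rw [← Finset.coe_min' hne] at this
    exact WithTop.coe_le_coe.1 this
  have hmin : ∀ I ∈ X :: Y :: t, ∀ x ∈ I, a ≤ x := by
    simp only [List.mem_cons, forall_eq_or_imp]
    rw [List.pairwise_cons] at hs
    exact ⟨hle X hlt.le, hle Y le_rfl, fun I hI => hle I (hs.1 I hI)⟩
  have hok := ok_map_erase hd hmin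
  have e := comm_eq_P (p := p) hd haY hmin
  simp only [List.pairwise_cons, List.mem_cons, forall_eq_or_imp] at hd
  have hX : X.erase a = X := Finset.erase_eq_of_notMem (Finset.disjoint_right.1 hd.1.1 haY)
  have ht : (t.map fun I => I.erase a) = t := by
    conv_rhs => rw [← List.map_id t]
    exact List.map_congr_left fun I hI =>
      Finset.erase_eq_of_notMem (Finset.disjoint_left.1 (hd.2.1 I hI) haY)
  simp only [List.map_cons, hX, ht] at hok e
  exact ⟨a, Y.erase a, Finset.notMem_erase _ _, (Finset.insert_erase haY).symm, hok, e⟩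

lemma exists_of_dfc_pos {L : List (Finset ℕ)} (h : 0 < dfc L) : ∃ I ∈ L, #I < 2 := by
  by_contra! H
  induction L with
  | nil => simp at h
  | cons X L ih =>
    simp only [List.mem_cons, forall_eq_or_imp] at H
    rw [dfc_cons] at h
    refine ih ?_ H.2
    have := H.1
    omega

lemma dfc_nonneg {L : List (Finset ℕ)} (h : ∀ I ∈ L, #I ≤ 2) : 0 ≤ dfc L := by
  induction L with
  | nil => simp
  | cons X L ih =>
    simp only [List.mem_cons, forall_eq_or_imp] at h
    rw [dfc_cons]
    have := ih h.2
    omega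

lemma dfc_eq_zero {L : List (Finset ℕ)} (h : ∀ I ∈ L, #I = 2) : dfc L = 0 := by
  induction L with
  | nil => simp
  | cons X L ih =>
    simp only [List.mem_cons, forall_eq_or_imp] at h
    rw [dfc_cons, ih h.2, h.1]; rfl

lemma card_eq_two_of_dfc {L : List (Finset ℕ)} (h : ∀ I ∈ L, #I ≤ 2) (h0 : dfc L = 0) :
    ∀ I ∈ L, #I = 2 := by
  intro I hI
  have e := dfc_perm (List.perm_cons_erase hI)
  have := dfc_nonneg (L := L.erase I) fun J hJ => h J (List.mem_of_mem_erase hJ)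
  have := h I hI
  rw [dfc_cons] at e
  omega

/-- Removing a set of size less than two from a list with positive total deficit. -/
lemma exists_perm_of_dfc_pos {L : List (Finset ℕ)} (h : ∀ I ∈ L, #I ≤ 2) (h0 : 0 < dfc L) :
    ∃ I L', L.Perm (I :: L') ∧ (∀ I ∈ L', #I ≤ 2) ∧
      ((I = ∅ ∧ dfc L' = dfc L - 2) ∨ ((∃ i, I = {i}) ∧ dfc L' = dfc L - 1)) := by
  obtain ⟨I, hI, hc⟩ := exists_of_dfc_pos h0
  have e := List.perm_cons_erase hI
  refine ⟨I, L.erase I, e, fun J hJ => h J (List.mem_of_mem_erase hJ), ?_⟩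
  have e' := dfc_perm e
  rw [dfc_cons] at e'
  obtain h1 | h1 : #I = 0 ∨ #I = 1 := by omega
  · exact .inl ⟨Finset.card_eq_zero.1 h1, by omega⟩
  · exact .inr ⟨Finset.card_eq_one.1 h1, by omega⟩

lemma exists_perm_of_dfc_one {L : List (Finset ℕ)} (h : ∀ I ∈ L, #I ≤ 2) (h0 : dfc L = 1) :
    ∃ i r, L.Perm ({i} :: r) ∧ ∀ I ∈ r, #I = 2 := by
  obtain ⟨I, L', e, h', ⟨rfl, hd⟩ | ⟨⟨i, rfl⟩, hd⟩⟩ := exists_perm_of_dfc_pos h (by omega)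
  · have := dfc_nonneg h'; omega
  · exact ⟨i, L', e, card_eq_two_of_dfc h' (by omega)⟩

lemma exists_perm_of_dfc_two {L : List (Finset ℕ)} (h : ∀ I ∈ L, #I ≤ 2) (h0 : dfc L = 2) :
    (∃ r, L.Perm (∅ :: r) ∧ ∀ I ∈ r, #I = 2) ∨
      ∃ i j r, L.Perm ({i} :: {j} :: r) ∧ ∀ I ∈ r, #I = 2 := by
  obtain ⟨I, L', e, h', ⟨rfl, hd⟩ | ⟨⟨i, rfl⟩, hd⟩⟩ := exists_perm_of_dfc_pos h (by omega)
  · exact .inl ⟨L', e, card_eq_two_of_dfc h' (by omega)⟩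
  · obtain ⟨j, r, e', hr⟩ := exists_perm_of_dfc_one h' (by omega)
    exact .inr ⟨i, j, r, e.trans (e'.cons _), hr⟩

lemma exists_perm_of_dfc_three {L : List (Finset ℕ)} (h : ∀ I ∈ L, #I ≤ 2) (h0 : dfc L = 3) :
    (∃ i r, L.Perm (∅ :: {i} :: r) ∧ ∀ I ∈ r, #I = 2) ∨
      ∃ i j k r, L.Perm ({i} :: {j} :: {k} :: r) ∧ ∀ I ∈ r, #I = 2 := by
  obtain ⟨I, L', e, h', ⟨rfl, hd⟩ | ⟨⟨i, rfl⟩, hd⟩⟩ := exists_perm_of_dfc_pos h (by omega)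
  · obtain ⟨i, r, e', hr⟩ := exists_perm_of_dfc_one h' (by omega)
    exact .inl ⟨i, r, e.trans (e'.cons _), hr⟩
  · obtain ⟨r, e', hr⟩ | ⟨j, k, r, e', hr⟩ := exists_perm_of_dfc_two h' (by omega)
    · exact .inl ⟨i, r, e.trans ((e'.cons _).trans (List.Perm.swap _ _ _)), hr⟩
    · exact .inr ⟨i, j, k, r, e.trans (e'.cons _), hr⟩

/-! ### Calculus modulo `J` -/

/-- Right bracketing with a fixed element, on the quotient by `J`. -/
def der (x : F p) : (F p ⧸ (J p).toSubmodule) →ₗ[ZMod p] (F p ⧸ (J p).toSubmodule) :=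
  (J p).toSubmodule.mapQ (J p).toSubmodule (-(LieAlgebra.ad (ZMod p) (F p) x)) fun u hu => by
    simpa using (J p).lie_mem hu

/-- The class of `P b L` modulo `J`. -/
def q (p : ℕ) (b : ℕ) (L : List (Finset ℕ)) : F p ⧸ (J p).toSubmodule :=
  (J p).toSubmodule.mkQ (P p b L)

lemma q_eq_zero {b : ℕ} {L : List (Finset ℕ)} : q p b L = 0 ↔ P p b L ∈ J p :=
  Submodule.Quotient.mk_eq_zero _

lemma der_mkQ (x u : F p) : der x ((J p).toSubmodule.mkQ u) = (J p).toSubmodule.mkQ ⁅u, x⁆ := by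
  simp [der]

lemma lie_mem_J {u : F p} (h : u ∈ J p) (x : F p) : ⁅u, x⁆ ∈ J p := by
  rw [← lie_skew]; exact neg_mem ((J p).lie_mem h)

lemma ok_singleton_cons {b i : ℕ} {L : List (Finset ℕ)} :
    Ok b ({i} :: L) ↔ b < i ∧ (∀ I ∈ L, i ∉ I) ∧ Ok b L := by
  rw [ok_cons]; simp; tauto

lemma der_c_q {b i : ℕ} {L : List (Finset ℕ)} (h : Ok b ({i} :: L)) :
    der (c p i) (q p b L) = sumIns i L (q p b) := by
  rw [ok_singleton_cons] at h
  rw [q, der_mkQ, P_lie_c h.1 h.2.1]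
  exact sumIns_map (J p).toSubmodule.mkQ.toAddMonoidHom i L (P p b)

lemma der_z_q {b : ℕ} {L : List (Finset ℕ)} (h : 2 ≤ L.length) :
    der (z p) (q p b L) = q p b (L ++ [∅]) := by
  rw [q, der_mkQ, P_lie_z h, q]

lemma q_perm (b : ℕ) (X Y : Finset ℕ) {t t' : List (Finset ℕ)} (h : t.Perm t') :
    q p b (X :: Y :: t) = q p b (X :: Y :: t') := by
  rw [q, P_perm b X Y h, q]

lemma q_swap (b : ℕ) (X Y Z W : Finset ℕ) (t : List (Finset ℕ)) :
    q p b (X :: Y :: Z :: W :: t) = q p b (X :: Y :: W :: Z :: t) :=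
  q_perm b X Y (List.Perm.swap _ _ _)

lemma q_of_not_ok {b : ℕ} {L : List (Finset ℕ)} (h : ¬ Ok b L) : q p b L = 0 := by
  rw [q, P_of_not_ok h, map_zero]

lemma comm_mem_J_of_isBasisIndex {l : List (Finset ℕ)} (h : IsBasisIndex l)
    (h' : (l ≠ [∅] ∧ (typ l < -1 ∨ 1 < typ l)) ∨ HasLargeSet l) : comm p l ∈ J p :=
  LieSubmodule.subset_lieSpan ⟨l, h, h', rfl⟩

/-- The commutator contains `b` besides the sets listed, so its type is one minus the deficit, and
the forbidden types are the deficits outside 0, 1, 2. -/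
lemma P_mem_J_of_dfc {b : ℕ} {X Y : Finset ℕ} {t : List (Finset ℕ)}
    (h : dfc (X :: Y :: t) < 0 ∨ 2 < dfc (X :: Y :: t)) : P p b (X :: Y :: t) ∈ J p := by
  by_cases hO : Ok b (X :: Y :: t)
  · obtain ⟨t', e, hB, hP⟩ := exists_isBasisIndex (p := p) hO
    rw [hP]
    refine comm_mem_J_of_isBasisIndex hB (.inl ⟨by simp, ?_⟩)
    have hb : b ∉ Y := fun hb => (hO.2 Y (by simp) b hb).ne rfl
    rw [dfc_perm ((e.cons Y).cons X)] at h
    simp only [typ_eq, dfc_cons, Finset.card_insert_of_notMem hb] at h ⊢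
    push_cast
    omega
  · rw [P_of_not_ok hO]; exact zero_mem _

lemma P_mem_J_of_large {b : ℕ} {X Y : Finset ℕ} {t : List (Finset ℕ)}
    (h : 2 < #X ∨ ∃ I ∈ t, 2 < #I) : P p b (X :: Y :: t) ∈ J p := by
  by_cases hO : Ok b (X :: Y :: t)
  · obtain ⟨t', e, hB, hP⟩ := exists_isBasisIndex (p := p) hO
    rw [hP]
    refine comm_mem_J_of_isBasisIndex hB (.inr ?_)
    simpa [HasLargeSet, e.mem_iff] using h
  · rw [P_of_not_ok hO]; exact zero_mem _

lemma q_dfc {b : ℕ} {X Y : Finset ℕ} {t : List (Finset ℕ)}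
    (h : dfc (X :: Y :: t) < 0 ∨ 2 < dfc (X :: Y :: t)) : q p b (X :: Y :: t) = 0 :=
  q_eq_zero.2 (P_mem_J_of_dfc h)

lemma q_large {b : ℕ} {X Y : Finset ℕ} {t : List (Finset ℕ)} (h : 2 < #X ∨ ∃ I ∈ t, 2 < #I) :
    q p b (X :: Y :: t) = 0 :=
  q_eq_zero.2 (P_mem_J_of_large h)

/-- Straightening preserves the type, so this holds for arbitrary commutators and not only for basis
elements. No index has been split off here, whence the shifted bounds. -/
lemma comm_mem_J_of_dfc {l : List (Finset ℕ)} (hl : 2 ≤ l.length) (h : dfc l < -1 ∨ 1 < dfc l) :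
    comm p l ∈ J p := by
  refine comm_mem (N := (J p).toSubmodule) hl fun a _ ha hd X Y t e _ => P_mem_J_of_dfc ?_
  rw [← List.map_cons (f := fun I : Finset ℕ => I.erase a),
    ← List.map_cons (f := fun I : Finset ℕ => I.erase a), dfc_perm (e.map _), dfc_map_erase hd ha]
  omega

/-- The sum over the insertions into pairs of a function that vanishes on lists with a set with
more than two elements. -/
lemma sumIns_pairs {M : Type*} [AddCommMonoid M] {i : ℕ} {r : List (Finset ℕ)}
    {f : List (Finset ℕ) → M} (hf : ∀ s, (∃ I ∈ s, 2 < #I) → f s = 0)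
    (hr : ∀ I ∈ r, #I = 2) (hi : ∀ I ∈ r, i ∉ I) : sumIns i r f = 0 := by
  refine sumIns_eq_zero fun l₁ I l₂ e => hf _ ⟨insert i I, by simp, ?_⟩
  have hI : I ∈ r := by simp [e]
  rw [Finset.card_insert_of_notMem (hi I hI), hr I hI]
  omega

lemma der_two {b i : ℕ} {X Y : Finset ℕ} {r : List (Finset ℕ)} (h : Ok b ({i} :: X :: Y :: r))
    (hr : ∀ I ∈ r, #I = 2) :
    der (c p i) (q p b (X :: Y :: r)) =
        q p b (insert i X :: Y :: r) + q p b (X :: insert i Y :: r) := by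
  rw [der_c_q h, sumIns_cons, sumIns_cons, sumIns_pairs (fun s hs => q_large (.inr hs)) hr,
    add_zero]
  exact fun I hI => (ok_singleton_cons.1 h).2.1 I (by simp [hI])

lemma der_three {b i : ℕ} {X Y Z : Finset ℕ} {r : List (Finset ℕ)}
    (h : Ok b ({i} :: X :: Y :: Z :: r)) (hr : ∀ I ∈ r, #I = 2) :
    der (c p i) (q p b (X :: Y :: Z :: r)) = q p b (insert i X :: Y :: Z :: r)
      + (q p b (X :: insert i Y :: Z :: r) + q p b (X :: Y :: insert i Z :: r)) := by
  rw [der_c_q h, sumIns_cons, sumIns_cons, sumIns_cons, sumIns_pairs _ hr, add_zero]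
  · exact fun I hI => (ok_singleton_cons.1 h).2.1 I (by simp [hI])
  · exact fun s ⟨I, hI, hc⟩ => q_large (.inr ⟨I, by simp [hI], hc⟩)

lemma der_four {b i : ℕ} {X Y Z W : Finset ℕ} {r : List (Finset ℕ)}
    (h : Ok b ({i} :: X :: Y :: Z :: W :: r)) (hr : ∀ I ∈ r, #I = 2) :
    der (c p i) (q p b (X :: Y :: Z :: W :: r)) = q p b (insert i X :: Y :: Z :: W :: r)
      + (q p b (X :: insert i Y :: Z :: W :: r) + (q p b (X :: Y :: insert i Z :: W :: r)
      + q p b (X :: Y :: Z :: insert i W :: r))) := by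
  rw [der_c_q h, sumIns_cons, sumIns_cons, sumIns_cons, sumIns_cons, sumIns_pairs _ hr, add_zero]
  · exact fun I hI => (ok_singleton_cons.1 h).2.1 I (by simp [hI])
  · exact fun s ⟨I, hI, hc⟩ => q_large (.inr ⟨I, by simp [hI], hc⟩)

/-- The second source of relations modulo `J`: bracketing an element of `J` with a `c b` below all
its indices. Unlike the derivations `der (c p i)` with `b < i`, it exchanges sets between the slots.
-/
lemma q_of_comm_mem {b : ℕ} {X Y : Finset ℕ} {t : List (Finset ℕ)} (h : Ok b (X :: Y :: t))
    (hJ : comm p (X :: Y :: t) ∈ J p) :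
    q p b (X :: Y :: t) - q p b (Y :: X :: t)
      + sumPick t (fun I s => q p b (X :: I :: Y :: s) - q p b (Y :: I :: X :: s)) = 0 := by
  have h1 : (J p).toSubmodule.mkQ ⁅comm p (X :: Y :: t), c p b⁆ = 0 :=
    (Submodule.Quotient.mk_eq_zero _).2 (lie_mem_J hJ (c p b))
  rw [comm_lie_c_of_ok h, map_add, map_sub] at h1
  have h2 := sumPick_map (J p).toSubmodule.mkQ.toAddMonoidHom t
    fun I s => P p b (X :: I :: Y :: s) - P p b (Y :: I :: X :: s)
  simp only [LinearMap.toAddMonoidHom_coe, map_sub] at h2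
  rw [h2] at h1
  exact h1

/-- Straighten `⟨Y, X, t⟩` with respect to `a` instead of `b`: the large set `Y` does not contain
`a`, hence never enters the second slot, and the commutator lies in `J`. In its bracket with `c b`
every term but the wanted one has `Y` outside the second slot. -/
lemma q_large_of_min {b a : ℕ} {X Y : Finset ℕ} {t : List (Finset ℕ)} (hY : 2 < #Y)
    (haY : a ∉ Y) (ha : ∃ I ∈ X :: Y :: t, a ∈ I) (hmin : ∀ I ∈ X :: Y :: t, ∀ x ∈ I, a ≤ x) :
    q p b (X :: Y :: t) = 0 := by
  by_cases hO : Ok b (X :: Y :: t)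
  swap
  · exact q_of_not_ok hO
  have e0 : (Y :: X :: t).Perm (X :: Y :: t) := List.Perm.swap _ _ _
  have hO' := (Ok.perm e0).2 hO
  have hJ : comm p (Y :: X :: t) ∈ J p := by
    refine comm_mem_of_min (N := (J p).toSubmodule) (a := a) (by simp) ?_ fun X' Y' t' e haY' => ?_
    · obtain ⟨I, hI, h⟩ := ha
      exact ⟨I, e0.mem_iff.2 hI, h⟩
    · have e1 := e.trans e0
      rw [comm_eq_P ((e1.pairwise_iff (fun {x y} h => Disjoint.symm h)).2 hO.1) haY'
        fun I hI => hmin I (e1.mem_iff.1 hI)]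
      refine P_mem_J_of_large ?_
      have hYm : Y ∈ X' :: Y' :: t' := e1.mem_iff.2 (by simp)
      simp only [List.mem_cons] at hYm
      rcases hYm with rfl | rfl | hYm
      · left; simpa [Finset.erase_eq_of_notMem haY] using hY
      · exact absurd haY' haY
      · refine .inr ⟨Y.erase a, List.mem_map_of_mem hYm, ?_⟩
        rwa [Finset.erase_eq_of_notMem haY]
  have h1 := q_of_comm_mem hO' hJ
  rw [q_large (.inl hY), zero_sub, sumPick_eq_zero, add_zero, neg_eq_zero] at h1
  · exact h1
  · intro I s _
    rw [q_large (.inl hY), q_large (.inr ⟨Y, by simp, hY⟩), sub_zero]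

/-! ### Large sets in the second slot: induction step and deficit two -/

/-- Modulo `J`, commutators of deficit `d` vanish if the set in the second slot has more than two
elements apart from the smallest index. -/
def LargeVanish (p : ℕ) (d : ℤ) : Prop :=
  ∀ b X Y t, dfc (X :: Y :: t) = d → 2 < #Y → q p b (X :: Y :: t) = 0

lemma largeVanish_of_lt {d : ℤ} (hd : 2 < d) : LargeVanish p d := fun b X Y t h _ =>
  q_dfc (.inr (by omega))

/-- A commutator with a large set in the second slot lies in `J` unless this set contains the second
smallest index. -/
lemma q_large_cases {b : ℕ} {X Y : Finset ℕ} {t : List (Finset ℕ)} (hY : 2 < #Y)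
    (H : ∀ a B, a ∉ B → insert a B = Y → b < a → Ok a (X :: B :: t) → (∀ I ∈ X :: t, #I ≤ 2) →
      q p b (X :: Y :: t) = 0) : q p b (X :: Y :: t) = 0 := by
  by_cases hO : Ok b (X :: Y :: t)
  swap
  · exact q_of_not_ok hO
  by_cases hl : 2 < #X ∨ ∃ I ∈ t, 2 < #I
  · exact q_large hl
  push Not at hl
  obtain ⟨a, ⟨I, hI, haI⟩, hmin⟩ :
      ∃ a, (∃ I ∈ X :: Y :: t, a ∈ I) ∧ ∀ I ∈ X :: Y :: t, ∀ x ∈ I, a ≤ x := by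
    classical
    have he : ∃ x, ∃ I ∈ X :: Y :: t, x ∈ I := by
      obtain ⟨x, hx⟩ := Finset.card_pos.1 (by omega : 0 < #Y)
      exact ⟨x, Y, by simp, hx⟩
    exact ⟨Nat.find he, Nat.find_spec he, fun I hI x hx => Nat.find_min' he ⟨I, hI, hx⟩⟩
  by_cases haY : a ∈ Y
  swap
  · exact q_large_of_min hY haY ⟨I, hI, haI⟩ hmin
  refine H a (Y.erase a) (Finset.notMem_erase _ _) (Finset.insert_erase haY) (hO.2 I hI a haI) ?_
    (by simpa using hl)
  have h := ok_map_erase hO.1 hmin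
  have hX : X.erase a = X := Finset.erase_eq_of_notMem fun h =>
    Finset.disjoint_left.1 ((List.pairwise_cons.1 hO.1).1 _ List.mem_cons_self) h haY
  have ht : (t.map fun I => I.erase a) = t := by
    conv_rhs => rw [← List.map_id t]
    exact List.map_congr_left fun I hI => Finset.erase_eq_of_notMem <|
      Finset.disjoint_left.1 ((List.pairwise_cons.1 (List.pairwise_cons.1 hO.1).2).1 I hI) haY
  simpa only [List.map_cons, hX, ht] using h

/-- The step from deficit `d + 1` to `d` for sets with more than three elements. -/
lemma q_large_step {d : ℤ} (H : LargeVanish p (d + 1)) {b : ℕ} {X Y : Finset ℕ}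
    {t : List (Finset ℕ)} (hd : dfc (X :: Y :: t) = d) (hY : 3 < #Y) :
    q p b (X :: Y :: t) = 0 := by
  refine q_large_cases (by omega) fun a B haB hYB hba hoka hl => ?_
  subst hYB
  simp only [dfc_cons, Finset.card_insert_of_notMem haB] at hd hY
  have hB' : 2 < #B := by omega
  have hok := hoka.cons_singleton hba
  have h1 : q p b (X :: B :: t) = 0 := by
    refine H b X B t ?_ hB'
    simp only [dfc_cons]; push_cast at hd; omega
  have h2 := der_c_q (p := p) hok
  have hmin' : ∀ I ∈ X :: B :: t, ∀ x ∈ I, a ≤ x := fun I hI x hx => (hoka.2 I hI x hx).le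
  -- Bracket the vanishing class of `X :: B :: t` with `c a`. Unless `a` returns to `B`, it is the
  -- second smallest index and lies outside the large set `B`, so only the wanted term survives.
  rw [h1, map_zero, sumIns_cons, sumIns_cons, q_large_of_min hB' haB ⟨insert a X, by simp, by simp⟩,
    sumIns_eq_zero, zero_add, add_zero] at h2
  · exact h2.symm
  · intro l₁ I l₂ e
    refine q_large_of_min hB' haB ⟨insert a I, by simp, by simp⟩ ?_
    intro J hJ x hx
    simp only [List.mem_cons, List.mem_append, e] at hJ hmin'
    rcases hJ with rfl | rfl | hJ | rfl | hJ
    · exact hmin' _ (by simp) x hx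
    · exact hmin' _ (by simp) x hx
    · exact hmin' J (by simp [hJ]) x hx
    · rcases Finset.mem_insert.1 hx with rfl | hx
      · exact le_rfl
      · exact hmin' I (by simp) x hx
    · exact hmin' J (by simp [hJ]) x hx
  · intro J hJ x hx
    simp only [List.mem_cons] at hJ hmin'
    rcases hJ with rfl | rfl | hJ
    · rcases Finset.mem_insert.1 hx with rfl | hx
      · exact le_rfl
      · exact hmin' X (by simp) x hx
    · exact hmin' _ (by simp) x hx
    · exact hmin' J (by simp [hJ]) x hx

/-- The step from deficit `d + 1` to `d`, up to the case of sets of size three in the second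
slot that contain the second smallest index. -/
lemma largeVanish_step {d : ℤ} (H : LargeVanish p (d + 1))
    (h3 : ∀ b a X B t, b < a → Ok a (X :: B :: t) → #B = 2 → (∀ I ∈ X :: t, #I ≤ 2) →
      dfc (X :: t) = d + 1 → q p b (X :: insert a B :: t) = 0) : LargeVanish p d := by
  intro b X Y t hd hY
  by_cases hY3 : 3 < #Y
  · exact q_large_step H hd hY3
  refine q_large_cases hY fun a B haB hYB hba hoka hl => ?_
  subst hYB
  simp only [dfc_cons, Finset.card_insert_of_notMem haB] at hd hY hY3
  refine h3 b a X B t hba hoka (by omega) hl ?_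
  rw [dfc_cons]; push_cast at hd; omega

/-- Commutators with a large set in the second slot are symmetric in the other slots, provided
that a certain commutator lies in `J`. -/
lemma q_symm_of_large {b : ℕ} {X Y Z : Finset ℕ} {t : List (Finset ℕ)} (hY : 2 < #Y)
    (hJ : comm p (X :: Z :: Y :: t) ∈ J p) :
    q p b (X :: Y :: Z :: t) = q p b (Z :: Y :: X :: t) := by
  have e1 : (X :: Z :: Y :: t).Perm (X :: Y :: Z :: t) := (List.Perm.swap _ _ _).cons _
  have e2 : (X :: Z :: Y :: t).Perm (Z :: Y :: X :: t) :=
    (List.Perm.swap _ _ _).trans ((List.Perm.swap _ _ _).cons _)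
  by_cases hO : Ok b (X :: Z :: Y :: t)
  · have h := q_of_comm_mem hO hJ
    rw [q_large (.inr ⟨Y, by simp, hY⟩), q_large (.inr ⟨Y, by simp, hY⟩), sumPick_cons,
      sumPick_eq_zero] at h
    · simpa [sub_eq_zero] using h
    · intro I s _
      rw [q_large (.inr ⟨Y, by simp, hY⟩), q_large (.inr ⟨Y, by simp, hY⟩), sub_zero]
  · rw [q_of_not_ok (mt (Ok.perm e1).2 hO), q_of_not_ok (mt (Ok.perm e2).2 hO)]

/-- In deficit two the commutator required by `q_symm_of_large` is in `J` by its type alone, so all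
slots except the second may be permuted. -/
lemma q_perm_of_large {b : ℕ} {X Y X' : Finset ℕ} {t t' : List (Finset ℕ)} (hY : 2 < #Y)
    (hd : dfc (X :: Y :: t) = 2) (e : (X :: t).Perm (X' :: t')) :
    q p b (X :: Y :: t) = q p b (X' :: Y :: t') := by
  by_cases hX : X = X'
  · subst hX
    exact q_perm b X Y ((List.perm_cons _).1 e)
  · have hm : X' ∈ t := by simpa [Ne.symm hX] using e.mem_iff.2 (List.mem_cons_self (a := X'))
    have e1 := List.perm_cons_erase hm
    have e2 : t'.Perm (X :: t.erase X') :=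
      (List.perm_cons X').1 (e.symm.trans ((e1.cons X).trans (List.Perm.swap _ _ _)))
    rw [q_perm b X Y e1, q_perm b X' Y e2]
    refine q_symm_of_large hY (comm_mem_J_of_dfc (by simp) (.inr ?_))
    have := dfc_perm e1
    simp only [dfc_cons] at hd this ⊢
    omega

/-- The only place where the characteristic matters. -/
lemma eq_zero_of_eq_neg [Fact p.Prime] (hp : p ≠ 2) {M : Type*} [AddCommGroup M]
    [Module (ZMod p) M] {x : M} (h : x = -x) : x = 0 := by
  have h2 : (2 : ZMod p) ≠ 0 := by
    intro h2
    have h3 := (ZMod.natCast_eq_zero_iff 2 p).1 (by exact_mod_cast h2)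
    exact hp (((Nat.prime_dvd_prime_iff_eq Fact.out Nat.prime_two).1 h3))
  have h3 : (2 : ZMod p) • x = 0 := by rw [two_smul]; nth_rewrite 2 [h]; simp
  exact (smul_eq_zero.1 h3).resolve_left h2

/-- Distribute `a` and `k` over the slots other than `B` by brackets in both orders. Inserting `k`
into `B` gives zero by `q_large_of_min`, whereas inserting `a` gives the class in question;
comparing the orders shows that twice this class vanishes. -/
lemma q_large_empty_singleton [Fact p.Prime] (hp : p ≠ 2) {b a k : ℕ} {B : Finset ℕ}
    {r : List (Finset ℕ)} (hba : b < a) (h : Ok a (B :: {k} :: r)) (hB : #B = 2)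
    (hr : ∀ I ∈ r, #I = 2) : q p b (∅ :: insert a B :: {k} :: r) = 0 := by
  have hb := h.cons_singleton hba
  have haB : a ∉ B := fun ha => (h.2 B (by simp) a ha).ne rfl
  have hkB : k ∉ B := by simp [ok_cons] at h; grind
  have hak : a < k := h.2 {k} (by simp) k (by simp)
  have hcB : 2 < #(insert k B) := by rw [Finset.card_insert_of_notMem hkB]; omega
  have hcA : 2 < #(insert a B) := by rw [Finset.card_insert_of_notMem haB]; omega
  have hmin : ∀ x ∈ B, a < x := h.2 B (by simp)
  have hminr : ∀ I ∈ r, ∀ x ∈ I, a < x := fun I hI => h.2 I (by simp [hI])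
  have e1 := der_three (p := p) (b := b) (i := a) (X := ∅) (Y := B) (Z := {k}) (r := r)
    (by simp [ok_cons] at hb ⊢; grind) hr
  have e2 := der_three (p := p) (b := b) (i := k) (X := ∅) (Y := B) (Z := {a}) (r := r)
    (by simp [ok_cons] at hb ⊢; grind) hr
  have e3 := der_three (p := p) (b := b) (i := k) (X := {a}) (Y := B) (Z := ∅) (r := r)
    (by simp [ok_cons] at hb ⊢; grind) hr
  have e4 := der_three (p := p) (b := b) (i := a) (X := {k}) (Y := B) (Z := ∅) (r := r)
    (by simp [ok_cons] at hb ⊢; grind) hr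
  have hd := dfc_eq_zero hr
  have z2 : q p b (∅ :: insert k B :: {a} :: r) = 0 :=
    q_large_of_min (a := a) hcB (by simp [haB, hak.ne]) (by simp) (by simp; grind)
  have z3 : q p b ({a} :: insert k B :: ∅ :: r) = 0 :=
    q_large_of_min (a := a) hcB (by simp [haB, hak.ne]) (by simp) (by simp; grind)
  -- All four commutators being bracketed have deficit three.
  rw [q_dfc (by simp [hd, hB]), map_zero] at e1 e2 e3 e4
  rw [q_perm_of_large (X' := {k}) (t' := ∅ :: r) hcA
    (by simp [hd, Finset.card_insert_of_notMem haB, hB]) (List.Perm.swap _ _ _)] at e1 ⊢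
  simp only [insert_empty_eq, z2, z3, Finset.pair_comm k a, zero_add] at e1 e2 e3 e4
  refine eq_zero_of_eq_neg hp ?_
  -- The wanted class occurs once in `e1` and once in `e4`; each remaining term occurs once with
  -- either sign and cancels.
  linear_combination (norm := module) e2 + e3 - e1 - e4

lemma zc_mem_J {I : Finset ℕ} (h : 3 < #I) : zc p I ∈ J p := by
  refine comm_mem_J_of_isBasisIndex (l := [I]) (by simp [IsBasisIndex]) (.inl ⟨?_, ?_⟩)
  · rintro ⟨⟩; simp at h
  · simp [typ_eq]; omega

section

variable [Fact p.Prime]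

lemma q_large_empty (hp : p ≠ 2) (b k : ℕ) {Y : Finset ℕ} {r : List (Finset ℕ)} (hY : #Y = 3)
    (hr : ∀ I ∈ r, #I = 2) : q p b (∅ :: Y :: {k} :: r) = 0 := by
  refine q_large_cases (by omega) fun a B haB hYB hba hoka hl => ?_
  subst hYB
  rw [Finset.card_insert_of_notMem haB] at hY
  exact q_large_empty_singleton hp hba (ok_cons.1 hoka).2.2 (by omega) hr

lemma q_large_perm_empty (hp : p ≠ 2) (b k : ℕ) {X Y : Finset ℕ} {t r : List (Finset ℕ)}
    (hY : #Y = 3) (hr : ∀ I ∈ r, #I = 2) (e : (X :: t).Perm (∅ :: {k} :: r)) :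
    q p b (X :: Y :: t) = 0 := by
  rw [q_perm_of_large (by omega) _ e, q_large_empty hp b k hY hr]
  have := dfc_perm e
  simp [dfc_eq_zero hr] at this
  simp [hY]; omega

/-- Relator E3, by bracketing `⟨i, bB, ∅, r⟩`, of deficit three, with `c j`. The term with `j`
inserted into `B` is the large set just treated. -/
lemma q_merge_one_three (hp : p ≠ 2) {b i j : ℕ} {B : Finset ℕ} {r : List (Finset ℕ)}
    (h : Ok b ({i} :: {j} :: B :: r)) (hB : #B = 2) (hr : ∀ I ∈ r, #I = 2) :
    q p b ({i} :: B :: {j} :: r) = - q p b ({j, i} :: B :: ∅ :: r) := by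
  have e := der_three (p := p) (b := b) (i := j) (X := {i}) (Y := B) (Z := ∅) (r := r)
    (by simp [ok_cons] at h ⊢; grind) hr
  have hj : j ∉ B := (ok_singleton_cons.1 (ok_cons.1 h).2.2).2.1 B (by simp)
  rw [q_dfc (by simp [dfc_eq_zero hr, hB]), map_zero, q_large_perm_empty hp b i (Y := insert j B)
    (by rw [Finset.card_insert_of_notMem hj, hB]) hr (List.Perm.swap _ _ _), insert_empty_eq] at e
  linear_combination (norm := module) -e

lemma q_empty_one_three (hp : p ≠ 2) {b : ℕ} {B C : Finset ℕ} {r : List (Finset ℕ)}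
    (h : Ok b (C :: B :: r)) (hB : #B = 2) (hC : #C = 2) (hr : ∀ I ∈ r, #I = 2) :
    q p b (∅ :: B :: C :: r) = q p b (C :: B :: ∅ :: r) := by
  obtain ⟨i, k, hik, rfl⟩ := Finset.card_eq_two.1 hC
  have e := der_three (p := p) (b := b) (i := i) (X := ∅) (Y := B) (Z := {k}) (r := r)
    (by simp [ok_cons] at h ⊢; grind) hr
  have hi : i ∉ B := by simp [ok_cons] at h; grind
  rw [q_dfc (by simp [dfc_eq_zero hr, hB]), map_zero, q_large_empty hp b k (Y := insert i B)
    (by rw [Finset.card_insert_of_notMem hi, hB]) hr, insert_empty_eq,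
    q_merge_one_three hp (by simp [ok_cons] at h ⊢; grind) hB hr, Finset.pair_comm k i] at e
  linear_combination (norm := module) -e

/-- Relator E7: by E4 both sides equal the class with `∅` in the first slot and `A`, `C` in the
tail, where their order is irrelevant. -/
lemma q_empty_one_four (hp : p ≠ 2) {b : ℕ} {A B C : Finset ℕ} {r : List (Finset ℕ)}
    (h : Ok b (A :: B :: C :: r)) (hA : #A = 2) (hB : #B = 2) (hC : #C = 2)
    (hr : ∀ I ∈ r, #I = 2) :
    q p b (A :: B :: ∅ :: C :: r) = q p b (C :: B :: ∅ :: A :: r) := by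
  have e : (A :: B :: C :: r).Perm (C :: B :: A :: r) :=
    ((List.Perm.swap _ _ _).trans ((List.Perm.swap _ _ _).cons _)).trans (.swap _ _ _)
  rw [← q_empty_one_three hp h hB hA (by simpa [hC] using hr),
    ← q_empty_one_three hp ((Ok.perm e).1 h) hB hC (by simpa [hA] using hr), q_swap]

/-- The brackets of `⟨k, bB, l, s⟩` with `c a` and of `⟨a, bB, l, s⟩` with `c k` agree term by term,
by E3 and E7, except for insertion into `B`; there `k` gives zero, so `a` does too. -/
lemma q_large_three_singletons (hp : p ≠ 2) {b a k l s : ℕ} {B : Finset ℕ} {r : List (Finset ℕ)}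
    (hba : b < a) (h : Ok a ({k} :: B :: {l} :: {s} :: r)) (hB : #B = 2) (hr : ∀ I ∈ r, #I = 2) :
    q p b ({k} :: insert a B :: {l} :: {s} :: r) = 0 := by
  have hb := h.cons_singleton hba
  have haB : a ∉ B := fun ha => (h.2 B (by simp) a ha).ne rfl
  have hkB : k ∉ B := (ok_singleton_cons.1 h).2.1 B (by simp)
  have hak : a < k := h.2 {k} (by simp) k (by simp)
  have hcB : 2 < #(insert k B) := by rw [Finset.card_insert_of_notMem hkB]; omega
  have hmin : ∀ I ∈ B :: {l} :: {s} :: r, ∀ x ∈ I, a < x := fun I hI =>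
    h.2 I (List.mem_cons_of_mem _ hI)
  have e1 := der_four (p := p) (b := b) (i := a) (X := {k}) (Y := B) (Z := {l}) (W := {s}) (r := r)
    hb hr
  have e2 := der_four (p := p) (b := b) (i := k) (X := {a}) (Y := B) (Z := {l}) (W := {s}) (r := r)
    ((Ok.perm (List.Perm.swap _ _ _)).1 hb) hr
  have z2 : q p b ({a} :: insert k B :: {l} :: {s} :: r) = 0 :=
    q_large_of_min (a := a) hcB (by simp [haB, hak.ne]) (by simp) (by simp at hmin ⊢; grind)
  have hd := dfc_eq_zero hr
  rw [q_dfc (by simp [hd, hB]), map_zero] at e1 e2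
  have n : a ≠ l ∧ a ≠ s ∧ k ≠ l ∧ k ≠ s ∧ a ≠ k := by simp [ok_cons] at hb; grind
  obtain ⟨nal, nas, nkl, nks, nak⟩ := n
  have m1 := q_merge_one_three hp (b := b) (i := k) (j := s) (B := B) (r := {a, l} :: r)
    (by simp [ok_cons] at hb ⊢; grind) hB (by simpa [Finset.card_pair nal] using hr)
  have m2 := q_merge_one_three hp (b := b) (i := k) (j := l) (B := B) (r := {a, s} :: r)
    (by simp [ok_cons] at hb ⊢; grind) hB (by simpa [Finset.card_pair nas] using hr)
  have m3 := q_merge_one_three hp (b := b) (i := a) (j := s) (B := B) (r := {k, l} :: r)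
    (by simp [ok_cons] at hb ⊢; grind) hB (by simpa [Finset.card_pair nkl] using hr)
  have m4 := q_merge_one_three hp (b := b) (i := a) (j := l) (B := B) (r := {k, s} :: r)
    (by simp [ok_cons] at hb ⊢; grind) hB (by simpa [Finset.card_pair nks] using hr)
  have s1 := q_empty_one_four hp (b := b) (A := {s, k}) (B := B) (C := {a, l}) (r := r)
    (by simp [ok_cons] at hb ⊢; grind) (Finset.card_pair nks.symm) hB (Finset.card_pair nal) hr
  have s2 := q_empty_one_four hp (b := b) (A := {l, k}) (B := B) (C := {a, s}) (r := r)
    (by simp [ok_cons] at hb ⊢; grind) (Finset.card_pair nkl.symm) hB (Finset.card_pair nas) hr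
  rw [q_swap b _ _ {a, l}, m1, m2, s1, s2, Finset.pair_comm a k] at e1
  rw [z2, q_swap b _ _ {k, l}, m3, m4] at e2
  rw [Finset.pair_comm k s, Finset.pair_comm s a, Finset.pair_comm l a] at e2
  rw [Finset.pair_comm s k, Finset.pair_comm l k] at e1
  rw [Finset.pair_comm s k] at e2
  linear_combination (norm := module) e2 - e1

lemma largeVanish_two (hp : p ≠ 2) : LargeVanish p 2 := by
  refine largeVanish_step (largeVanish_of_lt (by norm_num)) fun b a X B t hba h hB hl hd => ?_
  have haB : a ∉ B := fun ha => (h.2 B (by simp) a ha).ne rfl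
  have hc : #(insert a B) = 3 := by rw [Finset.card_insert_of_notMem haB, hB]
  obtain ⟨k, r, e, hr⟩ | ⟨k, l, s, r, e, hr⟩ := exists_perm_of_dfc_three hl hd
  · exact q_large_perm_empty hp b k hc hr e
  · rw [q_perm_of_large (by omega) _ e]
    · refine q_large_three_singletons hp hba ?_ hB hr
      refine (Ok.perm ?_).1 h
      exact (List.Perm.swap _ _ _).trans ((e.cons B).trans (List.Perm.swap _ _ _))
    · simp only [dfc_cons] at hd ⊢; omega

end

/-! ### The relators of deficit two modulo `J` -/

section

variable [Fact p.Prime]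

lemma ok_mem {b : ℕ} {L : List (Finset ℕ)} (h : Ok b L) : ∀ I ∈ L, b ∉ I := fun I hI hb =>
  (h.2 I hI b hb).ne rfl

lemma J_E1 (hp : p ≠ 2) {b i j : ℕ} {A B : Finset ℕ} {r : List (Finset ℕ)}
    (h : Ok b (A :: B :: {i} :: {j} :: r)) (hA : #A = 2) (hB : #B = 2) (hr : ∀ I ∈ r, #I = 2) :
    q p b (A :: B :: {i} :: {j} :: r) + q p b (A :: B :: ∅ :: {i, j} :: r) = 0 := by
  have e := der_four (p := p) (b := b) (i := i) (X := A) (Y := B) (Z := ∅) (W := {j}) (r := r)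
    (by simp [ok_cons] at h ⊢; grind) hr
  have hi : i ∉ A ∧ i ∉ B := by simp [ok_cons] at h; grind
  have hd := dfc_eq_zero hr
  have z1 : q p b (insert i A :: B :: ∅ :: {j} :: r) = 0 :=
    q_large (.inl (by rw [Finset.card_insert_of_notMem hi.1]; omega))
  have z2 : q p b (A :: insert i B :: ∅ :: {j} :: r) = 0 :=
    largeVanish_two hp b _ _ _ (by simp [Finset.card_insert_of_notMem hi.2, hA, hB, hd])
      (by rw [Finset.card_insert_of_notMem hi.2]; omega)
  rw [q_dfc (by simp [hd, hA, hB]), map_zero, z1, z2, insert_empty_eq] at e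
  linear_combination (norm := module) -e

lemma J_E2 {b i k : ℕ} {A : Finset ℕ} {r : List (Finset ℕ)}
    (h : Ok b (A :: {k} :: {i} :: r)) (hA : #A = 2) (hr : ∀ I ∈ r, #I = 2) :
    q p b (A :: {k} :: {i} :: r) + q p b (A :: {k, i} :: ∅ :: r) = 0 := by
  have e := der_three (p := p) (b := b) (i := i) (X := A) (Y := {k}) (Z := ∅) (r := r)
    (by simp [ok_cons] at h ⊢; grind) hr
  have hi : i ∉ A := by simp [ok_cons] at h; grind
  rw [q_dfc (by simp [dfc_eq_zero hr, hA]), map_zero,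
    q_large (.inl (by rw [Finset.card_insert_of_notMem hi]; omega)), insert_empty_eq,
    Finset.pair_comm i k] at e
  linear_combination (norm := module) -e

lemma J_E5 {b i j : ℕ} {A : Finset ℕ} {r : List (Finset ℕ)}
    (h : Ok b (A :: {i} :: {j} :: r)) (hA : #A = 2) (hr : ∀ I ∈ r, #I = 2) :
    q p b (A :: ∅ :: {i, j} :: r) = q p b (A :: {i, j} :: ∅ :: r) := by
  have e := der_three (p := p) (b := b) (i := i) (X := A) (Y := ∅) (Z := {j}) (r := r)
    (by simp [ok_cons] at h ⊢; grind) hr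
  have hi : i ∉ A := by simp [ok_cons] at h; grind
  rw [q_dfc (by simp [dfc_eq_zero hr, hA]), map_zero,
    q_large (.inl (by rw [Finset.card_insert_of_notMem hi]; omega)), insert_empty_eq] at e
  linear_combination (norm := module) -e - J_E2 (p := p) h hA hr

lemma J_E5' {b : ℕ} {A C : Finset ℕ} {r : List (Finset ℕ)}
    (h : Ok b (A :: C :: r)) (hA : #A = 2) (hC : #C = 2) (hr : ∀ I ∈ r, #I = 2) :
    q p b (A :: ∅ :: C :: r) = q p b (A :: C :: ∅ :: r) := by
  obtain ⟨i, j, hij, rfl⟩ := Finset.card_eq_two.1 hC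
  exact J_E5 (by simp [ok_cons] at h ⊢; grind) hA hr

lemma J_E6 (hp : p ≠ 2) {b i j k s : ℕ} {r : List (Finset ℕ)}
    (h : Ok b ({i} :: {s} :: {j} :: {k} :: r)) (hr : ∀ I ∈ r, #I = 2) :
    q p b ({i} :: {s} :: {j, k} :: r) - q p b ({i, j} :: {s, k} :: ∅ :: r)
      - q p b ({i, k} :: {s, j} :: ∅ :: r) = 0 := by
  have e := der_three (p := p) (b := b) (i := k) (X := {i}) (Y := {s}) (Z := {j}) (r := r)
    (by simp [ok_cons] at h ⊢; grind) hr
  have hk : i ≠ k ∧ s ≠ k := by simp [ok_cons] at h; grind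
  have e2 := J_E2 (p := p) (b := b) (A := {i, k}) (k := s) (i := j) (r := r)
    (by simp [ok_cons] at h ⊢; grind) (Finset.card_pair hk.1) hr
  have e3 := q_merge_one_three hp (b := b) (B := {s, k}) (i := i) (j := j) (r := r)
    (by simp [ok_cons] at h ⊢; grind) (Finset.card_pair hk.2) hr
  rw [q_dfc (by simp [dfc_eq_zero hr]), map_zero, Finset.pair_comm k i, Finset.pair_comm k s,
    Finset.pair_comm k j] at e
  rw [Finset.pair_comm j i] at e3
  linear_combination (norm := module) -e - e2 - e3

/-- Exchanging the first two slots cannot come from a single derivation; it comes from `⟨A, ∅, B,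
r⟩`, which is in `J`, by a bracket with the smallest `c b`. The sum over the tail vanishes termwise
by E4. -/
lemma J_E8 (hp : p ≠ 2) {b : ℕ} {A B : Finset ℕ} {r : List (Finset ℕ)}
    (h : Ok b (A :: B :: r)) (hA : #A = 2) (hB : #B = 2) (hr : ∀ I ∈ r, #I = 2) :
    q p b (A :: B :: ∅ :: r) = q p b (B :: A :: ∅ :: r) := by
  have hok : Ok b (A :: ∅ :: B :: r) := by simp [ok_cons] at h ⊢; grind
  have e := q_of_comm_mem (p := p) hok
    (comm_mem_J_of_dfc (by simp) (.inr (by simp [dfc_eq_zero hr, hA, hB])))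
  rw [sumPick_eq_zero, J_E5' h hA hB hr,
    q_empty_one_three hp ((Ok.perm (List.Perm.swap _ _ _)).1 h) hA hB hr] at e
  · linear_combination (norm := module) e
  · intro I s es
    have hs : ∀ I ∈ B :: r, #I = 2 := by simpa [hB] using hr
    rw [q_empty_one_three hp (C := A) (B := I) ((Ok.perm (es.cons A)).1 h)
      (hs I (es.mem_iff.2 (by simp))) hA fun K hK => hs K (es.mem_iff.2 (by simp [hK])), sub_self]

/-- E9 says that two expressions for the same class agree: E6, and the bracket of `⟨i, b, jk⟩` with
`c s` rewritten by E5. -/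
lemma J_E9 (hp : p ≠ 2) {b i j k s : ℕ} {r : List (Finset ℕ)}
    (h : Ok b ({i} :: {j} :: {k} :: {s} :: r)) (hr : ∀ I ∈ r, #I = 2) :
    q p b ({i, k} :: {j, s} :: ∅ :: r) + q p b ({i, j} :: {k, s} :: ∅ :: r)
      + q p b ({i, s} :: {j, k} :: ∅ :: r) = 0 := by
  have n : i ≠ s ∧ s ∉ ({j, k} : Finset ℕ) ∧ j ≠ k := by simp [ok_cons] at h; grind
  have e := der_three (p := p) (b := b) (i := s) (X := {i}) (Y := ∅) (Z := {j, k}) (r := r)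
    (by simp [ok_cons] at h ⊢; grind) hr
  have e5 := J_E5 (p := p) (b := b) (A := {i, s}) (i := j) (j := k) (r := r)
    (by simp [ok_cons] at h ⊢; grind) (Finset.card_pair n.1) hr
  have e6 := J_E6 hp (b := b) (i := i) (j := j) (k := k) (s := s) (r := r)
    (by simp [ok_cons] at h ⊢; grind) hr
  have z : q p b ({i} :: ∅ :: insert s {j, k} :: r) = 0 :=
    q_large (.inr ⟨_, List.mem_cons_self,
      by rw [Finset.card_insert_of_notMem n.2.1, Finset.card_pair n.2.2]; omega⟩)
  rw [q_dfc (by simp [dfc_eq_zero hr, Finset.card_pair n.2.2]), map_zero, z, insert_empty_eq,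
    Finset.pair_comm s i, e5] at e
  rw [Finset.pair_comm s k, Finset.pair_comm s j] at e6
  linear_combination (norm := module) -e - e6

lemma J_D1 {b i j : ℕ} (h : Ok b [{i}, {j}]) :
    q p b [{i}, {j}] + q p b [∅, {i, j}] = 0 := by
  have e := der_two (p := p) (b := b) (i := i) (X := ∅) (Y := {j}) (r := [])
    (by simp [ok_cons] at h ⊢; grind) (by simp)
  rw [q_dfc (by simp), map_zero, insert_empty_eq] at e
  exact e.symm

lemma J_D2 {b : ℕ} {A : Finset ℕ} (h : Ok b [A]) (hA : #A = 2) :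
    q p b [A, ∅] = q p b [∅, A] := by
  have e := q_of_comm_mem (p := p) (b := b) (X := A) (Y := ∅) (t := [])
    (by simp [ok_cons] at h ⊢; grind) (comm_mem_J_of_dfc (by simp) (.inr (by simp [hA])))
  rw [sumPick_nil, add_zero] at e
  exact sub_eq_zero.1 e

/-! ### Large sets in the second slot: deficits one and zero -/

lemma q_large_mem_empty {b : ℕ} {X Y : Finset ℕ} {t r : List (Finset ℕ)} (e : t.Perm (∅ :: r))
    (hd : dfc (X :: Y :: t) < 2) : q p b (X :: Y :: t) = 0 := by
  have h1 := der_z_q (p := p) (b := b) (L := X :: Y :: r) (by simp)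
  have h2 := dfc_perm e
  simp only [dfc_cons, Finset.card_empty] at hd h2
  rw [q_dfc (by left; simp only [dfc_cons]; push_cast at *; omega), map_zero] at h1
  rw [q_perm b X Y (e.trans (List.perm_append_singleton ∅ r).symm)]
  exact h1.symm

lemma largeVanish_one (hp : p ≠ 2) : LargeVanish p 1 := by
  refine largeVanish_step (largeVanish_two hp) fun b a X B t hba h hB hl hd => ?_
  have haB : a ∉ B := ok_mem h B (by simp)
  set Y := insert a B with hYdef
  have hY : #Y = 3 := by rw [hYdef, Finset.card_insert_of_notMem haB, hB]
  have hb := h.cons_singleton hba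
  have hok : Ok b (X :: Y :: t) := by simp [hYdef, ok_cons] at hb ⊢; grind
  simp only [List.mem_cons, forall_eq_or_imp] at hl
  rw [dfc_cons] at hd
  obtain hX | hX | hX : #X = 0 ∨ #X = 1 ∨ #X = 2 := by have := hl.1; omega
  · rw [Finset.card_eq_zero] at hX
    subst hX
    have ht := card_eq_two_of_dfc hl.2 (by simp at hd; omega)
    cases t with
    | nil =>
      rw [q_eq_zero, P_of_ok hok]
      -- Without further slots the commutator comes from a single `[z, c_I]` with four indices,
      -- which is a generator of `J`.
      have hc : comm p [∅, insert b Y] = - ⁅zc p (insert b Y), z p⁆ := by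
        rw [comm_cons_cons, fold_nil, zc_empty, lie_skew]
      rw [hc]
      refine neg_mem (lie_mem_J (zc_mem_J ?_) _)
      rw [Finset.card_insert_of_notMem (ok_mem hok Y (by simp))]
      omega
    | cons A r =>
      simp only [List.mem_cons, forall_eq_or_imp] at ht
      rw [q_symm_of_large (by omega)]
      · exact q_large_mem_empty (List.Perm.refl _) (by simp [dfc_eq_zero ht.2, hY, ht.1])
      -- `⟨∅, A, Y, r⟩` has type `-1`, so its type does not put it in `J`; straightened with respect
      -- to `a` it is the relator E4.
      · have e0 : (∅ :: B :: A :: r).Perm (A :: B :: ∅ :: r) :=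
          ((List.Perm.swap _ _ _).trans ((List.Perm.swap _ _ _).cons _)).trans (.swap _ _ _)
        rw [comm_jacobi, hYdef, ← P_of_ok h, ← P_of_ok ((Ok.perm e0).1 h)]
        have h1 := q_empty_one_three hp (b := a) (B := B) (C := A) (r := r)
          (by simp [ok_cons] at h ⊢; grind) hB ht.1 ht.2
        exact (Submodule.Quotient.eq _).1 h1
  · obtain ⟨k, rfl⟩ := Finset.card_eq_one.1 hX
    obtain ⟨l, r, e, hr⟩ := exists_perm_of_dfc_one hl.2 (by simp at hd; omega)
    rw [q_perm b _ _ e]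
    have hok' := (Ok.perm ((e.cons Y).cons _)).1 hok
    have hl' : l ∉ Y ∧ l ≠ k := by simp only [ok_cons] at hok'; simp at hok'; grind
    have hr' := dfc_eq_zero hr
    -- Start from `∅` in place of `{l}`, where deficit two gives zero. Inserting `l` elsewhere
    -- leaves `∅` in the tail, so that term is a bracket with `z` of an element of `J`.
    have e1 := der_three (p := p) (b := b) (i := l) (X := {k}) (Y := Y) (Z := ∅) (r := r)
      (by simp only [ok_cons] at hok' ⊢; simp at hok' ⊢; grind) hr
    rw [largeVanish_two hp b _ _ _ (by simp [hr', hY]) (by omega), map_zero,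
      q_large_mem_empty (t := ∅ :: r) (List.Perm.refl _)
        (by simp [hr', hY, Finset.card_pair hl'.2]),
      q_large_mem_empty (t := ∅ :: r) (List.Perm.refl _)
        (by simp [hr', hY, Finset.card_insert_of_notMem hl'.1]),
      insert_empty_eq] at e1
    simpa using e1.symm
  · have hdt : dfc t = 2 := by omega
    obtain ⟨r, e, hr⟩ | ⟨k, l, r, e, hr⟩ := exists_perm_of_dfc_two hl.2 hdt
    · exact q_large_mem_empty e (by simp [hdt, hX, hY])
    · rw [q_perm b _ _ e]
      have hok' := (Ok.perm ((e.cons Y).cons _)).1 hok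
      have hr' := dfc_eq_zero hr
      have hk : k ∉ X ∧ k ∉ Y ∧ k ≠ l := by
        simp only [ok_cons] at hok'; simp at hok'; grind
      have e1 := der_four (p := p) (b := b) (i := k) (X := X) (Y := Y) (Z := ∅) (W := {l}) (r := r)
        (by simp only [ok_cons] at hok' ⊢; simp at hok' ⊢; grind) hr
      rw [largeVanish_two hp b _ _ _ (by simp [hr', hX, hY]) (by omega), map_zero,
        q_large (.inl (by rw [Finset.card_insert_of_notMem hk.1]; omega)),
        q_large_mem_empty (t := ∅ :: {l} :: r) (List.Perm.refl _)
          (by simp [hr', hX, hY, Finset.card_insert_of_notMem hk.2.1]),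
        q_large_mem_empty (t := ∅ :: {k, l} :: r) (List.Perm.refl _)
          (by simp [hr', hX, hY, Finset.card_pair hk.2.2]),
        insert_empty_eq] at e1
      simpa using e1.symm

lemma largeVanish_zero (hp : p ≠ 2) : LargeVanish p 0 := by
  refine largeVanish_step (largeVanish_one hp) fun b a X B t hba h hB hl hd => ?_
  have haB : a ∉ B := ok_mem h B (by simp)
  set Y := insert a B with hYdef
  have hY : #Y = 3 := by rw [hYdef, Finset.card_insert_of_notMem haB, hB]
  have hb := h.cons_singleton hba
  have hok : Ok b (X :: Y :: t) := by simp [hYdef, ok_cons] at hb ⊢; grind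
  simp only [List.mem_cons, forall_eq_or_imp] at hl
  rw [dfc_cons] at hd
  have ht0 := dfc_nonneg hl.2
  obtain hX | hX : #X = 1 ∨ #X = 2 := by have := hl.1; omega
  · obtain ⟨k, rfl⟩ := Finset.card_eq_one.1 hX
    have ht := card_eq_two_of_dfc hl.2 (by simp at hd; omega)
    have hk : k ∉ Y := (ok_singleton_cons.1 hok).2.1 Y (by simp)
    -- The competing term has four elements in the second set, and `q_large_step` covers it using
    -- deficit one only.
    have e1 := der_two (p := p) (b := b) (i := k) (X := ∅) (Y := Y) (r := t)
      (by simp only [ok_cons] at hok ⊢; simp at hok ⊢; grind) ht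
    have hc := Finset.card_insert_of_notMem hk
    rw [largeVanish_one hp b _ _ _ (by simp [dfc_eq_zero ht, hY]) (by omega), map_zero,
      q_large_step (d := 0) (largeVanish_one hp) (Y := insert k Y)
          (by simp [dfc_eq_zero ht, hY, hc])
        (by omega), insert_empty_eq] at e1
    simpa using e1.symm
  · obtain ⟨k, r, e, hr⟩ := exists_perm_of_dfc_one hl.2 (by omega)
    rw [q_perm b _ _ e]
    have hok' := (Ok.perm ((e.cons Y).cons _)).1 hok
    have hk : k ∉ X ∧ k ∉ Y := by
      simp only [ok_cons] at hok'; simp at hok'; grind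
    have e1 := der_three (p := p) (b := b) (i := k) (X := X) (Y := Y) (Z := ∅) (r := r)
      (by simp only [ok_cons] at hok' ⊢; simp at hok' ⊢; grind) hr
    have hr' := dfc_eq_zero hr
    rw [largeVanish_one hp b _ _ _ (by simp [hr', hX, hY]) (by omega), map_zero,
      q_large (.inl (by rw [Finset.card_insert_of_notMem hk.1]; omega)),
      q_large_mem_empty (t := ∅ :: r) (List.Perm.refl _)
        (by simp [hr', hX, hY, Finset.card_insert_of_notMem hk.2]), insert_empty_eq] at e1
    simpa using e1.symm

/-- Modulo `J`, commutators with a large set in the second slot vanish. -/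
lemma q_large_second (hp : p ≠ 2) {b : ℕ} {X Y : Finset ℕ} {t : List (Finset ℕ)} (hY : 2 < #Y) :
    q p b (X :: Y :: t) = 0 := by
  by_cases h : dfc (X :: Y :: t) < 0 ∨ 2 < dfc (X :: Y :: t)
  · exact q_dfc h
  obtain h | h | h : dfc (X :: Y :: t) = 0 ∨ dfc (X :: Y :: t) = 1 ∨ dfc (X :: Y :: t) = 2 := by
    omega
  · exact largeVanish_zero hp b X Y t h hY
  · exact largeVanish_one hp b X Y t h hY
  · exact largeVanish_two hp b X Y t h hY

end

/-! ### The relators of deficit one and zero modulo `J` -/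

section

variable [Fact p.Prime]

lemma two_lt_card_insert {i : ℕ} {X : Finset ℕ} (hX : #X = 2) (hi : i ∉ X) : 2 < #(insert i X) := by
  rw [Finset.card_insert_of_notMem hi]; omega

lemma q_insert_one {b i : ℕ} {X Y : Finset ℕ} {t : List (Finset ℕ)} (hX : #X = 2) (hi : i ∉ X) :
    q p b (insert i X :: Y :: t) = 0 :=
  q_large (.inl (two_lt_card_insert hX hi))

lemma q_insert_two (hp : p ≠ 2) {b i : ℕ} {X Y : Finset ℕ} {t : List (Finset ℕ)} (hY : #Y = 2)
    (hi : i ∉ Y) : q p b (X :: insert i Y :: t) = 0 :=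
  q_large_second hp (two_lt_card_insert hY hi)

lemma q_insert_three {b i : ℕ} {X Y Z : Finset ℕ} {t : List (Finset ℕ)} (hZ : #Z = 2)
    (hi : i ∉ Z) : q p b (X :: Y :: insert i Z :: t) = 0 :=
  q_large (.inr ⟨_, by simp, two_lt_card_insert hZ hi⟩)

lemma q_insert_four {b i : ℕ} {X Y Z W : Finset ℕ} {t : List (Finset ℕ)} (hW : #W = 2)
    (hi : i ∉ W) : q p b (X :: Y :: Z :: insert i W :: t) = 0 :=
  q_large (.inr ⟨_, by simp, two_lt_card_insert hW hi⟩)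

/-- This is E4 bracketed with `c i`: insertion into any pair vanishes, the second slot included, so
`i` can only fill the empty set. G2, G3, G4, G5 and D3 arise likewise from E5, E8, E7, E9 and D2. -/
lemma J_G1 (hp : p ≠ 2) {b i : ℕ} {B C : Finset ℕ} {r : List (Finset ℕ)}
    (h : Ok b ({i} :: B :: C :: r)) (hB : #B = 2) (hC : #C = 2) (hr : ∀ I ∈ r, #I = 2) :
    q p b ({i} :: B :: C :: r) = q p b (C :: B :: {i} :: r) := by
  have hm := (ok_singleton_cons.1 h).2.1
  have hCB : Ok b (C :: B :: r) := by
    simp [ok_cons] at h ⊢; grind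
  have e := congrArg (der (c p i)) (q_empty_one_three (p := p) hp hCB hB hC hr)
  rw [der_three (by simp [ok_cons] at h ⊢; grind) hr,
    der_three (by simp [ok_cons] at h ⊢; grind) hr,
    q_insert_two hp hB (hm B (by simp)), q_insert_three hC (hm C (by simp)),
    q_insert_one hC (hm C (by simp)), q_insert_two hp hB (hm B (by simp)), insert_empty_eq] at e
  simpa using e

lemma J_G2 (hp : p ≠ 2) {b k : ℕ} {A C : Finset ℕ} {r : List (Finset ℕ)}
    (h : Ok b ({k} :: A :: C :: r)) (hA : #A = 2) (hC : #C = 2) (hr : ∀ I ∈ r, #I = 2) :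
    q p b (A :: {k} :: C :: r) = q p b (A :: C :: {k} :: r) := by
  have hm := (ok_singleton_cons.1 h).2.1
  have e := congrArg (der (c p k)) (J_E5' (p := p) (ok_cons.1 h).2.2 hA hC hr)
  rw [der_three (by simp [ok_cons] at h ⊢; grind) hr,
    der_three (by simp [ok_cons] at h ⊢; grind) hr,
    q_insert_one hA (hm A (by simp)), q_insert_one hA (hm A (by simp)),
    q_insert_two hp hC (hm C (by simp)), q_insert_three hC (hm C (by simp)), insert_empty_eq] at e
  simpa using e

lemma J_G3 (hp : p ≠ 2) {b k : ℕ} {A B : Finset ℕ} {r : List (Finset ℕ)}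
    (h : Ok b ({k} :: A :: B :: r)) (hA : #A = 2) (hB : #B = 2) (hr : ∀ I ∈ r, #I = 2) :
    q p b (A :: B :: {k} :: r) = q p b (B :: A :: {k} :: r) := by
  have hm := (ok_singleton_cons.1 h).2.1
  have e := congrArg (der (c p k)) (J_E8 (p := p) hp (ok_cons.1 h).2.2 hA hB hr)
  rw [der_three (by simp [ok_cons] at h ⊢; grind) hr,
    der_three (by simp [ok_cons] at h ⊢; grind) hr,
    q_insert_one hA (hm A (by simp)), q_insert_one hB (hm B (by simp)),
    q_insert_two hp hB (hm B (by simp)), q_insert_two hp hA (hm A (by simp)), insert_empty_eq] at e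
  simpa using e

lemma J_G4 (hp : p ≠ 2) {b k : ℕ} {A B C : Finset ℕ} {r : List (Finset ℕ)}
    (h : Ok b ({k} :: A :: B :: C :: r)) (hA : #A = 2) (hB : #B = 2) (hC : #C = 2)
    (hr : ∀ I ∈ r, #I = 2) :
    q p b (A :: B :: {k} :: C :: r) = q p b (C :: B :: {k} :: A :: r) := by
  have hm := (ok_singleton_cons.1 h).2.1
  have e := congrArg (der (c p k)) (q_empty_one_four (p := p) hp (ok_cons.1 h).2.2 hA hB hC hr)
  rw [der_four (by simp [ok_cons] at h ⊢; grind) hr, der_four (by simp [ok_cons] at h ⊢; grind) hr,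
    q_insert_one hA (hm A (by simp)), q_insert_one hC (hm C (by simp)),
    q_insert_two hp hB (hm B (by simp)), q_insert_two hp hB (hm B (by simp)),
    q_insert_four hA (hm A (by simp)), q_insert_four hC (hm C (by simp)), insert_empty_eq] at e
  simpa using e

lemma J_G5 (hp : p ≠ 2) {b i j k s l : ℕ} {r : List (Finset ℕ)}
    (h : Ok b ({i} :: {j} :: {k} :: {s} :: {l} :: r)) (hr : ∀ I ∈ r, #I = 2) :
    q p b ({i, k} :: {j, s} :: {l} :: r) + q p b ({i, j} :: {k, s} :: {l} :: r)
      + q p b ({i, s} :: {j, k} :: {l} :: r) = 0 := by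
  have e := congrArg (der (c p l)) (J_E9 (p := p) hp (b := b) (i := i) (j := j) (k := k) (s := s)
    (r := r) (by simp [ok_cons] at h ⊢; grind) hr)
  have n : i ≠ j ∧ i ≠ k ∧ i ≠ s ∧ j ≠ k ∧ j ≠ s ∧ k ≠ s ∧ l ≠ i ∧ l ≠ j ∧ l ≠ k ∧ l ≠ s := by
    simp [ok_cons] at h; grind
  obtain ⟨nij, nik, nis, njk, njs, nks, nli, nlj, nlk, nls⟩ := n
  rw [map_add, map_add, der_three (by simp [ok_cons] at h ⊢; grind) hr,
    der_three (by simp [ok_cons] at h ⊢; grind) hr,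
    der_three (by simp [ok_cons] at h ⊢; grind) hr,
    q_insert_one (Finset.card_pair nik) (by simp [nli, nlk]),
    q_insert_one (Finset.card_pair nij) (by simp [nli, nlj]),
    q_insert_one (Finset.card_pair nis) (by simp [nli, nls]),
    q_insert_two hp (Finset.card_pair njs) (by simp [nlj, nls]),
    q_insert_two hp (Finset.card_pair nks) (by simp [nlk, nls]),
    q_insert_two hp (Finset.card_pair njk) (by simp [nlj, nlk]), insert_empty_eq] at e
  simpa using e

/-- E2 bracketed with `c j`. One term has its singleton in the second slot and is moved by G2; D4
follows in the same way from D1 and D3. -/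
lemma J_G6 (hp : p ≠ 2) {b i j k : ℕ} {A : Finset ℕ} {r : List (Finset ℕ)}
    (h : Ok b (A :: {i} :: {j} :: {k} :: r)) (hA : #A = 2) (hr : ∀ I ∈ r, #I = 2) :
    q p b (A :: {i, k} :: {j} :: r) + q p b (A :: {k, j} :: {i} :: r)
      + q p b (A :: {i, j} :: {k} :: r) = 0 := by
  have n : i ≠ j ∧ i ≠ k ∧ j ≠ k ∧ j ∉ A := by simp [ok_cons] at h; grind
  obtain ⟨nij, nik, njk, njA⟩ := n
  have e := congrArg (der (c p j)) (J_E2 (p := p) (b := b) (A := A) (i := i) (k := k)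
    (r := r) (by simp [ok_cons] at h ⊢; grind) hA hr)
  rw [map_add, der_three (by simp [ok_cons] at h ⊢; grind) hr,
    der_three (by simp [ok_cons] at h ⊢; grind) hr, q_insert_one hA njA, q_insert_one hA njA,
    q_insert_two hp (Finset.card_pair nik.symm) (by simp [njk, nij.symm]), insert_empty_eq,
    J_G2 hp (by simp [ok_cons] at h ⊢; grind) hA (Finset.card_pair nij.symm) hr,
    Finset.pair_comm j k, Finset.pair_comm j i, Finset.pair_comm k i, map_zero] at e
  linear_combination (norm := module) e

lemma J_D3 (hp : p ≠ 2) {b k : ℕ} {A : Finset ℕ} (h : Ok b [{k}, A]) (hA : #A = 2) :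
    q p b [A, {k}] = q p b [{k}, A] := by
  have hm := (ok_singleton_cons.1 h).2.1
  have e := congrArg (der (c p k)) (J_D2 (p := p) (ok_cons.1 h).2.2 hA)
  rw [der_two (by simp [ok_cons] at h ⊢; grind) (by simp),
    der_two (by simp [ok_cons] at h ⊢; grind) (by simp),
    q_insert_one hA (hm A (by simp)), q_insert_two hp hA (hm A (by simp)), insert_empty_eq] at e
  simpa using e

lemma J_D4 (hp : p ≠ 2) {b i j k : ℕ} (h : Ok b [{i}, {j}, {k}]) :
    q p b [{i}, {j, k}] + q p b [{j}, {i, k}] + q p b [{k}, {i, j}] = 0 := by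
  have n : i ≠ j ∧ i ≠ k ∧ j ≠ k := by simp [ok_cons] at h; grind
  obtain ⟨nij, nik, njk⟩ := n
  have e := congrArg (der (c p k)) (J_D1 (p := p) (b := b) (i := i) (j := j)
    (by simp [ok_cons] at h ⊢; grind))
  rw [map_add, der_two (by simp [ok_cons] at h ⊢; grind) (by simp),
    der_two (by simp [ok_cons] at h ⊢; grind) (by simp),
    q_insert_two hp (Finset.card_pair nij) (by simp [nik.symm, njk.symm]), insert_empty_eq,
    J_D3 hp (by simp [ok_cons] at h ⊢; grind) (Finset.card_pair nik.symm),
    Finset.pair_comm k i, Finset.pair_comm k j, map_zero] at e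
  linear_combination (norm := module) e

/-- A pair is a singleton `{l}` into which `k` has been inserted, so G3 bracketed with `c k` gives
the claim. With two slots only, D3 takes the role of G3. -/
lemma J_H1 (hp : p ≠ 2) {b : ℕ} {A B : Finset ℕ} {r : List (Finset ℕ)}
    (h : Ok b (A :: B :: r)) (hA : #A = 2) (hB : #B = 2) (hr : ∀ I ∈ r, #I = 2) :
    q p b (A :: B :: r) = q p b (B :: A :: r) := by
  cases r with
  | nil =>
    obtain ⟨k, l, hkl, rfl⟩ := Finset.card_eq_two.1 hB
    have n : k ∉ A := by simp [ok_cons] at h; grind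
    have e := congrArg (der (c p k)) (J_D3 (p := p) hp (b := b) (k := l) (A := A)
      (by simp [ok_cons] at h ⊢; grind) hA)
    rw [der_two (by simp [ok_cons] at h ⊢; grind) (by simp),
      der_two (by simp [ok_cons] at h ⊢; grind) (by simp),
      q_insert_one hA n, q_insert_two hp hA n] at e
    simpa using e
  | cons C r =>
    simp only [List.mem_cons, forall_eq_or_imp] at hr
    obtain ⟨k, l, hkl, rfl⟩ := Finset.card_eq_two.1 hr.1
    have n : k ∉ A ∧ k ∉ B := by simp [ok_cons] at h; grind
    have e := congrArg (der (c p k)) (J_G3 (p := p) hp (b := b) (k := l) (A := A) (B := B) (r := r)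
      (by simp [ok_cons] at h ⊢; grind) hA hB hr.2)
    rw [der_three (by simp [ok_cons] at h ⊢; grind) hr.2,
      der_three (by simp [ok_cons] at h ⊢; grind) hr.2,
      q_insert_one hA n.1, q_insert_two hp hA n.1, q_insert_one hB n.2, q_insert_two hp hB n.2] at e
    simpa using e

lemma J_H2 (hp : p ≠ 2) {b : ℕ} {A B C : Finset ℕ} {r : List (Finset ℕ)}
    (h : Ok b (A :: B :: C :: r)) (hA : #A = 2) (hB : #B = 2) (hC : #C = 2)
    (hr : ∀ I ∈ r, #I = 2) :
    q p b (A :: B :: C :: r) = q p b (C :: B :: A :: r) := by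
  obtain ⟨k, l, hkl, rfl⟩ := Finset.card_eq_two.1 hA
  have n : k ∉ B ∧ k ∉ C := by simp [ok_cons] at h; grind
  have e := congrArg (der (c p k)) (J_G1 (p := p) hp (b := b) (i := l) (B := B) (C := C) (r := r)
    (by simp [ok_cons] at h ⊢; grind) hB hC hr)
  rw [der_three (by simp [ok_cons] at h ⊢; grind) hr,
    der_three (by simp [ok_cons] at h ⊢; grind) hr,
    q_insert_two hp hB n.1, q_insert_three hC n.2, q_insert_one hC n.2,
    q_insert_two hp hB n.1] at e
  simpa using e

lemma J_H3 (hp : p ≠ 2) {b i j k s : ℕ} {r : List (Finset ℕ)}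
    (h : Ok b ({i} :: {j} :: {k} :: {s} :: r)) (hr : ∀ I ∈ r, #I = 2) :
    q p b ({i, k} :: {j, s} :: r) + q p b ({i, j} :: {k, s} :: r)
      + q p b ({i, s} :: {k, j} :: r) = 0 := by
  have n : i ≠ j ∧ i ≠ k ∧ i ≠ s ∧ j ≠ k ∧ j ≠ s ∧ k ≠ s := by
    simp [ok_cons] at h; grind
  obtain ⟨nij, nik, nis, njk, njs, nks⟩ := n
  cases r with
  | nil =>
    have e := congrArg (der (c p i)) (J_D4 (p := p) hp (b := b) (i := k) (j := j) (k := s)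
      (by simp [ok_cons] at h ⊢; grind))
    rw [map_add, map_add, der_two (by simp [ok_cons] at h ⊢; grind) (by simp),
      der_two (by simp [ok_cons] at h ⊢; grind) (by simp),
      der_two (by simp [ok_cons] at h ⊢; grind) (by simp),
      q_insert_two hp (Finset.card_pair njs) (by simp [nij, nis]),
      q_insert_two hp (Finset.card_pair nks) (by simp [nik, nis]),
      q_insert_two hp (Finset.card_pair njk.symm) (by simp [nij, nik])] at e
    simpa using e
  | cons C r =>
    simp only [List.mem_cons, forall_eq_or_imp] at hr
    obtain ⟨l, l', hl, rfl⟩ := Finset.card_eq_two.1 hr.1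
    have n : l' ≠ i ∧ l' ≠ j ∧ l' ≠ k ∧ l' ≠ s := by
      simp [ok_cons] at h; grind
    obtain ⟨nli, nlj, nlk, nls⟩ := n
    have e := congrArg (der (c p l')) (J_G5 (p := p) hp (b := b) (i := i) (j := j) (k := k) (s := s)
      (l := l) (r := r) (by simp [ok_cons] at h ⊢; grind) hr.2)
    rw [map_add, map_add, der_three (by simp [ok_cons] at h ⊢; grind) hr.2,
      der_three (by simp [ok_cons] at h ⊢; grind) hr.2,
      der_three (by simp [ok_cons] at h ⊢; grind) hr.2,
      q_insert_one (Finset.card_pair nik) (by simp [nli, nlk]),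
      q_insert_one (Finset.card_pair nij) (by simp [nli, nlj]),
      q_insert_one (Finset.card_pair nis) (by simp [nli, nls]),
      q_insert_two hp (Finset.card_pair njs) (by simp [nlj, nls]),
      q_insert_two hp (Finset.card_pair nks) (by simp [nlk, nls]),
      q_insert_two hp (Finset.card_pair njk) (by simp [nlj, nlk]), Finset.pair_comm l' l,
      Finset.pair_comm j k] at e
    simpa using e

end

/-! ### The relators written in terms of `P` -/

lemma comm_E1 {a i j : ℕ} {A B : Finset ℕ} {r : List (Finset ℕ)}
    (h : Ok a (A :: B :: {i} :: {j} :: r)) :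
    comm p (A :: insert a B :: {i} :: {j} :: r) + comm p (A :: insert a B :: ∅ :: {i, j} :: r) =
      P p a (A :: B :: {i} :: {j} :: r) + P p a (A :: B :: ∅ :: {i, j} :: r) := by
  rw [P_of_ok h,
    P_of_ok (by simp [ok_cons] at h ⊢; grind)]

lemma comm_E2 {a i k : ℕ} {A : Finset ℕ} {r : List (Finset ℕ)}
    (h : Ok a (A :: {k} :: {i} :: r)) :
    comm p (A :: {a, k} :: {i} :: r) + comm p (A :: {a, k, i} :: ∅ :: r) =
      P p a (A :: {k} :: {i} :: r) + P p a (A :: {k, i} :: ∅ :: r) := by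
  rw [P_of_ok h,
    P_of_ok (by simp [ok_cons] at h ⊢; grind)]

lemma comm_E3 {a i j : ℕ} {B : Finset ℕ} {r : List (Finset ℕ)}
    (h : Ok a ({i} :: B :: {j} :: r)) :
    comm p ({i} :: insert a B :: {j} :: r) + comm p ({i, j} :: insert a B :: ∅ :: r) =
      P p a ({i} :: B :: {j} :: r) + P p a ({i, j} :: B :: ∅ :: r) := by
  rw [P_of_ok h,
    P_of_ok (by simp [ok_cons] at h ⊢; grind)]

lemma comm_E4 {a : ℕ} {B C : Finset ℕ} {r : List (Finset ℕ)}
    (h : Ok a (B :: C :: r)) :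
    comm p (∅ :: insert a B :: C :: r) - comm p (C :: insert a B :: ∅ :: r) =
      P p a (∅ :: B :: C :: r) - P p a (C :: B :: ∅ :: r) := by
  rw [P_of_ok (by simp [ok_cons] at h ⊢; grind),
    P_of_ok (by simp [ok_cons] at h ⊢; grind)]

lemma comm_E5 {a i j : ℕ} {A : Finset ℕ} {r : List (Finset ℕ)}
    (h : Ok a (A :: {i} :: {j} :: r)) :
    comm p (A :: {a} :: {i, j} :: r) - comm p (A :: {a, i, j} :: ∅ :: r) =
      P p a (A :: ∅ :: {i, j} :: r) - P p a (A :: {i, j} :: ∅ :: r) := by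
  rw [P_of_ok (by simp [ok_cons] at h ⊢; grind),
    P_of_ok (by simp [ok_cons] at h ⊢; grind),
    insert_empty_eq]

lemma comm_E6 {a i j k s : ℕ} {r : List (Finset ℕ)}
    (h : Ok a ({i} :: {s} :: {j} :: {k} :: r)) :
    comm p ({i} :: {a, s} :: {j, k} :: r) - comm p ({i, j} :: {a, s, k} :: ∅ :: r) -
      comm p ({i, k} :: {a, s, j} :: ∅ :: r) =
      P p a ({i} :: {s} :: {j, k} :: r) - P p a ({i, j} :: {s, k} :: ∅ :: r) -
      P p a ({i, k} :: {s, j} :: ∅ :: r) := by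
  rw [P_of_ok (by simp [ok_cons] at h ⊢; grind),
    P_of_ok (by simp [ok_cons] at h ⊢; grind),
    P_of_ok (by simp [ok_cons] at h ⊢; grind)]

lemma comm_E7 {a : ℕ} {A B C : Finset ℕ} {r : List (Finset ℕ)}
    (h : Ok a (A :: B :: C :: r)) :
    comm p (A :: insert a B :: ∅ :: C :: r) - comm p (C :: insert a B :: ∅ :: A :: r) =
      P p a (A :: B :: ∅ :: C :: r) - P p a (C :: B :: ∅ :: A :: r) := by
  rw [P_of_ok (by simp [ok_cons] at h ⊢; grind),
    P_of_ok (by simp [ok_cons] at h ⊢; grind)]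

lemma comm_E8 {a : ℕ} {A B : Finset ℕ} {r : List (Finset ℕ)}
    (h : Ok a (A :: B :: r)) :
    comm p (A :: insert a B :: ∅ :: r) - comm p (B :: insert a A :: ∅ :: r) =
      P p a (A :: B :: ∅ :: r) - P p a (B :: A :: ∅ :: r) := by
  rw [P_of_ok (by simp [ok_cons] at h ⊢; grind),
    P_of_ok (by simp [ok_cons] at h ⊢; grind)]

lemma comm_E9 {a i j k s : ℕ} {r : List (Finset ℕ)}
    (h : Ok a ({i} :: {j} :: {k} :: {s} :: r)) :
    comm p ({i, k} :: {a, j, s} :: ∅ :: r) + comm p ({i, j} :: {a, k, s} :: ∅ :: r) +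
      comm p ({i, s} :: {a, j, k} :: ∅ :: r) =
      P p a ({i, k} :: {j, s} :: ∅ :: r) + P p a ({i, j} :: {k, s} :: ∅ :: r) +
      P p a ({i, s} :: {j, k} :: ∅ :: r) := by
  rw [P_of_ok (by simp [ok_cons] at h ⊢; grind),
    P_of_ok (by simp [ok_cons] at h ⊢; grind),
    P_of_ok (by simp [ok_cons] at h ⊢; grind)]

lemma comm_G1 {a i j k : ℕ} {B : Finset ℕ} {r : List (Finset ℕ)}
    (h : Ok a ({i} :: B :: {j} :: {k} :: r)) :
    comm p ({i} :: insert a B :: {j, k} :: r) - comm p ({j, k} :: insert a B :: {i} :: r) =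
      P p a ({i} :: B :: {j, k} :: r) - P p a ({j, k} :: B :: {i} :: r) := by
  rw [P_of_ok (by simp [ok_cons] at h ⊢; grind),
    P_of_ok (by simp [ok_cons] at h ⊢; grind)]

lemma comm_G2 {a i j k : ℕ} {A : Finset ℕ} {r : List (Finset ℕ)}
    (h : Ok a (A :: {k} :: {i} :: {j} :: r)) :
    comm p (A :: {a, k} :: {i, j} :: r) - comm p (A :: {a, i, j} :: {k} :: r) =
      P p a (A :: {k} :: {i, j} :: r) - P p a (A :: {i, j} :: {k} :: r) := by
  rw [P_of_ok (by simp [ok_cons] at h ⊢; grind),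
    P_of_ok (by simp [ok_cons] at h ⊢; grind)]

lemma comm_G3 {a k : ℕ} {A B : Finset ℕ} {r : List (Finset ℕ)}
    (h : Ok a (A :: B :: {k} :: r)) :
    comm p (A :: insert a B :: {k} :: r) - comm p (B :: insert a A :: {k} :: r) =
      P p a (A :: B :: {k} :: r) - P p a (B :: A :: {k} :: r) := by
  rw [P_of_ok h,
    P_of_ok (by simp [ok_cons] at h ⊢; grind)]

lemma comm_G4 {a k : ℕ} {A B C : Finset ℕ} {r : List (Finset ℕ)}
    (h : Ok a (A :: B :: {k} :: C :: r)) :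
    comm p (A :: insert a B :: {k} :: C :: r) - comm p (C :: insert a B :: {k} :: A :: r) =
      P p a (A :: B :: {k} :: C :: r) - P p a (C :: B :: {k} :: A :: r) := by
  rw [P_of_ok h,
    P_of_ok (by simp [ok_cons] at h ⊢; grind)]

lemma comm_G5 {a i j k s l : ℕ} {r : List (Finset ℕ)}
    (h : Ok a ({i} :: {j} :: {k} :: {s} :: {l} :: r)) :
    comm p ({i, k} :: {a, j, s} :: {l} :: r) + comm p ({i, j} :: {a, k, s} :: {l} :: r) +
      comm p ({i, s} :: {a, j, k} :: {l} :: r) =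
      P p a ({i, k} :: {j, s} :: {l} :: r) + P p a ({i, j} :: {k, s} :: {l} :: r) +
      P p a ({i, s} :: {j, k} :: {l} :: r) := by
  rw [P_of_ok (by simp [ok_cons] at h ⊢; grind),
    P_of_ok (by simp [ok_cons] at h ⊢; grind),
    P_of_ok (by simp [ok_cons] at h ⊢; grind)]

lemma comm_G6 {a i j k : ℕ} {A : Finset ℕ} {r : List (Finset ℕ)}
    (h : Ok a (A :: {i} :: {j} :: {k} :: r)) :
    comm p (A :: {a, i, k} :: {j} :: r) + comm p (A :: {a, k, j} :: {i} :: r) +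
      comm p (A :: {a, i, j} :: {k} :: r) =
      P p a (A :: {i, k} :: {j} :: r) + P p a (A :: {k, j} :: {i} :: r) +
      P p a (A :: {i, j} :: {k} :: r) := by
  rw [P_of_ok (by simp [ok_cons] at h ⊢; grind),
    P_of_ok (by simp [ok_cons] at h ⊢; grind),
    P_of_ok (by simp [ok_cons] at h ⊢; grind)]

lemma comm_H1 {a : ℕ} {A B : Finset ℕ} {r : List (Finset ℕ)}
    (h : Ok a (A :: B :: r)) :
    comm p (A :: insert a B :: r) - comm p (B :: insert a A :: r) =
      P p a (A :: B :: r) - P p a (B :: A :: r) := by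
  rw [P_of_ok h,
    P_of_ok (by simp [ok_cons] at h ⊢; grind)]

lemma comm_H2 {a : ℕ} {A B C : Finset ℕ} {r : List (Finset ℕ)}
    (h : Ok a (A :: B :: C :: r)) :
    comm p (A :: insert a B :: C :: r) - comm p (C :: insert a B :: A :: r) =
      P p a (A :: B :: C :: r) - P p a (C :: B :: A :: r) := by
  rw [P_of_ok h,
    P_of_ok (by simp [ok_cons] at h ⊢; grind)]

lemma comm_H3 {a i j k s : ℕ} {r : List (Finset ℕ)}
    (h : Ok a ({i} :: {j} :: {k} :: {s} :: r)) :
    comm p ({i, k} :: {a, j, s} :: r) + comm p ({i, j} :: {a, k, s} :: r) +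
      comm p ({i, s} :: {a, k, j} :: r) =
      P p a ({i, k} :: {j, s} :: r) + P p a ({i, j} :: {k, s} :: r) +
      P p a ({i, s} :: {k, j} :: r) := by
  rw [P_of_ok (by simp [ok_cons] at h ⊢; grind),
    P_of_ok (by simp [ok_cons] at h ⊢; grind),
    P_of_ok (by simp [ok_cons] at h ⊢; grind)]

lemma comm_D1 {a i j : ℕ}
    (h : Ok a [{i}, {j}]) :
    comm p [{i}, {a, j}] + comm p [∅, {a, i, j}] =
      P p a [{i}, {j}] + P p a [∅, {i, j}] := by
  rw [P_of_ok h,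
    P_of_ok (by simp [ok_cons] at h ⊢; grind)]

lemma comm_D2 {a i j : ℕ}
    (h : Ok a [{i}, {j}]) :
    comm p [{i, j}, {a}] - comm p [∅, {a, i, j}] =
      P p a [{i, j}, ∅] - P p a [∅, {i, j}] := by
  rw [P_of_ok (by simp [ok_cons] at h ⊢; grind),
    P_of_ok (by simp [ok_cons] at h ⊢; grind),
    insert_empty_eq]

lemma comm_D3 {a i j k : ℕ}
    (h : Ok a [{i}, {j}, {k}]) :
    comm p [{i, j}, {a, k}] - comm p [{k}, {a, i, j}] =
      P p a [{i, j}, {k}] - P p a [{k}, {i, j}] := by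
  rw [P_of_ok (by simp [ok_cons] at h ⊢; grind),
    P_of_ok (by simp [ok_cons] at h ⊢; grind)]

lemma comm_D4 {a i j k : ℕ}
    (h : Ok a [{i}, {j}, {k}]) :
    comm p [{i}, {a, j, k}] + comm p [{j}, {a, i, k}] + comm p [{k}, {a, i, j}] =
      P p a [{i}, {j, k}] + P p a [{j}, {i, k}] + P p a [{k}, {i, j}] := by
  rw [P_of_ok (by simp [ok_cons] at h ⊢; grind),
    P_of_ok (by simp [ok_cons] at h ⊢; grind),
    P_of_ok (by simp [ok_cons] at h ⊢; grind)]

lemma Cfg.ok {a : ℕ} {l r : List (Finset ℕ)} (h : Cfg a l r) : Ok a (l ++ r) := ⟨h.1, h.2.1⟩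

lemma Cfg.pairs {a : ℕ} {l r : List (Finset ℕ)} (h : Cfg a l r) : ∀ I ∈ r, #I = 2 := h.2.2

/-! ### `V ⊔ VTwo` is contained in `J` -/

section

variable [Fact p.Prime]

lemma mem_J_of_mkQ {u : F p} (h : (J p).toSubmodule.mkQ u = 0) : u ∈ (J p).toSubmodule :=
  (Submodule.Quotient.mk_eq_zero _).1 h

lemma relE_mem_J (hp : p ≠ 2) {u : F p} (h : RelE p u) : u ∈ (J p).toSubmodule := by
  cases h with
  | E1 a i j A B r h hA hB =>
    rw [comm_E1 (r := r) h.ok]; exact mem_J_of_mkQ (J_E1 hp h.ok hA hB h.pairs)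
  | E2 a i k A r h hA =>
    rw [comm_E2 (r := r) h.ok]; exact mem_J_of_mkQ (J_E2 h.ok hA h.pairs)
  | E3 a i j B r h hB =>
    have hO := h.ok
    rw [comm_E3 (r := r) h.ok]
    have := q_merge_one_three hp (b := a) (i := i) (j := j) (B := B) (r := r)
      (by simp [ok_cons] at hO ⊢; grind) hB h.pairs
    rw [Finset.pair_comm] at this
    exact mem_J_of_mkQ (eq_neg_iff_add_eq_zero.1 this)
  | E4 a B C r h hB hC =>
    rw [comm_E4 (r := r) h.ok]
    exact mem_J_of_mkQ (sub_eq_zero.2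
      (q_empty_one_three hp ((Ok.perm (List.Perm.swap _ _ _)).1 h.ok) hB hC h.pairs))
  | E5 a i j A r h hA =>
    rw [comm_E5 (r := r) h.ok]
    exact mem_J_of_mkQ (sub_eq_zero.2 (J_E5 h.ok hA h.pairs))
  | E6 a i j k s r h =>
    have hO := h.ok
    rw [comm_E6 (r := r) h.ok]
    exact mem_J_of_mkQ (J_E6 hp h.ok h.pairs)
  | E7 a A B C r h hA hB hC =>
    rw [comm_E7 (r := r) h.ok]
    exact mem_J_of_mkQ (sub_eq_zero.2 (q_empty_one_four hp h.ok hA hB hC h.pairs))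
  | E8 a A B r h hA hB =>
    rw [comm_E8 (r := r) h.ok]
    exact mem_J_of_mkQ (sub_eq_zero.2 (J_E8 hp h.ok hA hB h.pairs))
  | E9 a i j k s r h =>
    rw [comm_E9 (r := r) h.ok]
    exact mem_J_of_mkQ (J_E9 hp h.ok h.pairs)

lemma relG_mem_J (hp : p ≠ 2) {u : F p} (h : RelG p u) : u ∈ (J p).toSubmodule := by
  cases h with
  | G1 a i j k B r h hB =>
    have hO := h.ok
    have hjk : j ≠ k := by simp [ok_cons] at hO; grind
    rw [comm_G1 (r := r) h.ok]
    exact mem_J_of_mkQ (sub_eq_zero.2 (J_G1 hp (by simp [ok_cons] at hO ⊢; grind) hB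
      (Finset.card_pair hjk) h.pairs))
  | G2 a i j k A r h hA =>
    have hO := h.ok
    have hij : i ≠ j := by simp [ok_cons] at hO; grind
    rw [comm_G2 (r := r) h.ok]
    exact mem_J_of_mkQ (sub_eq_zero.2 (J_G2 hp (by simp [ok_cons] at hO ⊢; grind) hA
      (Finset.card_pair hij) h.pairs))
  | G3 a k A B r h hA hB =>
    have hO := h.ok
    rw [comm_G3 (r := r) h.ok]
    exact mem_J_of_mkQ (sub_eq_zero.2 (J_G3 hp (by simp [ok_cons] at hO ⊢; grind) hA hB h.pairs))
  | G4 a k A B C r h hA hB hC =>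
    have hO := h.ok
    rw [comm_G4 (r := r) h.ok]
    exact mem_J_of_mkQ (sub_eq_zero.2
      (J_G4 hp (by simp [ok_cons] at hO ⊢; grind) hA hB hC h.pairs))
  | G5 a i j k s l r h =>
    rw [comm_G5 (r := r) h.ok]
    exact mem_J_of_mkQ (J_G5 hp h.ok h.pairs)
  | G6 a i j k A r h hA =>
    rw [comm_G6 (r := r) h.ok]
    exact mem_J_of_mkQ (J_G6 hp h.ok hA h.pairs)

lemma relH_mem_J (hp : p ≠ 2) {u : F p} (h : RelH p u) : u ∈ (J p).toSubmodule := by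
  cases h with
  | H1 a A B r h hA hB =>
    rw [comm_H1 (r := r) h.ok]
    exact mem_J_of_mkQ (sub_eq_zero.2 (J_H1 hp h.ok hA hB h.pairs))
  | H2 a A B C r h hA hB hC =>
    rw [comm_H2 (r := r) h.ok]
    exact mem_J_of_mkQ (sub_eq_zero.2 (J_H2 hp h.ok hA hB hC h.pairs))
  | H3 a i j k s r h =>
    rw [comm_H3 (r := r) h.ok]
    exact mem_J_of_mkQ (J_H3 hp h.ok h.pairs)

lemma relTwo_mem_J (hp : p ≠ 2) {u : F p} (h : RelTwo p u) : u ∈ (J p).toSubmodule := by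
  cases h with
  | D1 a i j h =>
    rw [comm_D1 h.ok]
    exact mem_J_of_mkQ (J_D1 h.ok)
  | D2 a i j h =>
    have hO := h.ok
    have hij : i ≠ j := by simp [ok_cons] at hO; grind
    rw [comm_D2 h.ok]
    exact mem_J_of_mkQ (sub_eq_zero.2 (J_D2 (by simp [ok_cons] at hO ⊢; grind)
      (Finset.card_pair hij)))
  | D3 a i j k h =>
    have hO := h.ok
    have hij : i ≠ j := by simp [ok_cons] at hO; grind
    rw [comm_D3 h.ok]
    exact mem_J_of_mkQ (sub_eq_zero.2 (J_D3 hp (by simp [ok_cons] at hO ⊢; grind)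
      (Finset.card_pair hij)))
  | D4 a i j k h =>
    rw [comm_D4 h.ok]
    exact mem_J_of_mkQ (J_D4 hp h.ok)

lemma Sizes.dfc_eq {t : List (Finset ℕ)} {s : List ℕ} (h : Sizes t s) :
    dfc t = 2 * (s.length : ℤ) - (s.sum : ℤ) := by
  obtain ⟨k, hk⟩ := h
  have h1 := hk.length_eq
  have h2 := hk.sum_eq
  simp at h1 h2
  simp [dfc, h1, h2]
  ring

lemma Sizes.card_mem {t : List (Finset ℕ)} {s : List ℕ} (h : Sizes t s) :
    ∀ I ∈ t, #I ∈ s ∨ #I = 2 := by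
  obtain ⟨k, hk⟩ := h
  intro I hI
  have := hk.mem_iff.1 (List.mem_map_of_mem (f := Finset.card) hI)
  simp only [List.mem_append, List.mem_replicate] at this
  tauto

lemma Sizes.of_perm {t l r : List (Finset ℕ)} (e : t.Perm (l ++ r)) (hr : ∀ I ∈ r, #I = 2) :
    Sizes t (l.map Finset.card) := by
  refine ⟨r.length, (e.map _).trans ?_⟩
  rw [List.map_append, List.eq_replicate_of_mem (l := r.map Finset.card) (a := 2)
      (by simpa using hr),
    List.length_map]

lemma Sizes.card_le {t : List (Finset ℕ)} {s : List ℕ} (h : Sizes t s) (hs : ∀ n ∈ s, n ≤ 2) :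
    ∀ I ∈ t, #I ≤ 2 := fun I hI => (h.card_mem I hI).elim (hs _) fun e => e.le

lemma sizes_nil_iff {t : List (Finset ℕ)} : Sizes t [] ↔ (∀ I ∈ t, #I ≤ 2) ∧ dfc t = 0 :=
  ⟨fun h => ⟨h.card_le (by simp), by simpa using h.dfc_eq⟩,
    fun h => Sizes.of_perm (l := []) (List.Perm.refl t) (card_eq_two_of_dfc h.1 h.2)⟩

lemma sizes_one_iff {t : List (Finset ℕ)} : Sizes t [1] ↔ (∀ I ∈ t, #I ≤ 2) ∧ dfc t = 1 := by
  refine ⟨fun h => ⟨h.card_le (by simp), by simpa using h.dfc_eq⟩, fun ⟨h1, h2⟩ => ?_⟩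
  obtain ⟨i, r, e, hr⟩ := exists_perm_of_dfc_one h1 h2
  exact Sizes.of_perm (l := [{i}]) e hr

lemma sizes_zero_or_iff {t : List (Finset ℕ)} :
    Sizes t [0] ∨ Sizes t [1, 1] ↔ (∀ I ∈ t, #I ≤ 2) ∧ dfc t = 2 := by
  constructor
  · rintro (h | h) <;> exact ⟨h.card_le (by simp), by simpa using h.dfc_eq⟩
  · rintro ⟨h1, h2⟩
    obtain ⟨r, e, hr⟩ | ⟨i, j, r, e, hr⟩ := exists_perm_of_dfc_two h1 h2
    · exact .inl (Sizes.of_perm (l := [∅]) e hr)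
    · exact .inr (Sizes.of_perm (l := [{i}, {j}]) e hr)

/-- The size conditions on a member of `Z` of degree at least two in `z` amount to bounds on the
sizes of the sets and on the type. -/
lemma isZ_iff {a : ℕ} {X Y : Finset ℕ} {t : List (Finset ℕ)} (ha : a ∉ Y) :
    IsZ (X :: insert a Y :: t) ↔ (#X ≤ 2 ∧ #Y ≤ 2 ∧ ∀ I ∈ t, #I ≤ 2) ∧
      0 ≤ dfc (X :: Y :: t) ∧ dfc (X :: Y :: t) ≤ 2 := by
  have h0 := sizes_nil_iff (t := t)
  have h1 := sizes_one_iff (t := t)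
  have h2 := sizes_zero_or_iff (t := t)
  have hn : (∀ I ∈ t, #I ≤ 2) → 0 ≤ dfc t := dfc_nonneg
  simp only [IsZ, Finset.card_insert_of_notMem ha, dfc_cons]
  constructor
  · rintro (h | h | h | h | h | h | h)
    · have := h0.1 h.2.2; exact ⟨⟨by omega, by omega, this.1⟩, by omega, by omega⟩
    · have := h1.1 h.2.2.2; exact ⟨⟨by omega, by omega, this.1⟩, by omega, by omega⟩
    · have := h2.1 (.inl h.2.2); exact ⟨⟨by omega, by omega, this.1⟩, by omega, by omega⟩
    · have := h2.1 (.inr h.2.2); exact ⟨⟨by omega, by omega, this.1⟩, by omega, by omega⟩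
    · have := h1.1 h.2.2; exact ⟨⟨by omega, by omega, this.1⟩, by omega, by omega⟩
    · have := h0.1 h.2.2.2; exact ⟨⟨by omega, by omega, this.1⟩, by omega, by omega⟩
    · have := h0.1 h.2.2; exact ⟨⟨by omega, by omega, this.1⟩, by omega, by omega⟩
  · rintro ⟨⟨hX, hY, ht⟩, hd⟩
    have hn := hn ht
    obtain h | h | h : dfc t = 0 ∨ dfc t = 1 ∨ dfc t = 2 := by omega
    · have := h0.2 ⟨ht, h⟩
      obtain h | h | h : #X + #Y = 2 ∨ #X + #Y = 3 ∨ #X + #Y = 4 := by omega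
      · exact .inl ⟨by omega, hX, this⟩
      · exact .inr (.inr (.inr (.inr (.inr (.inl ⟨by omega, hX, by omega, this⟩)))))
      · exact .inr (.inr (.inr (.inr (.inr (.inr ⟨by omega, by omega, this⟩)))))
    · have := h1.2 ⟨ht, h⟩
      obtain h | h : #X + #Y = 3 ∨ #X + #Y = 4 := by omega
      · exact .inr (.inl ⟨by omega, hX, by omega, this⟩)
      · exact .inr (.inr (.inr (.inr (.inl ⟨by omega, by omega, this⟩))))
    · rcases h2.2 ⟨ht, h⟩ with this | this
      · exact .inr (.inr (.inl ⟨by omega, by omega, this⟩))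
      · exact .inr (.inr (.inr (.inl ⟨by omega, by omega, this⟩)))

/-- By `isZ_iff`, a basis element of degree at least two outside `Z` has a deficit outside 0, 1, 2
or a set that is too large. A large second set is the only case that is not a generator of `J`. -/
lemma xdiffZ_mem_J (hp : p ≠ 2) {u : F p} (h : u ∈ XdiffZ p) : u ∈ (J p).toSubmodule := by
  obtain ⟨l, hB, hZ, rfl⟩ := h
  match l, hB with
  | [I], _ => exact zc_mem_J (by simpa [IsZ] using hZ)
  | X :: Y :: t, hB =>
    obtain ⟨a, Y', ha, rfl, hO, e⟩ := exists_eq_P_of_isBasisIndex (p := p) hB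
    rw [isZ_iff ha] at hZ
    rw [e]
    refine mem_J_of_mkQ ?_
    change q p a (X :: Y' :: t) = 0
    by_cases hY : 2 < #Y'
    · exact q_large_second hp hY
    by_cases hX : 2 < #X ∨ ∃ I ∈ t, 2 < #I
    · exact q_large hX
    push Not at hX hY
    refine q_dfc ?_
    by_contra! hd
    exact hZ ⟨⟨hX.1, hY, hX.2⟩, hd⟩

lemma V_sup_VTwo_le_J (hp : p ≠ 2) : V p ⊔ VTwo p ≤ (J p).toSubmodule := by
  refine sup_le (Submodule.span_le.2 ?_) (Submodule.span_le.2 fun u h => relTwo_mem_J hp h)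
  rintro u (((h | h) | h) | h)
  · exact xdiffZ_mem_J hp h
  · exact relE_mem_J hp h
  · exact relG_mem_J hp h
  · exact relH_mem_J hp h

end

/-! ### The symmetric relators span an ideal containing `J` -/

lemma eq_of_perm_of_swaps {M : Type*} {g : List (Finset ℕ) → M} {Q : List (Finset ℕ) → Prop}
    (hQ : ∀ L L', L.Perm L' → Q L → Q L')
    (h₀ : ∀ X Y t t', t.Perm t' → g (X :: Y :: t) = g (X :: Y :: t'))
    (h₁ : ∀ X Y t, Q (X :: Y :: t) → g (X :: Y :: t) = g (Y :: X :: t))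
    (h₂ : ∀ X Y Z t, Q (X :: Y :: Z :: t) → g (X :: Y :: Z :: t) = g (Z :: Y :: X :: t))
    {L L' : List (Finset ℕ)} (e : L.Perm L') (hL : Q L) : g L = g L' := by
  -- The prefix `l` records where a neighbouring transposition acts: on slots one and two, on slots
  -- two and three (a conjugate of `h₂` by `h₁`), or inside the tail.
  suffices H : ∀ l, Q (l ++ L) → g (l ++ L) = g (l ++ L') from H [] hL
  clear hL
  induction e with
  | nil => exact fun _ _ => rfl
  | cons X _ ih => exact fun l hl => by simpa using ih (l ++ [X]) (by simpa using hl)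
  | swap X Y t =>
    intro l hl
    match l, hl with
    | [], hl => exact h₁ Y X t hl
    | [A], hl =>
      change Q (A :: Y :: X :: t) at hl
      change g (A :: Y :: X :: t) = g (A :: X :: Y :: t)
      rw [h₁ A Y _ hl, h₂ Y A X _ (hQ _ _ (.swap _ _ _) hl),
        h₁ X A _ (hQ _ _ (((List.Perm.swap _ _ _).cons _).trans (.swap _ _ _)) hl)]
    | A :: B :: l, _ => exact h₀ A B _ _ ((List.Perm.swap X Y t).append_left l)
  | trans e _ ih1 ih2 =>
    exact fun l hl => (ih1 l hl).trans (ih2 l (hQ _ _ (e.append_left l) hl))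

lemma sumIns_perm {M : Type*} [AddCommMonoid M] (i : ℕ) {f : List (Finset ℕ) → M}
    (hf : ∀ s s', s.Perm s' → f s = f s') {L L' : List (Finset ℕ)} (e : L.Perm L') :
    sumIns i L f = sumIns i L' f := by
  induction e generalizing f with
  | nil => rfl
  | cons X e ih =>
    rw [sumIns_cons, sumIns_cons, hf _ _ (e.cons _), ih fun s s' h => hf _ _ (h.cons X)]
  | swap X Y t =>
    simp only [sumIns_cons]
    rw [hf (insert i Y :: X :: t) _ (List.Perm.swap _ _ _),
      hf (Y :: insert i X :: t) _ (List.Perm.swap _ _ _), ← add_assoc, ← add_assoc,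
      add_comm (f (X :: insert i Y :: t))]
    congr 1
    exact sumIns_congr fun l₁ I l₂ _ => hf _ _ (List.Perm.swap _ _ _)
  | trans _ _ ih1 ih2 => exact (ih1 hf).trans (ih2 hf)

lemma sumIns_add {M : Type*} [AddCommMonoid M] (i : ℕ) (t : List (Finset ℕ))
    (f g : List (Finset ℕ) → M) :
    sumIns i t (fun s => f s + g s) = sumIns i t f + sumIns i t g := by
  induction t generalizing f g with
  | nil => simp
  | cons X t ih => simp only [sumIns_cons, ih]; abel

/-- A symmetric system of relators, which will be seen to span `J`. -/
inductive SymRel (p : ℕ) : F p → Prop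
  | zc (I : Finset ℕ) (h : 3 < #I) : SymRel p (zc p I)
  | dfc (b : ℕ) (L : List (Finset ℕ)) (hL : 2 ≤ L.length) (h : dfc L < 0 ∨ 2 < dfc L) :
      SymRel p (P p b L)
  | large (b : ℕ) (L : List (Finset ℕ)) (h : ∃ I ∈ L, 2 < #I) : SymRel p (P p b L)
  | swap_two (b : ℕ) (X Y : Finset ℕ) (t : List (Finset ℕ)) :
      SymRel p (P p b (X :: Y :: t) - P p b (Y :: X :: t))
  | swap_three (b : ℕ) (X Y Z : Finset ℕ) (t : List (Finset ℕ)) :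
      SymRel p (P p b (X :: Y :: Z :: t) - P p b (Z :: Y :: X :: t))
  | merge (b i j : ℕ) (t : List (Finset ℕ)) (hij : i ≠ j) :
      SymRel p (P p b ({i} :: {j} :: t) + P p b (∅ :: {i, j} :: t))
  | three (b i j k : ℕ) (t : List (Finset ℕ)) (hij : i ≠ j) (hik : i ≠ k) (hjk : j ≠ k) :
      SymRel p (P p b ({i} :: {j, k} :: t) + P p b ({j} :: {i, k} :: t)
        + P p b ({k} :: {i, j} :: t))
  | four (b i j k s : ℕ) (t : List (Finset ℕ)) (hij : i ≠ j) (hik : i ≠ k) (his : i ≠ s)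
      (hjk : j ≠ k) (hjs : j ≠ s) (hks : k ≠ s) :
      SymRel p (P p b ({i, j} :: {k, s} :: t) + P p b ({i, k} :: {j, s} :: t)
        + P p b ({i, s} :: {j, k} :: t))

/-- The subspace spanned by the symmetric system of relators. -/
def SymSpan (p : ℕ) : Submodule (ZMod p) (F p) := Submodule.span (ZMod p) {u | SymRel p u}

/-- The class of `P b L` modulo `SymSpan`. -/
def sq (p : ℕ) (b : ℕ) (L : List (Finset ℕ)) : F p ⧸ SymSpan p := (SymSpan p).mkQ (P p b L)

lemma mkQ_symRel {u : F p} (h : SymRel p u) : (SymSpan p).mkQ u = 0 :=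
  (Submodule.Quotient.mk_eq_zero _).2 (Submodule.subset_span h)

lemma sq_perm (b : ℕ) {L L' : List (Finset ℕ)} (e : L.Perm L') : sq p b L = sq p b L' :=
  eq_of_perm_of_swaps (Q := fun _ => True) (fun _ _ _ _ => trivial)
    (fun X Y _ _ h => congrArg (SymSpan p).mkQ (P_perm b X Y h))
    (fun X Y t _ => sub_eq_zero.1 <|
      (map_sub (SymSpan p).mkQ _ _).symm.trans (mkQ_symRel (.swap_two b X Y t)))
    (fun X Y Z t _ => sub_eq_zero.1 <|
      (map_sub (SymSpan p).mkQ _ _).symm.trans (mkQ_symRel (.swap_three b X Y Z t)))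
    e trivial

lemma sq_large {b : ℕ} {L : List (Finset ℕ)} (h : ∃ I ∈ L, 2 < #I) : sq p b L = 0 :=
  mkQ_symRel (.large b L h)

lemma sq_dfc {b : ℕ} {L : List (Finset ℕ)} (hL : 2 ≤ L.length) (h : dfc L < 0 ∨ 2 < dfc L) :
    sq p b L = 0 :=
  mkQ_symRel (.dfc b L hL h)

lemma sq_merge (b : ℕ) {i j : ℕ} (t : List (Finset ℕ)) (hij : i ≠ j) :
    sq p b ({i} :: {j} :: t) + sq p b (∅ :: {i, j} :: t) = 0 :=
  mkQ_symRel (.merge b i j t hij)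

lemma sq_three (b : ℕ) {i j k : ℕ} (t : List (Finset ℕ)) (hij : i ≠ j) (hik : i ≠ k)
    (hjk : j ≠ k) :
    sq p b ({i} :: {j, k} :: t) + sq p b ({j} :: {i, k} :: t) + sq p b ({k} :: {i, j} :: t) = 0 :=
  mkQ_symRel (.three b i j k t hij hik hjk)

lemma sq_four (b : ℕ) {i j k s : ℕ} (t : List (Finset ℕ)) (hij : i ≠ j) (hik : i ≠ k)
    (his : i ≠ s) (hjk : j ≠ k) (hjs : j ≠ s) (hks : k ≠ s) :
    sq p b ({i, j} :: {k, s} :: t) + sq p b ({i, k} :: {j, s} :: t)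
      + sq p b ({i, s} :: {j, k} :: t) = 0 :=
  mkQ_symRel (.four b i j k s t hij hik his hjk hjs hks)

lemma mkQ_P_lie_z {b : ℕ} {L : List (Finset ℕ)} (hL : 2 ≤ L.length) :
    (SymSpan p).mkQ ⁅P p b L, z p⁆ = sq p b (L ++ [∅]) := by
  rw [P_lie_z hL, sq]

lemma mkQ_P_lie_c {b i : ℕ} {L : List (Finset ℕ)} (hb : b < i) (hi : ∀ I ∈ L, i ∉ I) :
    (SymSpan p).mkQ ⁅P p b L, c p i⁆ = sumIns i L (sq p b) := by
  rw [P_lie_c hb hi]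
  exact sumIns_map (SymSpan p).mkQ.toAddMonoidHom i L (P p b)

/-- For `i = b` the index is repeated. For `i < b` the formula for a smallest index is a sum of
differences of permuted lists, which vanish by symmetry. -/
lemma mkQ_P_lie_c_of_le {b i : ℕ} (L : List (Finset ℕ)) (hb : i ≤ b) :
    (SymSpan p).mkQ ⁅P p b L, c p i⁆ = 0 := by
  by_cases hO : Ok b L
  swap
  · rw [P_of_not_ok hO, zero_lie, map_zero]
  match L with
  | [] => simp [P]
  | [X] => simp [P]
  | X :: Y :: t =>
    rw [P_of_ok hO]
    rcases hb.eq_or_lt with rfl | hb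
    · rw [comm_lie_c_eq_zero (I := insert i Y) (by simp) (by simp), map_zero]
    -- Now `i` is the smallest index and `b` becomes an ordinary element of the second set.
    · have hO' : Ok i (X :: insert b Y :: t) := by
        have h := hO.cons_singleton hb
        simp only [ok_cons] at h ⊢
        simp at h ⊢
        grind
      rw [comm_lie_c_of_ok hO', map_add, map_sub, ← sq, ← sq, sq_perm i (List.Perm.swap _ _ _),
        sub_self, zero_add, ← LinearMap.toAddMonoidHom_coe, sumPick_map]
      refine sumPick_eq_zero fun I s _ => ?_
      rw [LinearMap.toAddMonoidHom_coe, map_sub, ← sq, ← sq, sub_eq_zero]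
      exact sq_perm i (((List.Perm.swap _ _ _).trans ((List.Perm.swap _ _ _).cons _)).trans
        (List.Perm.swap _ _ _))

lemma mkQ_P_lie_c_perm {b i : ℕ} {L L' : List (Finset ℕ)} (e : L.Perm L') :
    (SymSpan p).mkQ ⁅P p b L, c p i⁆ = (SymSpan p).mkQ ⁅P p b L', c p i⁆ := by
  by_cases hb : i ≤ b
  · rw [mkQ_P_lie_c_of_le _ hb, mkQ_P_lie_c_of_le _ hb]
  push Not at hb
  by_cases hi : ∀ I ∈ L, i ∉ I
  · rw [mkQ_P_lie_c hb hi, mkQ_P_lie_c hb fun I hI => hi I (e.mem_iff.2 hI)]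
    exact sumIns_perm i (fun _ _ => sq_perm b) e
  · push Not at hi
    obtain ⟨I, hI, hiI⟩ := hi
    rw [P_lie_c_eq_zero hI hiI, P_lie_c_eq_zero (e.mem_iff.1 hI) hiI]

/-- To check that `c i` maps a relator into `SymSpan`, one may assume that `i` is a new index. -/
lemma mkQ_P_lie_c_cases {b i : ℕ} {S : Finset ℕ} {t : List (Finset ℕ)} {L : List (Finset ℕ)}
    (hL : ∀ x, x ∈ S → ∃ I ∈ L, x ∈ I) (ht : ∀ I ∈ t, I ∈ L)
    (h : ¬ (b < i ∧ i ∉ S ∧ ∀ I ∈ t, i ∉ I)) : (SymSpan p).mkQ ⁅P p b L, c p i⁆ = 0 := by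
  by_cases hb : i ≤ b
  · exact mkQ_P_lie_c_of_le _ hb
  push Not at hb h
  by_cases hS : i ∈ S
  · obtain ⟨I, hI, hiI⟩ := hL i hS
    rw [P_lie_c_eq_zero hI hiI, map_zero]
  · obtain ⟨I, hI, hiI⟩ := h hb hS
    rw [P_lie_c_eq_zero (ht I hI) hiI, map_zero]

lemma two_lt_card_triple {i j k : ℕ} (hij : i ≠ j) (hik : i ≠ k) (hjk : j ≠ k) :
    2 < #({i, j, k} : Finset ℕ) := by
  rw [Finset.card_eq_three.2 ⟨i, j, k, hij, hik, hjk, rfl⟩]; omega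

/-- The one deficit from which an insertion enters the range 0, 1, 2. For the shape `∅, {k}` the sum
is a `merge` relator; for three singletons, merging the two left over each time produces a `four`
relator with `∅` in its tail. -/
lemma sumIns_dfc_three {b i : ℕ} {L : List (Finset ℕ)} (hO : Ok b L) (hi : ∀ I ∈ L, i ∉ I)
    (hl : ∀ I ∈ L, #I ≤ 2) (hd : dfc L = 3) : sumIns i L (sq p b) = 0 := by
  obtain ⟨k, r, e, hr⟩ | ⟨k, l, s, r, e, hr⟩ := exists_perm_of_dfc_three hl hd
  · have hi' : ∀ I ∈ ∅ :: {k} :: r, i ∉ I := fun I hI => hi I (e.mem_iff.2 hI)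
    rw [sumIns_perm i (fun _ _ => sq_perm b) e, sumIns_cons, sumIns_cons, sumIns_pairs _ hr
      (fun I hI => hi' I (by simp [hI]))]
    · have hik : i ≠ k := by simpa using hi' {k} (by simp)
      rw [insert_empty_eq, add_zero]
      exact sq_merge b r hik
    · exact fun s ⟨I, hI, h⟩ => sq_large ⟨I, by simp [hI], h⟩
  · have hi' : ∀ I ∈ {k} :: {l} :: {s} :: r, i ∉ I := fun I hI => hi I (e.mem_iff.2 hI)
    have hO' := ((Ok.perm e).1 hO).1
    rw [sumIns_perm i (fun _ _ => sq_perm b) e, sumIns_cons, sumIns_cons, sumIns_cons,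
      sumIns_pairs _ hr (fun I hI => hi' I (by simp [hI]))]
    · have n : (i ≠ k ∧ i ≠ l ∧ i ≠ s) ∧ k ≠ l ∧ k ≠ s ∧ l ≠ s := by
        simp at hi' hO'; grind
      obtain ⟨⟨nik, nil, nis⟩, nkl, nks, nls⟩ := n
      have m1 := sq_merge (p := p) b ({i, k} :: r) nls
      have m2 := sq_merge (p := p) b ({i, l} :: r) nks
      have m3 := sq_merge (p := p) b ({i, s} :: r) nkl
      have f := sq_four (p := p) b (∅ :: r) nik nil nis nkl nks nls
      rw [sq_perm b (L := {i, k} :: {l} :: {s} :: r) (L' := {l} :: {s} :: {i, k} :: r) (by grind),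
        sq_perm b (L := {k} :: {i, l} :: {s} :: r) (L' := {k} :: {s} :: {i, l} :: r) (by grind),
        sq_perm b (L := {k} :: {l} :: {i, s} :: r) (L' := {k} :: {l} :: {i, s} :: r) (by grind)]
      rw [sq_perm b (L := {i, k} :: {l, s} :: ∅ :: r)
          (L' := ∅ :: {l, s} :: {i, k} :: r) (by grind),
        sq_perm b (L := {i, l} :: {k, s} :: ∅ :: r)
          (L' := ∅ :: {k, s} :: {i, l} :: r) (by grind),
        sq_perm b (L := {i, s} :: {k, l} :: ∅ :: r)
          (L' := ∅ :: {k, l} :: {i, s} :: r) (by grind)] at f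
      linear_combination (norm := module) m1 + m2 + m3 - f
    · exact fun s ⟨I, hI, h⟩ => sq_large ⟨I, by simp [hI], h⟩

lemma sumIns_large {b i : ℕ} {L : List (Finset ℕ)} (h : ∃ I ∈ L, 2 < #I) :
    sumIns i L (sq p b) = 0 := by
  refine sumIns_eq_zero fun l₁ I l₂ e => sq_large ?_
  obtain ⟨K, hK, hc⟩ := h
  simp only [e, List.mem_append, List.mem_cons] at hK
  rcases hK with hK | rfl | hK
  · exact ⟨K, by simp [hK], hc⟩
  · exact ⟨insert i K, by simp, hc.trans_le (Finset.card_le_card (Finset.subset_insert _ _))⟩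
  · exact ⟨K, by simp [hK], hc⟩

lemma symRel_lie_c {u : F p} (h : SymRel p u) (i : ℕ) : (SymSpan p).mkQ ⁅u, c p i⁆ = 0 := by
  cases h with
  | zc I h =>
    by_cases hi : i ∈ I
    · have := comm_lie_c_eq_zero (p := p) (l := [I]) (by simp) hi
      rw [comm_cons, fold_nil] at this
      rw [this, map_zero]
    · rw [← zc_insert hi]
      exact mkQ_symRel (.zc _ (h.trans_le (Finset.card_le_card (Finset.subset_insert _ _))))
  | dfc b L hL h =>
    by_cases hb : i ≤ b
    · exact mkQ_P_lie_c_of_le _ hb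
    push Not at hb
    by_cases hO : Ok b L
    swap
    · rw [P_of_not_ok hO, zero_lie, map_zero]
    by_cases hi : ∀ I ∈ L, i ∉ I
    swap
    · push Not at hi
      obtain ⟨I, hI, hiI⟩ := hi
      rw [P_lie_c_eq_zero hI hiI, map_zero]
    rw [mkQ_P_lie_c hb hi]
    by_cases hl : ∃ I ∈ L, 2 < #I
    · exact sumIns_large hl
    push Not at hl
    have h0 := dfc_nonneg hl
    obtain h3 | h3 : dfc L = 3 ∨ 3 < dfc L := by omega
    · exact sumIns_dfc_three hO hi hl h3
    -- An insertion lowers a deficit of at least four to at least three.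
    · refine sumIns_eq_zero fun l₁ I l₂ e => sq_dfc (by simpa [e] using hL) (.inr ?_)
      rw [dfc_insert (hi I (by simp [e])), ← e]
      omega
  | large b L h =>
    by_cases hb : i ≤ b
    · exact mkQ_P_lie_c_of_le _ hb
    push Not at hb
    by_cases hi : ∀ I ∈ L, i ∉ I
    · rw [mkQ_P_lie_c hb hi, sumIns_large h]
    · push Not at hi
      obtain ⟨I, hI, hiI⟩ := hi
      rw [P_lie_c_eq_zero hI hiI, map_zero]
  | swap_two b X Y t =>
    rw [sub_lie, map_sub, sub_eq_zero]
    exact mkQ_P_lie_c_perm (List.Perm.swap _ _ _)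
  | swap_three b X Y Z t =>
    rw [sub_lie, map_sub, sub_eq_zero]
    exact mkQ_P_lie_c_perm (by grind)
  | merge b k l t hkl =>
    rw [add_lie, map_add]
    by_cases h : b < i ∧ i ∉ ({k, l} : Finset ℕ) ∧ ∀ I ∈ t, i ∉ I
    swap
    · rw [mkQ_P_lie_c_cases (by simp) (by grind) h, mkQ_P_lie_c_cases (by simp) (by grind) h,
        add_zero]
    obtain ⟨hb, hi, ht⟩ := h
    simp only [Finset.mem_insert, Finset.mem_singleton, not_or] at hi
    rw [mkQ_P_lie_c hb (by simpa [hi] using ht), mkQ_P_lie_c hb (by simpa [hi] using ht)]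
    simp only [sumIns_cons, insert_empty_eq]
    -- Insertions into the tail give relators of the same family. Those into the two leading sets
    -- form a `three` relator, apart from a term with a set of size three.
    have h1 := sumIns_add i t (fun s => sq p b ({k} :: {l} :: s)) fun s => sq p b (∅ :: {k, l} :: s)
    simp only [sq_merge b _ hkl] at h1
    rw [sumIns_eq_zero fun _ _ _ _ => rfl] at h1
    have h2 := sq_three (p := p) b t hi.1 hi.2 hkl
    rw [sq_large (L := ∅ :: {i, k, l} :: t) ⟨{i, k, l}, by simp, two_lt_card_triple hi.1 hi.2 hkl⟩,
      sq_perm b (List.Perm.swap {l} {i, k} t)]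
    linear_combination (norm := module) h2 - h1
  | three b j k l t hjk hjl hkl =>
    rw [add_lie, add_lie, map_add, map_add]
    by_cases h : b < i ∧ i ∉ ({j, k, l} : Finset ℕ) ∧ ∀ I ∈ t, i ∉ I
    swap
    · rw [mkQ_P_lie_c_cases (by simp) (by grind) h, mkQ_P_lie_c_cases (by simp) (by grind) h,
        mkQ_P_lie_c_cases (by simp) (by grind) h, add_zero, add_zero]
    obtain ⟨hb, hi, ht⟩ := h
    simp only [Finset.mem_insert, Finset.mem_singleton, not_or] at hi
    obtain ⟨hij, hik, hil⟩ := hi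
    rw [mkQ_P_lie_c hb (by simpa [hij, hik, hil] using ht),
      mkQ_P_lie_c hb (by simpa [hij, hik, hil] using ht),
      mkQ_P_lie_c hb (by simpa [hij, hik, hil] using ht)]
    simp only [sumIns_cons]
    have h1 := sumIns_add i t (fun s => sq p b ({j} :: {k, l} :: s) + sq p b ({k} :: {j, l} :: s))
      fun s => sq p b ({l} :: {j, k} :: s)
    simp only [sumIns_add, sq_three b _ hjk hjl hkl] at h1
    rw [sumIns_eq_zero fun _ _ _ _ => rfl] at h1
    have h2 := sq_four (p := p) b t hij hik hil hjk hjl hkl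
    rw [sq_large (L := {j} :: {i, k, l} :: t) ⟨{i, k, l}, by simp, two_lt_card_triple hik hil hkl⟩,
      sq_large (L := {k} :: {i, j, l} :: t) ⟨{i, j, l}, by simp, two_lt_card_triple hij hil hjl⟩,
      sq_large (L := {l} :: {i, j, k} :: t) ⟨{i, j, k}, by simp, two_lt_card_triple hij hik hjk⟩]
    linear_combination (norm := module) h2 - h1
  | four b j k l s t hjk hjl hjs hkl hks hls =>
    rw [add_lie, add_lie, map_add, map_add]
    by_cases h : b < i ∧ i ∉ ({j, k, l, s} : Finset ℕ) ∧ ∀ I ∈ t, i ∉ I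
    swap
    · rw [mkQ_P_lie_c_cases (by simp) (by grind) h, mkQ_P_lie_c_cases (by simp) (by grind) h,
        mkQ_P_lie_c_cases (by simp) (by grind) h, add_zero, add_zero]
    obtain ⟨hb, hi, ht⟩ := h
    simp only [Finset.mem_insert, Finset.mem_singleton, not_or] at hi
    obtain ⟨hij, hik, hil, his⟩ := hi
    rw [mkQ_P_lie_c hb (by simpa [hij, hik, hil, his] using ht),
      mkQ_P_lie_c hb (by simpa [hij, hik, hil, his] using ht),
      mkQ_P_lie_c hb (by simpa [hij, hik, hil, his] using ht)]
    simp only [sumIns_cons]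
    have h1 := sumIns_add i t
      (fun x => sq p b ({j, k} :: {l, s} :: x) + sq p b ({j, l} :: {k, s} :: x))
      fun x => sq p b ({j, s} :: {k, l} :: x)
    simp only [sumIns_add, sq_four b _ hjk hjl hjs hkl hks hls] at h1
    rw [sumIns_eq_zero fun _ _ _ _ => rfl] at h1
    rw [sq_large ⟨{i, j, k}, by simp, two_lt_card_triple hij hik hjk⟩,
      sq_large ⟨{i, l, s}, by simp, two_lt_card_triple hil his hls⟩,
      sq_large ⟨{i, j, l}, by simp, two_lt_card_triple hij hil hjl⟩,
      sq_large ⟨{i, k, s}, by simp, two_lt_card_triple hik his hks⟩,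
      sq_large ⟨{i, j, s}, by simp, two_lt_card_triple hij his hjs⟩,
      sq_large ⟨{i, k, l}, by simp, two_lt_card_triple hik hil hkl⟩]
    linear_combination (norm := module) - h1

lemma comm_pair_empty_mem {I : Finset ℕ} (h : 3 < #I) : comm p [I, ∅] ∈ SymSpan p := by
  refine comm_mem (by simp) fun a _ _ _ X Y t e _ => Submodule.subset_span (.large _ _ ?_)
  refine ⟨I.erase a, List.mem_map_of_mem (e.mem_iff.2 (by simp)), ?_⟩
  have := Finset.pred_card_le_card_erase (s := I) (a := a)
  omega

lemma symRel_lie_z {u : F p} (h : SymRel p u) : (SymSpan p).mkQ ⁅u, z p⁆ = 0 := by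
  cases h with
  | zc I h =>
    have e : ⁅zc p I, z p⁆ = comm p [I, ∅] := by rw [comm_cons_cons, fold_nil, zc_empty]
    rw [e]
    exact (Submodule.Quotient.mk_eq_zero _).2 (comm_pair_empty_mem h)
  | dfc b L hL h =>
    rw [mkQ_P_lie_z hL]
    by_cases hl : ∃ I ∈ L, 2 < #I
    · obtain ⟨I, hI, hc⟩ := hl
      exact sq_large ⟨I, by simp [hI], hc⟩
    push Not at hl
    have h0 := dfc_nonneg hl
    -- Without large sets the deficit is nonnegative, hence already above two, and a further empty
    -- slot raises it.
    refine sq_dfc (by simp; omega) (.inr ?_)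
    simp [dfc_append]; omega
  | large b L h =>
    match L, h with
    | [X], _ => simp [P]
    | X :: Y :: t, ⟨I, hI, hc⟩ =>
      rw [mkQ_P_lie_z (by simp)]
      exact sq_large ⟨I, List.mem_append_left _ hI, hc⟩
  | swap_two b X Y t =>
    rw [sub_lie, map_sub, mkQ_P_lie_z (by simp), mkQ_P_lie_z (by simp), sub_eq_zero]
    simp only [List.cons_append]
    exact sq_perm b (List.Perm.swap _ _ _)
  | swap_three b X Y Z t =>
    rw [sub_lie, map_sub, mkQ_P_lie_z (by simp), mkQ_P_lie_z (by simp), sub_eq_zero]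
    simp only [List.cons_append]
    exact sq_perm b (by grind)
  | merge b k l t hkl =>
    rw [add_lie, map_add, mkQ_P_lie_z (by simp), mkQ_P_lie_z (by simp)]
    simp only [List.cons_append]
    exact sq_merge b (t ++ [∅]) hkl
  | three b j k l t hjk hjl hkl =>
    rw [add_lie, add_lie, map_add, map_add, mkQ_P_lie_z (by simp), mkQ_P_lie_z (by simp),
      mkQ_P_lie_z (by simp)]
    simp only [List.cons_append]
    exact sq_three b (t ++ [∅]) hjk hjl hkl
  | four b j k l s t hjk hjl hjs hkl hks hls =>
    rw [add_lie, add_lie, map_add, map_add, mkQ_P_lie_z (by simp), mkQ_P_lie_z (by simp),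
      mkQ_P_lie_z (by simp)]
    simp only [List.cons_append]
    exact sq_four b (t ++ [∅]) hjk hjl hjs hkl hks hls

lemma lie_mem_of_span {S : Set (F p)} {x : F p}
    (h : ∀ u ∈ S, ⁅u, x⁆ ∈ Submodule.span (ZMod p) S) {u : F p}
    (hu : u ∈ Submodule.span (ZMod p) S) : ⁅u, x⁆ ∈ Submodule.span (ZMod p) S := by
  induction hu using Submodule.span_induction with
  | mem u hu => exact h u hu
  | zero => rw [zero_lie]; exact zero_mem _
  | add u v _ _ hu hv => rw [add_lie]; exact add_mem hu hv
  | smul r u _ hu => rw [smul_lie]; exact Submodule.smul_mem _ r hu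

/-- `SymSpan` is an ideal. -/
def symIdeal (p : ℕ) : LieIdeal (ZMod p) (F p) :=
  { SymSpan p with
    lie_mem := fun {x u} hu => lie_mem_of_closed (SymSpan p)
      (fun _ hw => lie_mem_of_span
        (fun _ hu => (Submodule.Quotient.mk_eq_zero _).1 (symRel_lie_z hu)) hw)
      (fun i _ hw => lie_mem_of_span
        (fun _ hu => (Submodule.Quotient.mk_eq_zero _).1 (symRel_lie_c hu i)) hw) x u hu }

lemma J_le_symSpan : (J p).toSubmodule ≤ SymSpan p := by
  suffices h : J p ≤ symIdeal p from h
  rw [J, LieSubmodule.lieSpan_le]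
  rintro u ⟨l, hB, h, rfl⟩
  refine Submodule.subset_span ?_
  match l, hB with
  | [I], hB =>
    have hI : 3 < #I := by
      rcases h with ⟨hne, h⟩ | h
      · have : I.Nonempty := Finset.nonempty_iff_ne_empty.2 fun h => hne (by rw [h])
        have := Finset.card_pos.2 this
        simp [typ_eq] at h
        omega
      · exact absurd h (by simp [HasLargeSet])
    exact .zc I hI
  | X :: Y :: t, hB =>
    obtain ⟨a, Y', ha, rfl, hO, e⟩ := exists_eq_P_of_isBasisIndex (p := p) hB
    rw [e]
    rcases h with ⟨-, h⟩ | h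
    · refine .dfc a _ (by simp) ?_
      simp only [typ_eq, dfc_cons, Finset.card_insert_of_notMem ha] at h ⊢
      push_cast at h
      omega
    · refine .large a _ ?_
      simp only [HasLargeSet] at h
      rcases h with h | ⟨I, hI, h⟩
      · exact ⟨X, by simp, h⟩
      · exact ⟨I, by simp [hI], h⟩

/-! ### The given relators modulo `V ⊔ VTwo` -/

/-- The class of `P b L` modulo `V ⊔ VTwo`. -/
def w (p : ℕ) (b : ℕ) (L : List (Finset ℕ)) : F p ⧸ (V p ⊔ VTwo p) :=
  (V p ⊔ VTwo p).mkQ (P p b L)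

lemma w_tail_perm (b : ℕ) (X Y : Finset ℕ) {t t' : List (Finset ℕ)} (h : t.Perm t') :
    w p b (X :: Y :: t) = w p b (X :: Y :: t') :=
  congrArg (V p ⊔ VTwo p).mkQ (P_perm b X Y h)

lemma w_of_not_ok {b : ℕ} {L : List (Finset ℕ)} (h : ¬ Ok b L) : w p b L = 0 := by
  rw [w, P_of_not_ok h, map_zero]

lemma mkQ_of_mem_V {u : F p} (h : u ∈ V p) : (V p ⊔ VTwo p).mkQ u = 0 :=
  (Submodule.Quotient.mk_eq_zero _).2 (Submodule.mem_sup_left h)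

lemma mkQ_relE {u : F p} (h : RelE p u) : (V p ⊔ VTwo p).mkQ u = 0 :=
  mkQ_of_mem_V (Submodule.subset_span (.inl (.inl (.inr h))))

lemma mkQ_relG {u : F p} (h : RelG p u) : (V p ⊔ VTwo p).mkQ u = 0 :=
  mkQ_of_mem_V (Submodule.subset_span (.inl (.inr h)))

lemma mkQ_relH {u : F p} (h : RelH p u) : (V p ⊔ VTwo p).mkQ u = 0 :=
  mkQ_of_mem_V (Submodule.subset_span (.inr h))

lemma mkQ_relTwo {u : F p} (h : RelTwo p u) : (V p ⊔ VTwo p).mkQ u = 0 :=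
  (Submodule.Quotient.mk_eq_zero _).2 (Submodule.mem_sup_right (Submodule.subset_span h))

/-- By `isZ_iff` these are exactly the size conditions that put a basis element outside `Z`; a large
second set needs no separate treatment on this side. -/
lemma w_eq_zero {b : ℕ} {L : List (Finset ℕ)}
    (h : (∃ I ∈ L, 2 < #I) ∨ dfc L < 0 ∨ 2 < dfc L) : w p b L = 0 := by
  by_cases hO : Ok b L
  swap
  · exact w_of_not_ok hO
  match L with
  | [] => simp [w, P]
  | [X] => simp [w, P]
  | X :: Y :: t =>
    obtain ⟨t', e, hB, hP⟩ := exists_isBasisIndex (p := p) hO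
    have hb : b ∉ Y := fun hb => (hO.2 Y (by simp) b hb).ne rfl
    rw [w, hP]
    refine mkQ_of_mem_V (Submodule.subset_span (.inl (.inl (.inl ⟨_, hB, fun hZ => ?_, rfl⟩))))
    rw [isZ_iff hb] at hZ
    rw [dfc_perm ((e.cons Y).cons X)] at h
    simp only [← e.mem_iff] at hZ
    grind

lemma cfg_of_ok {a : ℕ} {l r : List (Finset ℕ)} (h : Ok a (l ++ r)) (hr : ∀ I ∈ r, #I = 2) :
    Cfg a l r := ⟨h.1, h.2, hr⟩

section Relators

variable {b : ℕ} {r : List (Finset ℕ)}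

lemma w_E1 {i j : ℕ} {A B : Finset ℕ} (h : Ok b (A :: B :: {i} :: {j} :: r)) (hA : #A = 2)
    (hB : #B = 2) (hr : ∀ I ∈ r, #I = 2) :
    w p b (A :: B :: {i} :: {j} :: r) + w p b (A :: B :: ∅ :: {i, j} :: r) = 0 := by
  have := mkQ_relE (p := p) (.E1 b i j A B r (cfg_of_ok h hr) hA hB)
  rwa [comm_E1 h, map_add] at this

lemma w_E2 {i k : ℕ} {A : Finset ℕ} (h : Ok b (A :: {k} :: {i} :: r)) (hA : #A = 2)
    (hr : ∀ I ∈ r, #I = 2) :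
    w p b (A :: {k} :: {i} :: r) + w p b (A :: {k, i} :: ∅ :: r) = 0 := by
  have := mkQ_relE (p := p) (.E2 b i k A r (cfg_of_ok h hr) hA)
  rwa [comm_E2 h, map_add] at this

lemma w_E3 {i j : ℕ} {B : Finset ℕ} (h : Ok b ({i} :: B :: {j} :: r)) (hB : #B = 2)
    (hr : ∀ I ∈ r, #I = 2) :
    w p b ({i} :: B :: {j} :: r) + w p b ({i, j} :: B :: ∅ :: r) = 0 := by
  have := mkQ_relE (p := p) (.E3 b i j B r (cfg_of_ok h hr) hB)
  rwa [comm_E3 h, map_add] at this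

lemma w_E4 {B C : Finset ℕ} (h : Ok b (B :: C :: r)) (hB : #B = 2) (hC : #C = 2)
    (hr : ∀ I ∈ r, #I = 2) : w p b (∅ :: B :: C :: r) = w p b (C :: B :: ∅ :: r) := by
  have := mkQ_relE (p := p) (.E4 b B C r (cfg_of_ok h hr) hB hC)
  rwa [comm_E4 h, map_sub, sub_eq_zero] at this

lemma w_E5 {A C : Finset ℕ} (h : Ok b (A :: C :: r)) (hA : #A = 2) (hC : #C = 2)
    (hr : ∀ I ∈ r, #I = 2) : w p b (A :: ∅ :: C :: r) = w p b (A :: C :: ∅ :: r) := by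
  obtain ⟨i, j, hij, rfl⟩ := Finset.card_eq_two.1 hC
  have h' : Ok b (A :: {i} :: {j} :: r) := by simp [ok_cons] at h ⊢; grind
  have := mkQ_relE (p := p) (.E5 b i j A r (cfg_of_ok h' hr) hA)
  rwa [comm_E5 h', map_sub, sub_eq_zero] at this

lemma w_E6 {i j k s : ℕ} (h : Ok b ({i} :: {s} :: {j} :: {k} :: r)) (hr : ∀ I ∈ r, #I = 2) :
    w p b ({i} :: {s} :: {j, k} :: r) - w p b ({i, j} :: {s, k} :: ∅ :: r)
      - w p b ({i, k} :: {s, j} :: ∅ :: r) = 0 := by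
  have := mkQ_relE (p := p) (.E6 b i j k s r (cfg_of_ok h hr))
  rwa [comm_E6 h, map_sub, map_sub] at this

lemma w_E7 {A B C : Finset ℕ} (h : Ok b (A :: B :: C :: r)) (hA : #A = 2) (hB : #B = 2)
    (hC : #C = 2) (hr : ∀ I ∈ r, #I = 2) :
    w p b (A :: B :: ∅ :: C :: r) = w p b (C :: B :: ∅ :: A :: r) := by
  have := mkQ_relE (p := p) (.E7 b A B C r (cfg_of_ok h hr) hA hB hC)
  rwa [comm_E7 h, map_sub, sub_eq_zero] at this

lemma w_E8 {A B : Finset ℕ} (h : Ok b (A :: B :: r)) (hA : #A = 2) (hB : #B = 2)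
    (hr : ∀ I ∈ r, #I = 2) : w p b (A :: B :: ∅ :: r) = w p b (B :: A :: ∅ :: r) := by
  have := mkQ_relE (p := p) (.E8 b A B r (cfg_of_ok h hr) hA hB)
  rwa [comm_E8 h, map_sub, sub_eq_zero] at this

lemma w_E9 {i j k s : ℕ} (h : Ok b ({i} :: {j} :: {k} :: {s} :: r)) (hr : ∀ I ∈ r, #I = 2) :
    w p b ({i, k} :: {j, s} :: ∅ :: r) + w p b ({i, j} :: {k, s} :: ∅ :: r)
      + w p b ({i, s} :: {j, k} :: ∅ :: r) = 0 := by
  have := mkQ_relE (p := p) (.E9 b i j k s r (cfg_of_ok h hr))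
  rwa [comm_E9 h, map_add, map_add] at this

lemma w_G1 {i : ℕ} {B C : Finset ℕ} (h : Ok b ({i} :: B :: C :: r)) (hB : #B = 2) (hC : #C = 2)
    (hr : ∀ I ∈ r, #I = 2) : w p b ({i} :: B :: C :: r) = w p b (C :: B :: {i} :: r) := by
  obtain ⟨j, k, hjk, rfl⟩ := Finset.card_eq_two.1 hC
  have h' : Ok b ({i} :: B :: {j} :: {k} :: r) := by simp [ok_cons] at h ⊢; grind
  have := mkQ_relG (p := p) (.G1 b i j k B r (cfg_of_ok h' hr) hB)
  rwa [comm_G1 h', map_sub, sub_eq_zero] at this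

lemma w_G2 {k : ℕ} {A C : Finset ℕ} (h : Ok b (A :: {k} :: C :: r)) (hA : #A = 2) (hC : #C = 2)
    (hr : ∀ I ∈ r, #I = 2) : w p b (A :: {k} :: C :: r) = w p b (A :: C :: {k} :: r) := by
  obtain ⟨i, j, hij, rfl⟩ := Finset.card_eq_two.1 hC
  have h' : Ok b (A :: {k} :: {i} :: {j} :: r) := by simp [ok_cons] at h ⊢; grind
  have := mkQ_relG (p := p) (.G2 b i j k A r (cfg_of_ok h' hr) hA)
  rwa [comm_G2 h', map_sub, sub_eq_zero] at this

lemma w_G3 {k : ℕ} {A B : Finset ℕ} (h : Ok b (A :: B :: {k} :: r)) (hA : #A = 2) (hB : #B = 2)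
    (hr : ∀ I ∈ r, #I = 2) : w p b (A :: B :: {k} :: r) = w p b (B :: A :: {k} :: r) := by
  have := mkQ_relG (p := p) (.G3 b k A B r (cfg_of_ok h hr) hA hB)
  rwa [comm_G3 h, map_sub, sub_eq_zero] at this

lemma w_G4 {k : ℕ} {A B C : Finset ℕ} (h : Ok b (A :: B :: {k} :: C :: r)) (hA : #A = 2)
    (hB : #B = 2) (hC : #C = 2) (hr : ∀ I ∈ r, #I = 2) :
    w p b (A :: B :: {k} :: C :: r) = w p b (C :: B :: {k} :: A :: r) := by
  have := mkQ_relG (p := p) (.G4 b k A B C r (cfg_of_ok h hr) hA hB hC)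
  rwa [comm_G4 h, map_sub, sub_eq_zero] at this

lemma w_G5 {i j k s l : ℕ} (h : Ok b ({i} :: {j} :: {k} :: {s} :: {l} :: r))
    (hr : ∀ I ∈ r, #I = 2) :
    w p b ({i, k} :: {j, s} :: {l} :: r) + w p b ({i, j} :: {k, s} :: {l} :: r)
      + w p b ({i, s} :: {j, k} :: {l} :: r) = 0 := by
  have := mkQ_relG (p := p) (.G5 b i j k s l r (cfg_of_ok h hr))
  rwa [comm_G5 h, map_add, map_add] at this

lemma w_G6 {i j k : ℕ} {A : Finset ℕ} (h : Ok b (A :: {i} :: {j} :: {k} :: r)) (hA : #A = 2)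
    (hr : ∀ I ∈ r, #I = 2) :
    w p b (A :: {i, k} :: {j} :: r) + w p b (A :: {k, j} :: {i} :: r)
      + w p b (A :: {i, j} :: {k} :: r) = 0 := by
  have := mkQ_relG (p := p) (.G6 b i j k A r (cfg_of_ok h hr) hA)
  rwa [comm_G6 h, map_add, map_add] at this

lemma w_H1 {A B : Finset ℕ} (h : Ok b (A :: B :: r)) (hA : #A = 2) (hB : #B = 2)
    (hr : ∀ I ∈ r, #I = 2) : w p b (A :: B :: r) = w p b (B :: A :: r) := by
  have := mkQ_relH (p := p) (.H1 b A B r (cfg_of_ok h hr) hA hB)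
  rwa [comm_H1 h, map_sub, sub_eq_zero] at this

lemma w_H2 {A B C : Finset ℕ} (h : Ok b (A :: B :: C :: r)) (hA : #A = 2) (hB : #B = 2)
    (hC : #C = 2) (hr : ∀ I ∈ r, #I = 2) :
    w p b (A :: B :: C :: r) = w p b (C :: B :: A :: r) := by
  have := mkQ_relH (p := p) (.H2 b A B C r (cfg_of_ok h hr) hA hB hC)
  rwa [comm_H2 h, map_sub, sub_eq_zero] at this

lemma w_H3 {i j k s : ℕ} (h : Ok b ({i} :: {j} :: {k} :: {s} :: r)) (hr : ∀ I ∈ r, #I = 2) :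
    w p b ({i, k} :: {j, s} :: r) + w p b ({i, j} :: {k, s} :: r)
      + w p b ({i, s} :: {k, j} :: r) = 0 := by
  have := mkQ_relH (p := p) (.H3 b i j k s r (cfg_of_ok h hr))
  rwa [comm_H3 h, map_add, map_add] at this

lemma w_D1 {i j : ℕ} (h : Ok b [{i}, {j}]) : w p b [{i}, {j}] + w p b [∅, {i, j}] = 0 := by
  have := mkQ_relTwo (p := p) (.D1 b i j (cfg_of_ok h (by simp)))
  rwa [comm_D1 h, map_add] at this

lemma w_D2 {A : Finset ℕ} (h : Ok b [A]) (hA : #A = 2) : w p b [A, ∅] = w p b [∅, A] := by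
  obtain ⟨i, j, hij, rfl⟩ := Finset.card_eq_two.1 hA
  have h' : Ok b [{i}, {j}] := by simp [ok_cons] at h ⊢; grind
  have := mkQ_relTwo (p := p) (.D2 b i j (cfg_of_ok h' (by simp)))
  rwa [comm_D2 h', map_sub, sub_eq_zero] at this

lemma w_D3 {k : ℕ} {A : Finset ℕ} (h : Ok b [A, {k}]) (hA : #A = 2) :
    w p b [A, {k}] = w p b [{k}, A] := by
  obtain ⟨i, j, hij, rfl⟩ := Finset.card_eq_two.1 hA
  have h' : Ok b [{i}, {j}, {k}] := by simp [ok_cons] at h ⊢; grind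
  have := mkQ_relTwo (p := p) (.D3 b i j k (cfg_of_ok h' (by simp)))
  rwa [comm_D3 h', map_sub, sub_eq_zero] at this

lemma w_D4 {i j k : ℕ} (h : Ok b [{i}, {j}, {k}]) :
    w p b [{i}, {j, k}] + w p b [{j}, {i, k}] + w p b [{k}, {i, j}] = 0 := by
  have := mkQ_relTwo (p := p) (.D4 b i j k (cfg_of_ok h (by simp)))
  rwa [comm_D4 h, map_add, map_add] at this

end Relators

/-! ### Independence of the order of the slots modulo `V ⊔ VTwo` -/

section

variable {b : ℕ}

/-- Normal forms modulo `V ⊔ VTwo` for the commutators in which, apart from a single set `S`, only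
sets of size two occur. -/
def nf (p b : ℕ) (S : Finset ℕ) : List (Finset ℕ) → F p ⧸ (V p ⊔ VTwo p)
  | [] => 0
  | [A] => w p b [S, A]
  | A :: B :: r => w p b (A :: B :: S :: r)

lemma nf_perm {S : Finset ℕ} (hS : S = ∅ ∨ ∃ k, S = {k}) {R R' : List (Finset ℕ)}
    (e : R.Perm R') (hO : Ok b (S :: R)) (hR : ∀ I ∈ R, #I = 2) : nf p b S R = nf p b S R' := by
  refine eq_of_perm_of_swaps (Q := fun R => Ok b (S :: R) ∧ ∀ I ∈ R, #I = 2)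
    (fun L L' e h => ⟨(Ok.perm (e.cons S)).1 h.1, fun I hI => h.2 I (e.mem_iff.2 hI)⟩)
    (fun X Y _ _ h => ?_) (fun A B r h => ?_) (fun A B C r h => ?_)
    e ⟨hO, hR⟩
  · exact w_tail_perm b X Y (h.cons S)
  · obtain ⟨hO, h⟩ := h
    have hO' : Ok b (A :: B :: S :: r) :=
      (Ok.perm (((List.Perm.swap _ _ _).trans ((List.Perm.swap _ _ _).cons _)))).1 hO
    simp only [List.mem_cons, forall_eq_or_imp] at h
    obtain ⟨hA, hB, hr⟩ := h
    rcases hS with rfl | ⟨k, rfl⟩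
    · exact w_E8 (ok_cons.1 hO).2.2 hA hB hr
    · exact w_G3 hO' hA hB hr
  · obtain ⟨hO, h⟩ := h
    have hO' : Ok b (A :: B :: S :: C :: r) :=
      (Ok.perm (((List.Perm.swap _ _ _).trans ((List.Perm.swap _ _ _).cons _)))).1 hO
    simp only [List.mem_cons, forall_eq_or_imp] at h
    obtain ⟨hA, hB, hC, hr⟩ := h
    rcases hS with rfl | ⟨k, rfl⟩
    · exact w_E7 (ok_cons.1 hO).2.2 hA hB hC hr
    · exact w_G4 hO' hA hB hC hr

/-- The exceptional set `S` is moved to the third slot: from the first by E4 or G1, from the second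
by E5 or G2 (D2 or D3 if there are only two slots), and within the tail for free. -/
lemma w_eq_nf {S : Finset ℕ} (hS : S = ∅ ∨ ∃ k, S = {k}) {L R : List (Finset ℕ)}
    (e : L.Perm (S :: R)) (hO : Ok b L) (hR : ∀ I ∈ R, #I = 2) : w p b L = nf p b S R := by
  have hO' := (Ok.perm e).1 hO
  match L with
  | [] => simp at e
  | [X] =>
    obtain rfl : R = [] := by simpa using e.length_eq.symm
    simp [w, P, nf]
  | X :: Y :: t =>
    by_cases hX : X = S
    · subst hX
      have e' := (List.perm_cons _).1 e
      rw [← nf_perm hS e' hO fun I hI => hR I (e'.mem_iff.1 hI)]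
      match t with
      | [] => rfl
      | C :: r =>
        have h : ∀ I ∈ Y :: C :: r, #I = 2 := fun I hI => hR I (e'.mem_iff.1 hI)
        -- E4 and G1 exchange the first and third slots, so `C` comes out in front of `Y`.
        rw [nf_perm hS (List.Perm.swap C Y r) hO h]
        simp only [List.mem_cons, forall_eq_or_imp] at h
        rcases hS with rfl | ⟨k, rfl⟩
        · exact w_E4 (ok_cons.1 hO).2.2 h.1 h.2.1 h.2.2
        · exact w_G1 hO h.1 h.2.1 h.2.2
    by_cases hY : Y = S
    · subst hY
      have e' := (List.perm_cons _).1 ((List.Perm.swap X Y t).trans e)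
      rw [← nf_perm hS e' ((Ok.perm (List.Perm.swap Y X t)).1 hO)
        fun I hI => hR I (e'.mem_iff.1 hI)]
      have h : ∀ I ∈ X :: t, #I = 2 := fun I hI => hR I (e'.mem_iff.1 hI)
      match t with
      | [] =>
        rcases hS with rfl | ⟨k, rfl⟩
        · exact w_D2 (by simp [ok_cons] at hO ⊢; grind) (h X (by simp))
        · exact w_D3 hO (h X (by simp))
      | C :: r =>
        simp only [List.mem_cons, forall_eq_or_imp] at h
        rcases hS with rfl | ⟨k, rfl⟩
        · exact w_E5 (by simp [ok_cons] at hO ⊢; grind) h.1 h.2.1 h.2.2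
        · exact w_G2 hO h.1 h.2.1 h.2.2
    · have ht : S ∈ t := by
        have := e.mem_iff.2 (List.mem_cons_self (a := S) (l := R))
        simp only [List.mem_cons] at this
        grind
      have e₁ := List.perm_cons_erase ht
      rw [w_tail_perm b X Y e₁]
      have e₂ : (X :: Y :: t).Perm (S :: X :: Y :: t.erase S) :=
        (((e₁.cons Y).cons X).trans ((List.Perm.swap _ _ _).cons _)).trans (.swap _ _ _)
      have e₃ : (X :: Y :: t.erase S).Perm R := (List.perm_cons _).1 (e₂.symm.trans e)
      exact nf_perm hS e₃ ((Ok.perm e₂).1 hO) fun I hI => hR I (e₃.mem_iff.1 hI)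

lemma ok_pair {i j : ℕ} {R : List (Finset ℕ)} (h : Ok b ({i} :: {j} :: R)) :
    Ok b (∅ :: {i, j} :: R) := by
  simp [ok_cons] at h ⊢; grind

lemma card_pair_of_ok {i j : ℕ} {R : List (Finset ℕ)} (h : Ok b ({i} :: {j} :: R)) :
    #({i, j} : Finset ℕ) = 2 :=
  Finset.card_pair (by simp [ok_cons] at h; grind)

/-- If the first slot is a singleton and so is one of the others, then these can be merged. -/
lemma w_merge_head {i j : ℕ} {t R : List (Finset ℕ)} (e : t.Perm ({j} :: R))
    (hO : Ok b ({i} :: t)) (hR : ∀ I ∈ R, #I = 2) :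
    w p b ({i} :: t) = - nf p b ∅ ({i, j} :: R) := by
  have hO₁ : Ok b ({i} :: {j} :: R) := (Ok.perm (e.cons _)).1 hO
  have hO₂ := ok_pair hO₁
  have hc := card_pair_of_ok hO₁
  have hR' : ∀ I ∈ {i, j} :: R, #I = 2 := by simpa [hc] using hR
  match t with
  | [] => simp at e
  | Y :: t =>
    by_cases hY : Y = {j}
    · subst hY
      have e' := (List.perm_cons _).1 e
      rw [w_tail_perm b _ _ e', eq_neg_iff_add_eq_zero]
      rcases R with _ | ⟨C, r⟩
      · exact w_D1 hO₁
      · simp only [List.mem_cons, forall_eq_or_imp] at hR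
        obtain ⟨k, l, hkl, rfl⟩ := Finset.card_eq_two.1 hR.1
        have hO₃ : Ok b ({i} :: {j} :: {k} :: {l} :: r) := by simp [ok_cons] at hO₁ ⊢; grind
        -- E6 expands the commutator into two of the three pairings of `i, j, k, l`, and E9 replaces
        -- these by the third.
        have h6 := w_E6 (p := p) hO₃ hR.2
        have h9 := w_E9 (p := p) hO₃ hR.2
        change _ + w p b ({i, j} :: {k, l} :: ∅ :: r) = 0
        linear_combination (norm := module) h6 + h9
    · obtain ⟨B, rfl⟩ : ∃ B, B = Y := ⟨_, rfl⟩
      have ht : {j} ∈ t := by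
        have := e.mem_iff.2 (List.mem_cons_self (a := {j}) (l := R))
        simp only [List.mem_cons] at this
        grind
      have e₁ := List.perm_cons_erase ht
      have e₂ : (B :: t.erase {j}).Perm R :=
        (List.perm_cons _).1 (((List.Perm.swap _ _ _).trans (e₁.cons B).symm).trans e)
      have h : ∀ I ∈ B :: t.erase {j}, #I = 2 := fun I hI => hR I (e₂.mem_iff.1 hI)
      rw [w_tail_perm b _ _ e₁, eq_neg_iff_add_eq_zero,
        nf_perm (.inl rfl) (e₂.symm.cons _) hO₂ hR']
      simp only [List.mem_cons, forall_eq_or_imp] at h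
      exact w_E3 ((Ok.perm ((e₁.cons B).cons _)).1 hO) h.1 h.2

/-- If the second slot is a singleton and so is one of the following, then these can be merged. -/
lemma w_merge_second {i j : ℕ} {A : Finset ℕ} {t R : List (Finset ℕ)} (e : t.Perm ({j} :: R))
    (hO : Ok b (A :: {i} :: t)) (hA : #A = 2) (hR : ∀ I ∈ R, #I = 2) :
    w p b (A :: {i} :: t) = - nf p b ∅ (A :: {i, j} :: R) := by
  rw [w_tail_perm b _ _ e, eq_neg_iff_add_eq_zero]
  exact w_E2 ((Ok.perm ((e.cons _).cons A)).1 hO) hA hR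

/-- The cases are the positions of the two singletons: one in front (`w_merge_head`), one in the
second slot behind a pair (E2), or both in the tail (E1). The value reached does not depend on the
case. -/
lemma w_merge {i j : ℕ} {L R : List (Finset ℕ)} (e : L.Perm ({i} :: {j} :: R)) (hO : Ok b L)
    (hR : ∀ I ∈ R, #I = 2) : w p b L = - nf p b ∅ ({i, j} :: R) := by
  have hO₁ := (Ok.perm e).1 hO
  have hO₂ := ok_pair hO₁
  have hc := card_pair_of_ok hO₁
  have e' := e.trans (List.Perm.swap _ _ _)
  match L with
  | [] => simp at e
  | X :: t =>
    by_cases hi : X = {i}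
    · subst hi; exact w_merge_head ((List.perm_cons _).1 e) hO hR
    by_cases hj : X = {j}
    · subst hj
      rw [Finset.pair_comm]
      exact w_merge_head ((List.perm_cons _).1 e') hO hR
    have hX : X ∈ R := by
      have := e.mem_iff.1 (List.mem_cons_self (a := X) (l := t)); grind
    have eX := List.perm_cons_erase hX
    have et : t.Perm ({i} :: {j} :: R.erase X) := by
      rw [← List.perm_cons X]
      exact (e.trans (((eX.cons _).trans (.swap _ _ _)).cons _)).trans (.swap _ _ _)
    have hXc := hR X hX
    have hRX : ∀ I ∈ R.erase X, #I = 2 := fun I hI => hR I (List.mem_of_mem_erase hI)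
    have hRij : ∀ I ∈ {i, j} :: R, #I = 2 := by simpa [hc] using hR
    rw [nf_perm (.inl rfl) ((eX.cons _).trans (.swap _ _ _)) hO₂ hRij]
    match t with
    | [] => simp at et
    | Y :: s =>
      by_cases hi' : Y = {i}
      · subst hi'; exact w_merge_second ((List.perm_cons _).1 et) hO hXc hRX
      by_cases hj' : Y = {j}
      · subst hj'
        rw [Finset.pair_comm]
        exact w_merge_second ((List.perm_cons _).1 (et.trans (.swap _ _ _))) hO hXc hRX
      have hY : Y ∈ R.erase X := by
        have := et.mem_iff.1 (List.mem_cons_self (a := Y) (l := s)); grind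
      have eY := List.perm_cons_erase hY
      have es : s.Perm ({i} :: {j} :: (R.erase X).erase Y) := by
        rw [← List.perm_cons Y]
        exact (et.trans (((eY.cons _).trans (.swap _ _ _)).cons _)).trans (.swap _ _ _)
      have hRXY : ∀ I ∈ (R.erase X).erase Y, #I = 2 := fun I hI => hRX I (List.mem_of_mem_erase hI)
      have eXY : (X :: {i, j} :: R.erase X).Perm (X :: Y :: {i, j} :: (R.erase X).erase Y) :=
        ((eY.cons _).trans (.swap _ _ _)).cons _
      have hX' : ∀ I ∈ X :: {i, j} :: R.erase X, #I = 2 := by simpa [hc, hXc] using hRX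
      rw [w_tail_perm b X Y es, eq_neg_iff_add_eq_zero, nf_perm (.inl rfl) eXY
        ((Ok.perm (((eX.cons _).trans (.swap _ _ _)).cons _)).1 hO₂) hX']
      exact w_E1 ((Ok.perm ((es.cons Y).cons X)).1 hO) hXc (hRX Y hY) hRXY

/-- Modulo `V ⊔ VTwo`, the class of `P b L` does not depend on the order of the sets. -/
lemma w_perm {L L' : List (Finset ℕ)} (e : L.Perm L') : w p b L = w p b L' := by
  by_cases hO : Ok b L
  swap
  · rw [w_of_not_ok hO, w_of_not_ok fun h => hO ((Ok.perm e).2 h)]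
  by_cases h : (∃ I ∈ L, 2 < #I) ∨ dfc L < 0 ∨ 2 < dfc L
  · rw [w_eq_zero h, w_eq_zero (by simpa only [e.mem_iff, dfc_perm e] using h)]
  push Not at h
  obtain ⟨hl, h0, h2⟩ := h
  have hO' := (Ok.perm e).1 hO
  obtain h | h | h : dfc L = 0 ∨ dfc L = 1 ∨ dfc L = 2 := by omega
  · refine eq_of_perm_of_swaps (Q := fun R => Ok b R ∧ ∀ I ∈ R, #I = 2)
      (fun L L' e h => ⟨(Ok.perm e).1 h.1, fun I hI => h.2 I (e.mem_iff.2 hI)⟩)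
      (fun X Y _ _ h => w_tail_perm b X Y h) (fun A B r ⟨hO, h⟩ => ?_) (fun A B C r ⟨hO, h⟩ => ?_)
      e ⟨hO, card_eq_two_of_dfc hl h⟩
    · simp only [List.mem_cons, forall_eq_or_imp] at h
      exact w_H1 hO h.1 h.2.1 h.2.2
    · simp only [List.mem_cons, forall_eq_or_imp] at h
      exact w_H2 hO h.1 h.2.1 h.2.2.1 h.2.2.2
  · obtain ⟨k, R, eR, hR⟩ := exists_perm_of_dfc_one hl h
    rw [w_eq_nf (.inr ⟨k, rfl⟩) eR hO hR, w_eq_nf (.inr ⟨k, rfl⟩) (e.symm.trans eR) hO' hR]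
  · obtain ⟨R, eR, hR⟩ | ⟨i, j, R, eR, hR⟩ := exists_perm_of_dfc_two hl h
    · rw [w_eq_nf (.inl rfl) eR hO hR, w_eq_nf (.inl rfl) (e.symm.trans eR) hO' hR]
    · rw [w_merge eR hO hR, w_merge (e.symm.trans eR) hO' hR]

lemma w_four {i j k s : ℕ} {t : List (Finset ℕ)} (h : Ok b ({i} :: {j} :: {k} :: {s} :: t)) :
    w p b ({i, j} :: {k, s} :: t) + w p b ({i, k} :: {j, s} :: t)
      + w p b ({i, s} :: {j, k} :: t) = 0 := by
  have hd : i ≠ j ∧ i ≠ k ∧ i ≠ s ∧ j ≠ k ∧ j ≠ s ∧ k ≠ s := by simp [ok_cons] at h; grind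
  obtain ⟨hij, hik, his, hjk, hjs, hks⟩ := hd
  have hO : ∀ {A B}, (A = {i, j} ∧ B = {k, s}) ∨ (A = {i, k} ∧ B = {j, s}) ∨
      (A = {i, s} ∧ B = {j, k}) → Ok b (A :: B :: t) ∧ #A = 2 := by
    rintro A B (⟨rfl, rfl⟩ | ⟨rfl, rfl⟩ | ⟨rfl, rfl⟩) <;>
      exact ⟨by simp [ok_cons] at h ⊢; grind, Finset.card_pair (by assumption)⟩
  by_cases ht : (∃ I ∈ t, 2 < #I) ∨ dfc t < 0 ∨ 2 < dfc t
  · have H : ∀ A B : Finset ℕ, #A = 2 → #B = 2 → w p b (A :: B :: t) = 0 := by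
      intro A B hA hB
      refine w_eq_zero (ht.imp (fun ⟨I, hI, h⟩ => ⟨I, by simp [hI], h⟩) fun h => ?_)
      simpa [hA, hB] using h
    rw [H, H, H] <;> simp [*]
  push Not at ht
  obtain ⟨hl, h0, h2⟩ := ht
  obtain hd | hd | hd : dfc t = 0 ∨ dfc t = 1 ∨ dfc t = 2 := by omega
  · have := w_H3 (p := p) h (card_eq_two_of_dfc hl hd)
    rw [Finset.pair_comm k j] at this
    linear_combination (norm := module) this
  · obtain ⟨l, r, e, hr⟩ := exists_perm_of_dfc_one hl hd
    rw [w_tail_perm b _ _ e, w_tail_perm b _ _ e, w_tail_perm b _ _ e]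
    have := w_G5 (p := p) ((Ok.perm ((((e.cons _).cons _).cons _).cons _)).1 h) hr
    linear_combination (norm := module) this
  · obtain ⟨r, e, hr⟩ | ⟨l, m, r, e, hr⟩ := exists_perm_of_dfc_two hl hd
    all_goals
      have h' := (Ok.perm ((((e.cons _).cons _).cons _).cons _)).1 h
      rw [w_tail_perm b _ _ e, w_tail_perm b _ _ e, w_tail_perm b _ _ e]
    · have := w_E9 (p := p) (b := b) (i := i) (j := j) (k := k) (s := s) (r := r)
        (by simp [ok_cons] at h' ⊢; grind) hr
      linear_combination (norm := module) this
    · have hlm : l ≠ m := by simp [ok_cons] at h'; grind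
      -- E1 merges the singletons `l` and `m` of the tail in all three terms, leaving E9 with `{l,
      -- m}` as an additional pair.
      have h9 := w_E9 (p := p) (b := b) (i := i) (j := j) (k := k) (s := s) (r := {l, m} :: r)
        (by simp [ok_cons] at h' ⊢; grind) (by simpa [Finset.card_pair hlm] using hr)
      have h1 := w_E1 (p := p) (b := b) (A := {i, j}) (B := {k, s}) (i := l) (j := m) (r := r)
        (by simp [ok_cons] at h' ⊢; grind) (Finset.card_pair hij) (Finset.card_pair hks) hr
      have h2 := w_E1 (p := p) (b := b) (A := {i, k}) (B := {j, s}) (i := l) (j := m) (r := r)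
        (by simp [ok_cons] at h' ⊢; grind) (Finset.card_pair hik) (Finset.card_pair hjs) hr
      have h3 := w_E1 (p := p) (b := b) (A := {i, s}) (B := {j, k}) (i := l) (j := m) (r := r)
        (by simp [ok_cons] at h' ⊢; grind) (Finset.card_pair his) (Finset.card_pair hjk) hr
      linear_combination (norm := module) h1 + h2 + h3 - h9

lemma w_three {i j k : ℕ} {t : List (Finset ℕ)} (h : Ok b ({i} :: {j} :: {k} :: t)) :
    w p b ({i} :: {j, k} :: t) + w p b ({j} :: {i, k} :: t) + w p b ({k} :: {i, j} :: t) = 0 := by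
  have hd : i ≠ j ∧ i ≠ k ∧ j ≠ k := by simp [ok_cons] at h; grind
  obtain ⟨hij, hik, hjk⟩ := hd
  by_cases ht : (∃ I ∈ t, 2 < #I) ∨ dfc t < 0 ∨ 1 < dfc t
  · have H : ∀ A B : Finset ℕ, #A = 1 → #B = 2 → w p b (A :: B :: t) = 0 := by
      intro A B hA hB
      refine w_eq_zero (ht.elim (fun ⟨I, hI, h⟩ => .inl ⟨I, by simp [hI], h⟩) fun h => ?_)
      by_cases hl : ∃ I ∈ t, 2 < #I
      · obtain ⟨I, hI, h⟩ := hl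
        exact .inl ⟨I, by simp [hI], h⟩
      · push Not at hl
        have := dfc_nonneg hl
        simp [hA, hB]; omega
    rw [H, H, H] <;> simp [*]
  push Not at ht
  obtain ⟨hl, h0, h1⟩ := ht
  obtain hd | hd : dfc t = 0 ∨ dfc t = 1 := by omega
  · have hr := card_eq_two_of_dfc hl hd
    rcases t with _ | ⟨C, r⟩
    · exact w_D4 h
    · simp only [List.mem_cons, forall_eq_or_imp] at hr
      have hO : Ok b (C :: {i} :: {j} :: {k} :: r) :=
        (Ok.perm (List.perm_middle (l₁ := [{i}, {j}, {k}]))).1 h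
      have h6 := w_G6 (p := p) hO hr.1 hr.2
      -- G6 has a pair in the first slot, so order independence is used to bring `C` there.
      have e : ∀ X Y : Finset ℕ, w p b (X :: Y :: C :: r) = w p b (C :: Y :: X :: r) :=
        fun X Y => w_perm (((List.Perm.swap _ _ _).trans ((List.Perm.swap _ _ _).cons _)).trans
          (.swap _ _ _))
      rw [e, e, e, Finset.pair_comm j k]
      linear_combination (norm := module) h6
  · obtain ⟨l, r, e, hr⟩ := exists_perm_of_dfc_one hl hd
    have h' := (Ok.perm (((e.cons _).cons _).cons _)).1 h
    rw [w_tail_perm b _ _ e, w_tail_perm b _ _ e, w_tail_perm b _ _ e]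
    -- E3 merges the leading singleton of each term with `l`; the results are the three pairings of
    -- `l, i, j, k`.
    have h9 := w_E9 (p := p) (b := b) (i := l) (j := i) (k := j) (s := k) (r := r)
      (by simp [ok_cons] at h' ⊢; grind) hr
    have h1 := w_E3 (p := p) (b := b) (i := i) (B := {j, k}) (j := l) (r := r)
      (by simp [ok_cons] at h' ⊢; grind) (Finset.card_pair hjk) hr
    have h2 := w_E3 (p := p) (b := b) (i := j) (B := {i, k}) (j := l) (r := r)
      (by simp [ok_cons] at h' ⊢; grind) (Finset.card_pair hik) hr
    have h3 := w_E3 (p := p) (b := b) (i := k) (B := {i, j}) (j := l) (r := r)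
      (by simp [ok_cons] at h' ⊢; grind) (Finset.card_pair hij) hr
    rw [Finset.pair_comm l j, Finset.pair_comm l i, Finset.pair_comm l k] at h9
    linear_combination (norm := module) h1 + h2 + h3 - h9

lemma symRel_mkQ_eq_zero {u : F p} (h : SymRel p u) : (V p ⊔ VTwo p).mkQ u = 0 := by
  cases h with
  | zc I h =>
    refine mkQ_of_mem_V (Submodule.subset_span (.inl (.inl (.inl ⟨[I], ?_, ?_, rfl⟩))))
    · simp [IsBasisIndex]
    · simpa [IsZ] using h
  | dfc b L _ h => exact w_eq_zero (.inr h)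
  | large b L h => exact w_eq_zero (.inl h)
  | swap_two b X Y t =>
    rw [map_sub, sub_eq_zero]
    exact w_perm (.swap _ _ _)
  | swap_three b X Y Z t =>
    rw [map_sub, sub_eq_zero]
    exact w_perm (((List.Perm.swap _ _ _).trans ((List.Perm.swap _ _ _).cons _)).trans
      (.swap _ _ _))
  | merge b i j t hij =>
    rw [map_add]
    change w p b _ + w p b _ = 0
    by_cases hO : Ok b ({i} :: {j} :: t)
    swap
    · rw [w_of_not_ok hO, w_of_not_ok fun h => hO (by simp [ok_cons] at h ⊢; grind), add_zero]
    by_cases ht : ∀ I ∈ t, #I = 2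
    · rw [w_merge (.refl _) hO ht, w_eq_nf (.inl rfl) (.refl _) (ok_pair hO), neg_add_cancel]
      simpa [card_pair_of_ok hO] using ht
    -- The two leading sets already contribute deficit two, so a tail not made of pairs has a large
    -- set or pushes the deficit beyond two.
    have H : ∀ A B : Finset ℕ, #A + #B = 2 → w p b (A :: B :: t) = 0 := by
      intro A B hAB
      refine w_eq_zero ?_
      by_cases hl : ∃ I ∈ t, 2 < #I
      · obtain ⟨I, hI, h⟩ := hl
        exact .inl ⟨I, by simp [hI], h⟩
      · push Not at hl
        have h0 := dfc_nonneg hl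
        have h1 : dfc t ≠ 0 := fun h => ht (card_eq_two_of_dfc hl h)
        simp; omega
    rw [H _ _ (by simp), H _ _ (by simp [Finset.card_pair hij]), add_zero]
  | three b i j k t hij hik hjk =>
    rw [map_add, map_add]
    change w p b _ + w p b _ + w p b _ = 0
    by_cases hO : Ok b ({i} :: {j} :: {k} :: t)
    · exact w_three hO
    · rw [w_of_not_ok fun h => hO (by simp [ok_cons] at h ⊢; grind),
        w_of_not_ok fun h => hO (by simp [ok_cons] at h ⊢; grind),
        w_of_not_ok fun h => hO (by simp [ok_cons] at h ⊢; grind), add_zero, add_zero]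
  | four b i j k s t hij hik his hjk hjs hks =>
    rw [map_add, map_add]
    change w p b _ + w p b _ + w p b _ = 0
    by_cases hO : Ok b ({i} :: {j} :: {k} :: {s} :: t)
    · exact w_four hO
    · rw [w_of_not_ok fun h => hO (by simp [ok_cons] at h ⊢; grind),
        w_of_not_ok fun h => hO (by simp [ok_cons] at h ⊢; grind),
        w_of_not_ok fun h => hO (by simp [ok_cons] at h ⊢; grind), add_zero, add_zero]

lemma symSpan_le : SymSpan p ≤ V p ⊔ VTwo p :=
  Submodule.span_le.2 fun _ h => (Submodule.Quotient.mk_eq_zero _).1 (symRel_mkQ_eq_zero h)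

end

end

end MetabelianLie

theorem lemma3p2 (p : ℕ) [Fact p.Prime] (hp : p ≠ 2) :
    (MetabelianLie.J p).toSubmodule = MetabelianLie.V p ⊔ MetabelianLie.VTwo p :=
  le_antisymm (MetabelianLie.J_le_symSpan.trans MetabelianLie.symSpan_le)
    (MetabelianLie.V_sup_VTwo_le_J hp)
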